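/- Let $\Omega\subset\mathbb{R}^d$ be a convex body, that is, a compact convex set with nonempty interior, whose boundary $\partial\Omega$ is smooth ($C^\infty$) and has positive Gaussian curvature at every point. Let $$\widehat{\chi_\Omega}(\xi)=\int_\Omega e^{-2\pi i\,\xi\cdot x}\,dx,\qquad \xi\in\mathbb{R}^d,$$ be the Fourier transform of its characteristic function. Then there exists a constant $C>0$, depending only on $\Omega$ (and so on $d$), such that for every $\Theta\in\mathbb{R}^d$ with $|\Theta|=1$ and every $\rho\ge 1$, $$\int_\rho^{\rho+1}\left|\widehat{\chi_\Omega}(s\Theta)\right|^2\,ds\;\ge\; C\,\rho^{-(d+1)}.$$ (For $d=1$ the Gaussian curvature of the boundary, an empty product, is $1$.) -/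

import Mathlib

open MeasureTheory Set
open scoped FourierTransform ContDiff RealInnerProductSpace

noncomputable section

/-- `f` is a smooth (`C^∞`) local defining function of `Ω` at `p`: in an open neighbourhood `U`
of `p`, `f` is smooth and `Ω` is the sublevel set `{f ≤ 0}`, and `∇ f p ≠ 0`. -/
def IsLocalDefiningFunction {d : ℕ} (Ω : Set (EuclideanSpace ℝ (Fin d)))
    (f : EuclideanSpace ℝ (Fin d) → ℝ) (p : EuclideanSpace ℝ (Fin d)) : Prop :=
  gradient f p ≠ 0 ∧
    ∃ U : Set (EuclideanSpace ℝ (Fin d)), IsOpen U ∧ p ∈ U ∧ ContDiffOn ℝ ∞ f U ∧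
      ∀ x ∈ U, x ∈ Ω ↔ f x ≤ 0

/-- `∂Ω` is smooth: `Ω` has a smooth local defining function at each of its boundary points. -/
def HasSmoothBoundary {d : ℕ} (Ω : Set (EuclideanSpace ℝ (Fin d))) : Prop :=
  ∀ p ∈ frontier Ω, ∃ f : EuclideanSpace ℝ (Fin d) → ℝ, IsLocalDefiningFunction Ω f p

/-- The unit normal field `∇ f / ‖∇ f‖` of the level sets of `f`. It is the outward unit normal
of `{f ≤ 0}` on `{f = 0}`. -/
def unitNormal {d : ℕ} (f : EuclideanSpace ℝ (Fin d) → ℝ) (x : EuclideanSpace ℝ (Fin d)) :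
    EuclideanSpace ℝ (Fin d) :=
  ‖gradient f x‖⁻¹ • gradient f x

/-- The tangent space at `p` of the level set of `f` through `p`: the orthogonal complement of
the normal. -/
def tangentHyperplane {d : ℕ} (f : EuclideanSpace ℝ (Fin d) → ℝ)
    (p : EuclideanSpace ℝ (Fin d)) : Submodule ℝ (EuclideanSpace ℝ (Fin d)) :=
  (Submodule.span ℝ {gradient f p})ᗮ

/-- The Weingarten map (shape operator) at `p` of the level set of `f` through `p`: the
derivative of the unit normal field along the tangent space, as an endomorphism of the tangent
space. The derivative of a unit field takes tangent values, so the orthogonal projection only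
serves to restrict the codomain. -/
def weingartenMap {d : ℕ} (f : EuclideanSpace ℝ (Fin d) → ℝ) (p : EuclideanSpace ℝ (Fin d)) :
    tangentHyperplane f p →ₗ[ℝ] tangentHyperplane f p :=
  ((tangentHyperplane f p).orthogonalProjectionOnto ∘L fderiv ℝ (unitNormal f) p ∘L
    (tangentHyperplane f p).subtypeL).toLinearMap

/-- The Gaussian curvature at `p` of the level set of `f` through `p`: the determinant of the
Weingarten map, that is, the product of the principal curvatures with respect to the normal
`∇ f / ‖∇ f‖`. -/
def levelSetGaussianCurvature {d : ℕ} (f : EuclideanSpace ℝ (Fin d) → ℝ)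
    (p : EuclideanSpace ℝ (Fin d)) : ℝ :=
  LinearMap.det (weingartenMap f p)

/-- The Gaussian curvature of `∂Ω`, with respect to the outward normal, is positive at every
boundary point. The curvature at `p` depends only on `Ω` and not on the local defining function
with which it is computed, so that it does not matter which one is used. -/
def HasPositiveGaussianCurvature {d : ℕ} (Ω : Set (EuclideanSpace ℝ (Fin d))) : Prop :=
  ∀ p ∈ frontier Ω, ∃ f : EuclideanSpace ℝ (Fin d) → ℝ,
    IsLocalDefiningFunction Ω f p ∧ 0 < levelSetGaussianCurvature f p

/-- The Fourier transform of the characteristic function of `Ω`,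
`ξ ↦ ∫_Ω exp (-2 π i ⟪x, ξ⟫) dx`. -/
def fourierIndicator {d : ℕ} (Ω : Set (EuclideanSpace ℝ (Fin d))) :
    EuclideanSpace ℝ (Fin d) → ℂ :=
  𝓕 (Ω.indicator (fun _ => (1 : ℂ)))

end

/-! Fix a unit vector `Θ` and let `P`, `Q` be the points of `Ω` where `⟪Θ, ·⟫` is largest and
smallest (the poles). Put `a = (d + 1) / 2`. Up to a rapidly decaying error, the transform at `σΘ`
is `X(σ) = e(-σ⟪Θ, P⟫) A(σ) + e(-σ⟪Θ, Q⟫) B(σ)` with `e(t) = exp(2πit)`, where `|A| ≥ c σ^(-a)` and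
`|A'|`, `|B'|` are at most `C σ^(-1-a)`. Over a fixed step `δ` the amplitudes barely move, while the
exponentials are multiplied by different unimodular numbers `f` and `g`. In `X(σ + δ) - g X(σ)` the
term with `B` cancels and `(f - g) A`, of order `σ^(-a)`, is left. So `|X(σ)| + |X(σ + δ)|` is at
least a multiple of `σ^(-a)`, and squaring and integrating gives the bound
(`exists_le_integral_norm_sq`).

The amplitudes are estimated without a stationary phase expansion. Near a pole `∂Ω = {F = 0}` with
`F` a strictly convex graph function, and `parabolicField` is a vector field `V`, tangent to `∂Ω`,
which imitates the parabolic dilations about `p`: it has constant divergence `a`, and the phase `u =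
F'(p)(p - x)` satisfies `V u = u` up to a cubic error. Since `(1 - V) exp(isu) = (1 - is V u)
exp(isu)`, repeated integration by parts along `V` has no boundary terms and gains powers of `(1 +
|s| u)⁻¹`. As caps of height `ε` have volume at most a multiple of `ε^a`, this bounds the pole
integral `I(s)` by a multiple of `|s|^(-a)` for complex `s` in the open right half-plane with `Im s
≥ 0` and `|s| ≥ 1` (`exists_norm_integral_le`).

The divergence theorem for `η exp(isu) V` yields Euler's relation `a I + s I' = O(|s|^(-a - 1/2))`
(`exists_norm_euler_le`). This bounds `I'`, and it shows that `s^a I(s)` is nearly constant on the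
quarter circle `|s| = R`. At `s = iR` the integrand is `η exp(-Ru) ≥ 0`, and the cap of height `1/R`
gives a lower bound of order `R^(-a)`. Rotating to the real axis preserves it
(`exists_poleIntegral_bounds`).

Away from the poles some tangent field moves `⟪Θ, x⟫` at positive speed, and the same integration by
parts gives rapid decay (`exists_nhds_rapid_decay`). The graph functions come from the implicit
function theorem; convexity makes their Hessians nonnegative and nonzero curvature makes them
definite on the tangent space (`exists_isStrictGraph`). All bounds are uniform for directions near a
given one, so compactness of the sphere settles large `ρ`. For bounded `ρ` the mean is continuous
and positive, because the transform is analytic along each line. -/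

open Filter Topology

/-! ### Derivatives along vector fields. -/

section DirDeriv

variable {E : Type*} [NormedAddCommGroup E] [NormedSpace ℝ E]
variable {W : Type*} [NormedAddCommGroup W] [NormedSpace ℝ W]

/-- The derivative of `g` along the vector field `V`. -/
noncomputable def dirDeriv (V : E → E) (g : E → W) : E → W := fun x => fderiv ℝ g x (V x)

lemma ContDiff.dirDeriv {V : E → E} {g : E → W} (hg : ContDiff ℝ ∞ g) (hV : ContDiff ℝ ∞ V) :
    ContDiff ℝ ∞ (dirDeriv V g) :=
  (hg.fderiv_right (m := ∞) (by simp)).clm_apply hV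

lemma dirDeriv_mul {V : E → E} {g h : E → ℂ} (hg : ContDiff ℝ ∞ g) (hh : ContDiff ℝ ∞ h) :
    dirDeriv V (fun x => g x * h x) = fun x => dirDeriv V g x * h x + g x * dirDeriv V h x := by
  funext x
  have h1 := (hg.differentiable (by simp)) x
  have h2 := (hh.differentiable (by simp)) x
  simp only [dirDeriv]
  rw [fderiv_fun_mul h1 h2]
  simp
  ring

lemma dirDeriv_add {V : E → E} {g h : E → W} (hg : ContDiff ℝ ∞ g) (hh : ContDiff ℝ ∞ h) :
    dirDeriv V (fun x => g x + h x) = fun x => dirDeriv V g x + dirDeriv V h x := by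
  funext x
  have h1 := (hg.differentiable (by simp)) x
  have h2 := (hh.differentiable (by simp)) x
  simp only [dirDeriv]
  rw [fderiv_fun_add h1 h2]
  simp

lemma dirDeriv_const_mul {V : E → E} (c : ℂ) {g : E → ℂ} (hg : ContDiff ℝ ∞ g) :
    dirDeriv V (fun x => c * g x) = fun x => c * dirDeriv V g x := by
  funext x
  have h1 := (hg.differentiable (by simp)) x
  simp only [dirDeriv]
  rw [fderiv_const_mul h1]
  simp

lemma dirDeriv_ofReal {V : E → E} {g : E → ℝ} (hg : ContDiff ℝ ∞ g) :
    dirDeriv V (fun x => (g x : ℂ)) = fun x => ((dirDeriv V g x : ℝ) : ℂ) := by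
  funext x
  have h1 := (hg.differentiable (by simp)) x
  simp only [dirDeriv]
  have h2 : HasFDerivAt (fun x => (g x : ℂ)) (Complex.ofRealCLM.comp (fderiv ℝ g x)) x :=
    Complex.ofRealCLM.hasFDerivAt.comp x h1.hasFDerivAt
  rw [h2.fderiv]
  simp

lemma tsupport_dirDeriv_subset (V : E → E) (g : E → W) :
    tsupport (dirDeriv V g) ⊆ tsupport g := by
  refine closure_minimal (fun x hx => ?_) (isClosed_tsupport g)
  by_contra hx'
  have : fderiv ℝ g x = 0 := by
    by_contra h
    exact hx' (support_fderiv_subset ℝ (f := g) h)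
  exact hx (by simp [dirDeriv, this])

lemma ContDiff.complex_ofReal {g : E → ℝ} {n : WithTop ℕ∞} (hg : ContDiff ℝ n g) :
    ContDiff ℝ n (fun x => (g x : ℂ)) :=
  Complex.ofRealCLM.contDiff.comp hg

end DirDeriv

/-! ### The divergence theorem for fields tangent to the boundary. -/

section Divergence

variable {E : Type*} [NormedAddCommGroup E] [InnerProductSpace ℝ E] [FiniteDimensional ℝ E]

/-- The divergence of a vector field on a Euclidean space. -/
noncomputable def divergence (V : E → E) (x : E) : ℝ :=
  ∑ i, ⟪stdOrthonormalBasis ℝ E i, fderiv ℝ V x (stdOrthonormalBasis ℝ E i)⟫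

lemma ContDiff.divergence {V : E → E} (hV : ContDiff ℝ ∞ V) : ContDiff ℝ ∞ (divergence V) := by
  unfold _root_.divergence
  refine ContDiff.sum fun i _ => ?_
  exact contDiff_const.inner ℝ ((hV.fderiv_right (m := ∞) (by simp)).clm_apply contDiff_const)

variable [MeasurableSpace E] [BorelSpace E]

lemma integral_fderiv_apply_eq_zero {f : E → ℂ} (hf : ContDiff ℝ 1 f) (hs : HasCompactSupport f)
    (v : E) : ∫ x, fderiv ℝ f x v = 0 := by
  have hc : Continuous (fun x => fderiv ℝ f x v) :=
    (hf.continuous_fderiv (by simp)).clm_apply continuous_const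
  have hi : Integrable (fun x => fderiv ℝ f x v) :=
    hc.integrable_of_hasCompactSupport (hs.fderiv_apply (𝕜 := ℝ) v)
  have := integral_mul_fderiv_eq_neg_fderiv_mul_of_integrable (μ := (volume : Measure E))
    (f := fun _ : E => (1 : ℂ)) (g := f) (v := v) (by simp) (by simpa using hi)
    (by simpa using hf.continuous.integrable_of_hasCompactSupport hs) (by simp)
    (fun x _ => hf.differentiable (by simp) x)
  simpa using this

/-- The integrand is the divergence of `ψ V`. In an orthonormal basis it is a sum of directional
derivatives of compactly supported functions. -/
lemma integral_dirDeriv_add_divergence_mul {V : E → E} (hV : ContDiff ℝ ∞ V) {ψ : E → ℂ}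
    (hψ : ContDiff ℝ ∞ ψ) (hs : HasCompactSupport ψ) :
    ∫ x, (dirDeriv V ψ x + (divergence V x : ℂ) * ψ x) = 0 := by
  let b := stdOrthonormalBasis ℝ E
  have hc : ∀ i, ContDiff ℝ ∞ (fun x => ((⟪b i, V x⟫ : ℝ) : ℂ)) := fun i =>
    (contDiff_const.inner ℝ hV).complex_ofReal
  have hm : ∀ i, ContDiff ℝ ∞ (fun x => ((⟪b i, V x⟫ : ℝ) : ℂ) * ψ x) := fun i => (hc i).mul hψ
  have key : ∀ x, dirDeriv V ψ x + (divergence V x : ℂ) * ψ x =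
      ∑ i, fderiv ℝ (fun x => ((⟪b i, V x⟫ : ℝ) : ℂ) * ψ x) x (b i) := by
    intro x
    have h2 := (hψ.differentiable (by simp)) x
    have hVx := (hV.differentiable (by simp)) x
    have h3 : ∀ i, fderiv ℝ (fun x => ((⟪b i, V x⟫ : ℝ) : ℂ) * ψ x) x (b i) =
        (⟪b i, V x⟫ : ℝ) * fderiv ℝ ψ x (b i) + (⟪b i, fderiv ℝ V x (b i)⟫ : ℝ) * ψ x := by
      intro i
      rw [fderiv_fun_mul ((hc i).differentiable (by simp) x) h2]
      have h4 : HasFDerivAt (fun x => ((⟪b i, V x⟫ : ℝ) : ℂ))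
          (Complex.ofRealCLM.comp ((innerSL ℝ (b i)).comp (fderiv ℝ V x))) x :=
        Complex.ofRealCLM.hasFDerivAt.comp x
          ((innerSL ℝ (b i)).hasFDerivAt.comp x hVx.hasFDerivAt)
      rw [h4.fderiv]
      simp [mul_comm]
    simp only [h3, Finset.sum_add_distrib, dirDeriv, divergence]
    congr 1
    · conv_lhs => rw [← b.sum_repr' (V x)]
      simp [map_sum]
    · push_cast
      rw [Finset.sum_mul]
  simp_rw [key]
  rw [integral_finsetSum]
  · refine Finset.sum_eq_zero fun i _ => ?_
    exact integral_fderiv_apply_eq_zero ((hm i).of_le (by simp)) (hs.mul_left) _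
  · intro i _
    have hs' : HasCompactSupport (fun x => ((⟪b i, V x⟫ : ℝ) : ℂ) * ψ x) := hs.mul_left
    exact (((hm i).continuous_fderiv (by simp)).clm_apply
      continuous_const).integrable_of_hasCompactSupport (hs'.fderiv_apply (𝕜 := ℝ) _)

/-- A vector field is tangent to (the boundary of) `Ω` in `U` if the divergence theorem holds
for it on `Ω` without a boundary term, for densities supported in `U`. -/
def TangentTo (Ω U : Set E) (V : E → E) : Prop :=
  ∀ ψ : E → ℂ, ContDiff ℝ ∞ ψ → HasCompactSupport ψ → tsupport ψ ⊆ U →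
    ∫ x in Ω, (dirDeriv V ψ x + (divergence V x : ℂ) * ψ x) = 0

/-- This majorant serves for dominated convergence in `tangentTo_of_dirDeriv_eq`: differentiating
the cutoff `smoothTransition (1 - k F)` along a field with `V F = a F` produces this function at `t
= k F`, so the bound is uniform in `k`. -/
lemma exists_bound_smoothTransition_deriv_mul :
    ∃ C : ℝ, ∀ t : ℝ, |deriv Real.smoothTransition (1 - t) * t| ≤ C := by
  have hc : Continuous (fun t : ℝ => deriv Real.smoothTransition (1 - t) * t) :=
    (((Real.smoothTransition.contDiff (n := 1)).continuous_deriv le_rfl).comp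
      (continuous_const.sub continuous_id)).mul continuous_id
  obtain ⟨C, hC⟩ := (isCompact_Icc (a := (0:ℝ)) (b := 1)).exists_bound_of_continuousOn
    hc.continuousOn
  refine ⟨C, fun t => ?_⟩
  have hC0 : 0 ≤ C := (norm_nonneg _).trans (hC 0 (by simp))
  by_cases ht : t ∈ Icc (0:ℝ) 1
  · exact hC t ht
  · have : deriv Real.smoothTransition (1 - t) = 0 := by
      rw [mem_Icc, not_and_or, not_le, not_le] at ht
      rcases ht with h | h
      · have : Real.smoothTransition =ᶠ[𝓝 (1 - t)] fun _ => 1 := by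
          filter_upwards [lt_mem_nhds (show (1:ℝ) < 1 - t by linarith)] with y hy
          exact Real.smoothTransition.one_of_one_le hy.le
        rw [this.deriv_eq]; simp
      · have : Real.smoothTransition =ᶠ[𝓝 (1 - t)] fun _ => 0 := by
          filter_upwards [gt_mem_nhds (show (1 - t : ℝ) < 0 by linarith)] with y hy
          exact Real.smoothTransition.zero_of_nonpos hy.le
        rw [this.deriv_eq]; simp
    simpa [this] using hC0

/-- For fixed `x` the number `(k + 1) F x` is either nonpositive for all `k` or eventually greater
than `1`, so this gives the pointwise limit zero. The value `t = 0` is covered by the factor `t`. -/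
lemma deriv_smoothTransition_mul_eq_zero {t : ℝ} (ht : t ≤ 0 ∨ 1 < t) :
    deriv Real.smoothTransition (1 - t) * t = 0 := by
  rcases ht with h | h
  · rcases h.eq_or_lt with rfl | h
    · simp
    have : Real.smoothTransition =ᶠ[𝓝 (1 - t)] fun _ => 1 := by
      filter_upwards [lt_mem_nhds (show (1:ℝ) < 1 - t by linarith)] with y hy
      exact Real.smoothTransition.one_of_one_le hy.le
    rw [this.deriv_eq]; simp
  · have : Real.smoothTransition =ᶠ[𝓝 (1 - t)] fun _ => 0 := by
      filter_upwards [gt_mem_nhds (show (1 - t : ℝ) < 0 by linarith)] with y hy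
      exact Real.smoothTransition.zero_of_nonpos hy.le
    rw [this.deriv_eq]; simp

/-- A vector field along which a defining function `F` satisfies `V F = a F` is tangent to
the sublevel set `{F ≤ 0}`. -/
theorem tangentTo_of_dirDeriv_eq {Ω U : Set E} (hΩ : MeasurableSet Ω) {V : E → E}
    (hV : ContDiff ℝ ∞ V)
    {F : E → ℝ} (hF : ContDiff ℝ ∞ F) (a : ℝ) (hU : ∀ x ∈ U, x ∈ Ω ↔ F x ≤ 0)
    (hVF : ∀ x ∈ U, dirDeriv V F x = a * F x) : TangentTo Ω U V := by
  intro ψ hψ hs hsU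
  set c := divergence V with hc
  have hcs : ContDiff ℝ ∞ c := hV.divergence
  set G : E → ℂ := fun x => dirDeriv V ψ x + (c x : ℂ) * ψ x with hG
  have hGs : ContDiff ℝ ∞ G := (hψ.dirDeriv hV).add (hcs.complex_ofReal.mul hψ)
  have hG0 : ∀ x, x ∉ tsupport ψ → G x = 0 := by
    intro x hx
    have h1 : dirDeriv V ψ x = 0 :=
      image_eq_zero_of_notMem_tsupport fun h => hx (tsupport_dirDeriv_subset V ψ h)
    have h2 : ψ x = 0 := image_eq_zero_of_notMem_tsupport hx
    simp [hG, h1, h2]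
  have hGc : HasCompactSupport G := HasCompactSupport.of_support_subset_isCompact hs
    (fun x hx => by by_contra h; exact hx (hG0 x h))
  have hGi : Integrable G := hGs.continuous.integrable_of_hasCompactSupport hGc
  -- Smooth approximations of the indicator function of `{F ≤ 0}`: equal to `1` on that set, and to
  -- `0` where `(k + 1) F ≥ 1`.
  let H : ℕ → E → ℝ := fun k x => Real.smoothTransition (1 - (k + 1) * F x)
  let g : ℝ → ℝ := fun t => deriv Real.smoothTransition (1 - t) * t
  have hgc : Continuous g :=
    (((Real.smoothTransition.contDiff (n := 1)).continuous_deriv le_rfl).comp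
      (continuous_const.sub continuous_id)).mul continuous_id
  obtain ⟨Cg, hCg⟩ := exists_bound_smoothTransition_deriv_mul
  have hH : ∀ k, ContDiff ℝ ∞ (H k) := fun k =>
    Real.smoothTransition.contDiff.comp (contDiff_const.sub (contDiff_const.mul hF))
  -- Because `V F = a F`, the large factor `k + 1` appears only in the product `(k + 1) F`, which is
  -- bounded where the derivative of the cutoff is nonzero.
  have hHd : ∀ k, ∀ x ∈ U, dirDeriv V (H k) x = - (a * g ((k + 1) * F x)) := by
    intro k x hx
    have h1 : HasFDerivAt F (fderiv ℝ F x) x := (hF.differentiable (by simp) x).hasFDerivAt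
    have h2 : HasFDerivAt (fun y => 1 - ((k:ℝ) + 1) * F y) (-(((k:ℝ) + 1) • fderiv ℝ F x)) x := by
      simpa using (h1.const_mul ((k:ℝ) + 1)).const_sub 1
    have h3 : HasDerivAt Real.smoothTransition
        (deriv Real.smoothTransition (1 - ((k:ℝ) + 1) * F x)) (1 - ((k:ℝ) + 1) * F x) :=
      ((Real.smoothTransition.contDiff (n := 1)).differentiable (by simp) _).hasDerivAt
    have h4 := h3.comp_hasFDerivAt x h2
    have h5 : fderiv ℝ (H k) x = _ := h4.fderiv
    have h6 := hVF x hx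
    simp only [dirDeriv] at h6 ⊢
    rw [h5]
    simp only [smul_apply, neg_apply, h6, g, smul_eq_mul]
    ring
  -- The divergence theorem on the whole space for `ψ H k`. As `k → ∞` the left side tends to the
  -- integral over `Ω` and the right side to zero.
  have hint : ∀ k, ∫ x, G x * (H k x : ℂ) = ∫ x, ψ x * ((a * g ((k + 1) * F x) : ℝ) : ℂ) := by
    intro k
    have h0 := integral_dirDeriv_add_divergence_mul hV (hψ.mul (hH k).complex_ofReal)
      (hs.mul_right)
    rw [← sub_eq_zero, ← h0, ← integral_sub]
    · refine integral_congr_ae (Eventually.of_forall fun x => ?_)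
      simp only
      rw [dirDeriv_mul hψ (hH k).complex_ofReal, dirDeriv_ofReal (hH k)]
      by_cases hx : x ∈ tsupport ψ
      · simp only [hHd k x (hsU hx), hG]
        push_cast
        ring
      · have h2 : ψ x = 0 := image_eq_zero_of_notMem_tsupport hx
        simp [hG, h2]
    · refine (hGs.continuous.mul (hH k).complex_ofReal.continuous).integrable_of_hasCompactSupport
        hGc.mul_right
    · refine (hψ.continuous.mul ?_).integrable_of_hasCompactSupport hs.mul_right
      exact Complex.continuous_ofReal.comp (continuous_const.mul (hgc.comp
        (continuous_const.mul hF.continuous)))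
  have lim1 : Tendsto (fun k : ℕ => ∫ x, G x * (H k x : ℂ)) atTop
      (𝓝 (∫ x, {x | F x ≤ 0}.indicator G x)) := by
    refine tendsto_integral_of_dominated_convergence (fun x => ‖G x‖) (fun k => ?_) hGi.norm
      (fun k => Eventually.of_forall fun x => ?_) (Eventually.of_forall fun x => ?_)
    · exact (hGs.continuous.mul (hH k).complex_ofReal.continuous).aestronglyMeasurable
    · rw [norm_mul]
      refine mul_le_of_le_one_right (norm_nonneg _) ?_
      rw [Complex.norm_real, Real.norm_eq_abs, abs_of_nonneg (Real.smoothTransition.nonneg _)]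
      exact Real.smoothTransition.le_one _
    · by_cases hx : F x ≤ 0
      · rw [indicator_of_mem (by exact hx)]
        refine tendsto_const_nhds.congr fun k => ?_
        have : H k x = 1 := Real.smoothTransition.one_of_one_le (by nlinarith)
        simp [this]
      · rw [indicator_of_notMem (by exact hx)]
        rw [not_le] at hx
        refine tendsto_const_nhds.congr' ?_
        have h1 : Tendsto (fun k : ℕ => ((k:ℝ) + 1) * F x) atTop atTop :=
          (tendsto_natCast_atTop_atTop.atTop_add (tendsto_const_nhds (x := (1:ℝ)))).atTop_mul_const hx
        filter_upwards [h1.eventually_ge_atTop 1] with k hk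
        have : H k x = 0 := Real.smoothTransition.zero_of_nonpos (by linarith)
        simp [this]
  have lim2 : Tendsto (fun k : ℕ => ∫ x, ψ x * ((a * g ((k + 1) * F x) : ℝ) : ℂ)) atTop
      (𝓝 (∫ x : E, (0 : ℂ))) := by
    refine tendsto_integral_of_dominated_convergence (fun x => ‖ψ x‖ * (|a| * Cg)) (fun k => ?_)
      ((hψ.continuous.integrable_of_hasCompactSupport hs).norm.mul_const _)
      (fun k => Eventually.of_forall fun x => ?_) (Eventually.of_forall fun x => ?_)
    · exact (hψ.continuous.mul (Complex.continuous_ofReal.comp (continuous_const.mul (hgc.comp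
        (continuous_const.mul hF.continuous))))).aestronglyMeasurable
    · rw [norm_mul, Complex.norm_real, Real.norm_eq_abs, abs_mul]
      gcongr
      exact hCg _
    · refine tendsto_const_nhds.congr' ?_
      by_cases hx : F x ≤ 0
      · refine Eventually.of_forall fun k => ?_
        have : g (((k:ℝ) + 1) * F x) = 0 :=
          deriv_smoothTransition_mul_eq_zero (Or.inl (by nlinarith))
        simp [this]
      · rw [not_le] at hx
        have h1 : Tendsto (fun k : ℕ => ((k:ℝ) + 1) * F x) atTop atTop :=
          (tendsto_natCast_atTop_atTop.atTop_add (tendsto_const_nhds (x := (1:ℝ)))).atTop_mul_const hx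
        filter_upwards [h1.eventually_gt_atTop 1] with k hk
        have : g (((k:ℝ) + 1) * F x) = 0 :=
          deriv_smoothTransition_mul_eq_zero (Or.inr hk)
        simp [this]
  have heq := tendsto_nhds_unique (lim1.congr hint) lim2
  rw [integral_zero] at heq
  rw [← heq, ← integral_indicator hΩ]
  refine integral_congr_ae (Eventually.of_forall fun x => ?_)
  by_cases hx : x ∈ tsupport ψ
  · simp only [indicator]
    have := hU x (hsU hx)
    by_cases h : x ∈ Ω
    · have h' : x ∈ {x | F x ≤ 0} := this.1 h
      simp [h, h', hG]
    · have h' : x ∉ {x | F x ≤ 0} := fun hh => h (this.2 hh)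
      simp only [h, h', if_false]
  · have h := hG0 x hx
    simp only [indicator]
    simp only [hG] at h
    simp [h, hG]

end Divergence

/-! ### Symbol calculus: iterated derivatives bounded uniformly in a family. -/

section SymbolBounds

variable {E : Type*} [NormedAddCommGroup E] [NormedSpace ℝ E] {ι : Type*}

/-- The iterated derivatives up to order `k` of the family of functions `g i` along the vector
fields `V i` are bounded on `S i` by a uniform multiple of the weight `w i`. -/
def SymbolBound (V : ι → E → E) (S : ι → Set E) : ℕ → (ι → E → ℝ) → (ι → E → ℂ) → Prop
  | 0, w, g => ∃ C, 0 ≤ C ∧ ∀ i, ∀ x ∈ S i, ‖g i x‖ ≤ C * w i x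
  | k + 1, w, g => (∃ C, 0 ≤ C ∧ ∀ i, ∀ x ∈ S i, ‖g i x‖ ≤ C * w i x) ∧
      SymbolBound V S k w (fun i => dirDeriv (V i) (g i))

variable {V : ι → E → E} {S : ι → Set E} {w w' : ι → E → ℝ} {g h : ι → E → ℂ}

namespace SymbolBound

lemma bound {k : ℕ} (hg : SymbolBound V S k w g) :
    ∃ C, 0 ≤ C ∧ ∀ i, ∀ x ∈ S i, ‖g i x‖ ≤ C * w i x := by
  cases k with
  | zero => exact hg
  | succ k => exact hg.1

lemma of_succ {k : ℕ} (hg : SymbolBound V S (k + 1) w g) : SymbolBound V S k w g := by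
  induction k generalizing g with
  | zero => exact hg.1
  | succ k ih => exact ⟨hg.1, ih hg.2⟩

lemma mono {k : ℕ} (hg : SymbolBound V S k w g)
    (hw : ∃ C, 0 ≤ C ∧ ∀ i, ∀ x ∈ S i, w i x ≤ C * w' i x) : SymbolBound V S k w' g := by
  obtain ⟨C', hC', h'⟩ := hw
  have key : ∀ {g : ι → E → ℂ}, (∃ C, 0 ≤ C ∧ ∀ i, ∀ x ∈ S i, ‖g i x‖ ≤ C * w i x) →
      (∃ C, 0 ≤ C ∧ ∀ i, ∀ x ∈ S i, ‖g i x‖ ≤ C * w' i x) := by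
    rintro g ⟨C, hC, hh⟩
    refine ⟨C * C', by positivity, fun i x hx => (hh i x hx).trans ?_⟩
    rw [mul_assoc]
    exact mul_le_mul_of_nonneg_left (h' i x hx) hC
  induction k generalizing g with
  | zero => exact key hg
  | succ k ih => exact ⟨key hg.1, ih hg.2⟩

lemma add {k : ℕ} (hg : SymbolBound V S k w g) (hh : SymbolBound V S k w h)
    (sg : ∀ i, ContDiff ℝ ∞ (g i)) (sh : ∀ i, ContDiff ℝ ∞ (h i)) (sV : ∀ i, ContDiff ℝ ∞ (V i)) :
    SymbolBound V S k w (fun i x => g i x + h i x) := by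
  have key : ∀ {g h : ι → E → ℂ}, (∃ C, 0 ≤ C ∧ ∀ i, ∀ x ∈ S i, ‖g i x‖ ≤ C * w i x) →
      (∃ C, 0 ≤ C ∧ ∀ i, ∀ x ∈ S i, ‖h i x‖ ≤ C * w i x) →
      (∃ C, 0 ≤ C ∧ ∀ i, ∀ x ∈ S i, ‖g i x + h i x‖ ≤ C * w i x) := by
    rintro g h ⟨C, hC, h1⟩ ⟨C', hC', h2⟩
    refine ⟨C + C', by positivity, fun i x hx => (norm_add_le _ _).trans ?_⟩
    rw [add_mul]
    exact add_le_add (h1 i x hx) (h2 i x hx)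
  induction k generalizing g h with
  | zero => exact key hg hh
  | succ k ih =>
    refine ⟨key hg.1 hh.1, ?_⟩
    simp only [fun i => dirDeriv_add (V := V i) (sg i) (sh i)]
    exact ih hg.2 hh.2 (fun i => (sg i).dirDeriv (sV i)) (fun i => (sh i).dirDeriv (sV i))

lemma const_mul {k : ℕ} (c : ι → ℂ) (hc : ∃ C, ∀ i, ‖c i‖ ≤ C)
    (hg : SymbolBound V S k w g)
    (sg : ∀ i, ContDiff ℝ ∞ (g i)) (sV : ∀ i, ContDiff ℝ ∞ (V i)) :
    SymbolBound V S k w (fun i x => c i * g i x) := by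
  have key : ∀ {g : ι → E → ℂ}, (∃ C, 0 ≤ C ∧ ∀ i, ∀ x ∈ S i, ‖g i x‖ ≤ C * w i x) →
      (∃ C, 0 ≤ C ∧ ∀ i, ∀ x ∈ S i, ‖c i * g i x‖ ≤ C * w i x) := by
    rintro g ⟨C, hC, h1⟩
    obtain ⟨C', h2⟩ := hc
    refine ⟨|C'| * C, by positivity, fun i x hx => ?_⟩
    rw [norm_mul, mul_assoc]
    exact mul_le_mul ((h2 i).trans (le_abs_self _)) (h1 i x hx) (norm_nonneg _) (abs_nonneg _)
  induction k generalizing g with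
  | zero => exact key hg
  | succ k ih =>
    refine ⟨key hg.1, ?_⟩
    simp only [fun i => dirDeriv_const_mul (V := V i) (c i) (sg i)]
    exact ih hg.2 (fun i => (sg i).dirDeriv (sV i))

lemma mul {k : ℕ} (hg : SymbolBound V S k w g) (hh : SymbolBound V S k w' h)
    (sg : ∀ i, ContDiff ℝ ∞ (g i)) (sh : ∀ i, ContDiff ℝ ∞ (h i)) (sV : ∀ i, ContDiff ℝ ∞ (V i)) :
    SymbolBound V S k (fun i x => w i x * w' i x) (fun i x => g i x * h i x) := by
  have key : ∀ {g h : ι → E → ℂ}, (∃ C, 0 ≤ C ∧ ∀ i, ∀ x ∈ S i, ‖g i x‖ ≤ C * w i x) →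
      (∃ C, 0 ≤ C ∧ ∀ i, ∀ x ∈ S i, ‖h i x‖ ≤ C * w' i x) →
      (∃ C, 0 ≤ C ∧ ∀ i, ∀ x ∈ S i, ‖g i x * h i x‖ ≤ C * (w i x * w' i x)) := by
    rintro g h ⟨C, hC, h1⟩ ⟨C', hC', h2⟩
    refine ⟨C * C', by positivity, fun i x hx => ?_⟩
    rw [norm_mul, mul_mul_mul_comm]
    exact mul_le_mul (h1 i x hx) (h2 i x hx) (norm_nonneg _) ((norm_nonneg _).trans (h1 i x hx))
  induction k generalizing g h with
  | zero => exact key hg hh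
  | succ k ih =>
    refine ⟨key hg.1 hh.1, ?_⟩
    simp only [fun i => dirDeriv_mul (V := V i) (sg i) (sh i)]
    exact (ih hg.2 hh.of_succ (fun i => (sg i).dirDeriv (sV i)) sh).add
      (ih hg.of_succ hh.2 sg (fun i => (sh i).dirDeriv (sV i)))
      (fun i => ((sg i).dirDeriv (sV i)).mul (sh i))
      (fun i => (sg i).mul ((sh i).dirDeriv (sV i))) sV

lemma zero (k : ℕ) : SymbolBound V S k w (fun _ _ => (0:ℂ)) := by
  induction k with
  | zero => exact ⟨0, le_rfl, by simp⟩
  | succ k ih =>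
    refine ⟨⟨0, le_rfl, by simp⟩, ?_⟩
    have : (fun i => dirDeriv (V i) fun _ => (0:ℂ)) = fun _ _ => 0 := by
      funext i x
      simp [dirDeriv]
    rw [this]
    exact ih

lemma const (c : ι → ℂ) (hc : ∃ C, 0 ≤ C ∧ ∀ i, ∀ x ∈ S i, ‖c i‖ ≤ C * w i x) (k : ℕ) :
    SymbolBound V S k w (fun i _ => c i) := by
  cases k with
  | zero => exact hc
  | succ k =>
    refine ⟨hc, ?_⟩
    have : (fun i => dirDeriv (V i) fun _ => c i) = fun _ _ => 0 := by
      funext i x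
      simp [dirDeriv]
    rw [this]
    exact zero k

lemma sum {α : Type*} (s : Finset α) {k : ℕ} {g : α → ι → E → ℂ}
    (hg : ∀ a ∈ s, SymbolBound V S k w (g a))
    (sg : ∀ a, ∀ i, ContDiff ℝ ∞ (g a i)) (sV : ∀ i, ContDiff ℝ ∞ (V i)) :
    SymbolBound V S k w (fun i x => ∑ a ∈ s, g a i x) := by
  classical
  induction s using Finset.induction_on with
  | empty =>
    simpa using zero k
  | insert a s ha ih =>
    simp only [Finset.sum_insert ha]
    exact (hg a (by simp)).add (ih fun b hb => hg b (by simp [hb])) (sg a)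
      (fun i => ContDiff.sum fun b _ => sg b i) sV

/-- An approximately homogeneous function (`V g = c g + h`) is a symbol as soon as `h` is one and
`g` itself is bounded: each further derivative of `g` is expressed by `g` and `h` again. -/
lemma of_dirDeriv_eq {k : ℕ} (c : ι → ℂ) (hc : ∃ C, ∀ i, ‖c i‖ ≤ C)
    (hg : ∃ C, 0 ≤ C ∧ ∀ i, ∀ x ∈ S i, ‖g i x‖ ≤ C * w i x)
    (hd : ∀ i, dirDeriv (V i) (g i) = fun x => c i * g i x + h i x)
    (hh : ∀ k, SymbolBound V S k w h)
    (sg : ∀ i, ContDiff ℝ ∞ (g i)) (sh : ∀ i, ContDiff ℝ ∞ (h i)) (sV : ∀ i, ContDiff ℝ ∞ (V i)) :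
    SymbolBound V S k w g := by
  induction k with
  | zero => exact hg
  | succ k ih =>
    refine ⟨hg, ?_⟩
    simp only [hd]
    exact (const_mul c hc ih sg sV).add (hh k) (fun i => contDiff_const.mul (sg i)) sh sV

/-- Reciprocals of functions whose logarithmic derivatives are bounded symbols. -/
lemma inv {m : ι → E → ℂ} (hm : ∀ i x, m i x ≠ 0) (sm : ∀ i, ContDiff ℝ ∞ (m i))
    (sV : ∀ i, ContDiff ℝ ∞ (V i))
    (hd : ∀ k, SymbolBound V S k (fun i x => ‖m i x‖) (fun i => dirDeriv (V i) (m i)))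
    (k : ℕ) : SymbolBound V S k (fun i x => ‖(m i x)⁻¹‖) (fun i x => (m i x)⁻¹) := by
  have sa : ∀ i, ContDiff ℝ ∞ (fun x => (m i x)⁻¹) := fun i => (sm i).inv (hm i)
  have smd : ∀ i, ContDiff ℝ ∞ (dirDeriv (V i) (m i)) := fun i => (sm i).dirDeriv (sV i)
  -- The derivative of `m⁻¹` is grouped as `m⁻¹` times the logarithmic derivative, a symbol of
  -- weight one, so that the induction reproduces the weight `‖m⁻¹‖`.
  have hda : ∀ i, dirDeriv (V i) (fun x => (m i x)⁻¹) =
      fun x => (m i x)⁻¹ * (-1 * ((m i x)⁻¹ * dirDeriv (V i) (m i) x)) := by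
    intro i
    funext x
    have h1 : dirDeriv (V i) (fun x => m i x * (m i x)⁻¹) x = 0 := by
      have : (fun x => m i x * (m i x)⁻¹) = fun _ => 1 := by
        funext x; exact mul_inv_cancel₀ (hm i x)
      rw [this]; simp [dirDeriv]
    rw [dirDeriv_mul (sm i) (sa i)] at h1
    have h2 := hm i x
    field_simp at h1 ⊢
    linear_combination h1
  have hb : ∃ C, 0 ≤ C ∧ ∀ i, ∀ x ∈ S i, ‖(m i x)⁻¹‖ ≤ C * ‖(m i x)⁻¹‖ :=
    ⟨1, zero_le_one, by simp⟩
  have hw1 : ∃ C, 0 ≤ C ∧ ∀ i, ∀ x ∈ S i, ‖(m i x)⁻¹‖ * ‖m i x‖ ≤ C * (1:ℝ) := by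
    refine ⟨1, zero_le_one, fun i x _ => ?_⟩
    rw [← norm_mul, inv_mul_cancel₀ (hm i x)]; simp
  induction k with
  | zero => exact hb
  | succ k ih =>
    refine ⟨hb, ?_⟩
    have h1 : SymbolBound V S k (fun _ _ => 1)
        (fun i x => (m i x)⁻¹ * dirDeriv (V i) (m i) x) :=
      (ih.mul (hd k) sa smd sV).mono hw1
    have h2 := const_mul (fun _ => -1) ⟨1, by simp⟩ h1
      (fun i => (sa i).mul (smd i)) sV
    have h3 := ih.mul h2 sa (fun i => contDiff_const.mul ((sa i).mul (smd i))) sV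
    simp only [hda]
    simpa using h3

end SymbolBound

end SymbolBounds

/-! ### Oscillating exponentials and integration by parts along tangent fields. -/

section Phase

variable {E : Type*} [NormedAddCommGroup E] [NormedSpace ℝ E]

/-- The factor `1 - i s V u` produced by applying `1 - V` to `exp (i s u)`. -/
noncomputable def phaseFactor (V : E → E) (u : E → ℝ) (s : ℂ) (x : E) : ℂ :=
  1 - Complex.I * s * ((dirDeriv V u x : ℝ) : ℂ)

variable {V : E → E} {u : E → ℝ} {s : ℂ}

lemma contDiff_phaseFactor (hV : ContDiff ℝ ∞ V) (hu : ContDiff ℝ ∞ u) :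
    ContDiff ℝ ∞ (phaseFactor V u s) :=
  contDiff_const.sub (contDiff_const.mul (hu.dirDeriv hV).complex_ofReal)

lemma contDiff_cexp_phase (hu : ContDiff ℝ ∞ u) :
    ContDiff ℝ ∞ (fun x => Complex.exp (Complex.I * s * (u x : ℂ))) :=
  Complex.contDiff_exp.comp (contDiff_const.mul hu.complex_ofReal)

lemma dirDeriv_cexp_phase (hu : ContDiff ℝ ∞ u) (x : E) :
    dirDeriv V (fun x => Complex.exp (Complex.I * s * (u x : ℂ))) x =
      Complex.I * s * ((dirDeriv V u x : ℝ) : ℂ) * Complex.exp (Complex.I * s * (u x : ℂ)) := by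
  have h1 : HasFDerivAt u (fderiv ℝ u x) x := (hu.differentiable (by simp) x).hasFDerivAt
  have h2 : HasFDerivAt (fun x => (u x : ℂ)) (Complex.ofRealCLM.comp (fderiv ℝ u x)) x :=
    Complex.ofRealCLM.hasFDerivAt.comp x h1
  have h3 := (h2.const_mul (Complex.I * s)).cexp
  simp only [dirDeriv]
  rw [h3.fderiv]
  simp
  ring

end Phase

section IntegrationByParts

variable {E : Type*} [NormedAddCommGroup E] [InnerProductSpace ℝ E] [FiniteDimensional ℝ E] {ι : Type*}

/-- The transpose, on densities, of `(1 - i s V u)⁻¹ (1 - V)`. -/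
noncomputable def transposeStep (V : E → E) (u : E → ℝ) (s : ℂ) (ψ : E → ℂ) (x : E) : ℂ :=
  (1 + (divergence V x : ℂ)) * ((phaseFactor V u s x)⁻¹ * ψ x) +
    dirDeriv V (fun y => (phaseFactor V u s y)⁻¹ * ψ y) x

variable {V : E → E} {u : E → ℝ} {s : ℂ} {ψ : E → ℂ}

lemma contDiff_transposeStep (hV : ContDiff ℝ ∞ V) (hu : ContDiff ℝ ∞ u)
    (hm : ∀ x, phaseFactor V u s x ≠ 0) (hψ : ContDiff ℝ ∞ ψ) :
    ContDiff ℝ ∞ (transposeStep V u s ψ) := by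
  have h1 : ContDiff ℝ ∞ (fun y => (phaseFactor V u s y)⁻¹ * ψ y) :=
    ((contDiff_phaseFactor hV hu).inv hm).mul hψ
  exact ((contDiff_const.add hV.divergence.complex_ofReal).mul h1).add (h1.dirDeriv hV)

lemma tsupport_transposeStep_subset : tsupport (transposeStep V u s ψ) ⊆ tsupport ψ := by
  refine closure_minimal (fun x hx => ?_) (isClosed_tsupport ψ)
  by_contra hx'
  refine hx ?_
  have h1 : ψ x = 0 := image_eq_zero_of_notMem_tsupport hx'
  have h2 : x ∉ tsupport (fun y => (phaseFactor V u s y)⁻¹ * ψ y) := fun h =>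
    hx' (tsupport_mul_subset_right h)
  have h3 : dirDeriv V (fun y => (phaseFactor V u s y)⁻¹ * ψ y) x = 0 :=
    image_eq_zero_of_notMem_tsupport fun h => h2 (tsupport_dirDeriv_subset _ _ h)
  simp [transposeStep, h1, h3]

variable [MeasurableSpace E] [BorelSpace E]

/-- Apply tangency to `b e` with `b = m⁻¹ ψ`, `e = exp(isu)`, where `m` is the phase factor. As `V e
= (1 - m) e`, the integrand `V(b e) + (div V) b e` is the difference of the two integrands compared
here. -/
lemma integral_transposeStep_mul_cexp {Ω U : Set E} (hT : TangentTo Ω U V)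
    (hΩ : IsCompact Ω)
    (hV : ContDiff ℝ ∞ V) (hu : ContDiff ℝ ∞ u) (hm : ∀ x, phaseFactor V u s x ≠ 0)
    (hψ : ContDiff ℝ ∞ ψ) (hs : HasCompactSupport ψ) (hsU : tsupport ψ ⊆ U) :
    ∫ x in Ω, transposeStep V u s ψ x * Complex.exp (Complex.I * s * (u x : ℂ)) =
      ∫ x in Ω, ψ x * Complex.exp (Complex.I * s * (u x : ℂ)) := by
  set e : E → ℂ := fun x => Complex.exp (Complex.I * s * (u x : ℂ)) with he
  have hes : ContDiff ℝ ∞ e := contDiff_cexp_phase hu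
  set b : E → ℂ := fun y => (phaseFactor V u s y)⁻¹ * ψ y with hb
  have hbs : ContDiff ℝ ∞ b := ((contDiff_phaseFactor hV hu).inv hm).mul hψ
  have hbc : HasCompactSupport b := hs.mul_left
  have h0 := hT (fun x => b x * e x) (hbs.mul hes) hbc.mul_right
    ((tsupport_mul_subset_left).trans ((tsupport_mul_subset_right).trans hsU))
  have hTs := contDiff_transposeStep hV hu hm hψ
  rw [← sub_eq_zero, ← h0, ← integral_sub]
  · refine integral_congr_ae (Eventually.of_forall fun x => ?_)
    simp only
    have he' : dirDeriv V e x = Complex.I * s * ((dirDeriv V u x : ℝ) : ℂ) * e x :=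
      dirDeriv_cexp_phase hu x
    rw [dirDeriv_mul hbs hes, ← show e x = Complex.exp (Complex.I * s * (u x : ℂ)) from rfl]
    simp only [he']
    have h1 : b x * phaseFactor V u s x = ψ x := by
      simp only [hb]; have := hm x; field_simp
    rw [← h1]
    have h2 : transposeStep V u s ψ x = (1 + (divergence V x : ℂ)) * b x + dirDeriv V b x := rfl
    rw [h2]
    simp only [phaseFactor]
    ring
  · exact (hTs.continuous.mul hes.continuous).continuousOn.integrableOn_compact hΩ
  · exact (hψ.continuous.mul hes.continuous).continuousOn.integrableOn_compact hΩ

/-- Iterated integration by parts along tangent vector fields, uniformly in a family of phases. -/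
theorem exists_norm_integral_cexp_le {Ω : Set E} (hΩ : IsCompact Ω) {U : ι → Set E}
    {V : ι → E → E}
    {u : ι → E → ℝ} {s : ι → ℂ} {φ : ι → E → ℂ} {w wD : ι → E → ℝ}
    (hT : ∀ i, TangentTo Ω (U i) (V i)) (hV : ∀ i, ContDiff ℝ ∞ (V i))
    (hu : ∀ i, ContDiff ℝ ∞ (u i)) (hm : ∀ i x, phaseFactor (V i) (u i) (s i) x ≠ 0)
    (hφ : ∀ i, ContDiff ℝ ∞ (φ i)) (hs : ∀ i, HasCompactSupport (φ i))
    (hsU : ∀ i, tsupport (φ i) ⊆ U i)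
    (hre : ∀ i, ∀ x ∈ Ω ∩ U i, 0 ≤ (s i).im * u i x)
    (hc : ∀ k, SymbolBound V (fun i => Ω ∩ U i) k (fun _ _ => 1)
      (fun i x => (divergence (V i) x : ℂ)))
    (hD : ∀ k, SymbolBound V (fun i => Ω ∩ U i) k wD
      (fun i x => ((dirDeriv (V i) (u i) x : ℝ) : ℂ)))
    (hsD : ∃ C, 0 ≤ C ∧ ∀ i, ∀ x ∈ Ω ∩ U i,
      ‖s i‖ * wD i x ≤ C * ‖phaseFactor (V i) (u i) (s i) x‖)
    (hφw : ∀ k, SymbolBound V (fun i => Ω ∩ U i) k w φ) (N : ℕ) :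
    ∃ C, 0 ≤ C ∧ ∀ B : ι → E → ℝ, (∀ i, IntegrableOn (B i) Ω) → (∀ i, ∀ x ∈ Ω, 0 ≤ B i x) →
      (∀ i, ∀ x ∈ Ω ∩ U i, w i x * ‖(phaseFactor (V i) (u i) (s i) x)⁻¹‖ ^ N ≤ B i x) →
      ∀ i, ‖∫ x in Ω, φ i x * Complex.exp (Complex.I * s i * (u i x : ℂ))‖ ≤
        C * ∫ x in Ω, B i x := by
  set m : ι → E → ℂ := fun i => phaseFactor (V i) (u i) (s i) with hmdef
  have sm : ∀ i, ContDiff ℝ ∞ (m i) := fun i => contDiff_phaseFactor (hV i) (hu i)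
  have sD : ∀ i, ContDiff ℝ ∞ (fun x => ((dirDeriv (V i) (u i) x : ℝ) : ℂ)) := fun i =>
    ((hu i).dirDeriv (hV i)).complex_ofReal
  have sa : ∀ i, ContDiff ℝ ∞ (fun x => (m i x)⁻¹) := fun i => (sm i).inv (hm i)
  have hmd : ∀ i, dirDeriv (V i) (m i) = fun x =>
      (-(Complex.I * s i)) * dirDeriv (V i) (fun x => ((dirDeriv (V i) (u i) x : ℝ) : ℂ)) x := by
    intro i
    rw [← dirDeriv_const_mul _ (sD i)]
    have : m i = fun x => 1 + (-(Complex.I * s i)) * ((dirDeriv (V i) (u i) x : ℝ) : ℂ) := by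
      funext x
      simp only [hmdef, phaseFactor]
      ring
    rw [this]
    rw [dirDeriv_add contDiff_const (contDiff_const.mul (sD i))]
    funext x
    have h0 : dirDeriv (V i) (fun _ => (1 : ℂ)) x = 0 := by simp [dirDeriv]
    rw [h0, zero_add]
  -- the family with the frequency absorbed in the weight
  have hsb : ∀ {k : ℕ} {g : ι → E → ℂ}, (∀ i, ContDiff ℝ ∞ (g i)) →
      SymbolBound V (fun i => Ω ∩ U i) k wD g →
      SymbolBound V (fun i => Ω ∩ U i) k (fun i x => ‖m i x‖)
        (fun i x => (-(Complex.I * s i)) * g i x) := by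
    intro k g sg hg
    have h1 : SymbolBound V (fun i => Ω ∩ U i) k (fun i _ => ‖s i‖)
        (fun i _ => -(Complex.I * s i)) :=
      SymbolBound.const _ ⟨1, zero_le_one, by simp⟩ k
    exact (h1.mul hg (fun i => contDiff_const) sg hV).mono hsD
  have ha : ∀ k, SymbolBound V (fun i => Ω ∩ U i) k (fun i x => ‖(m i x)⁻¹‖)
      (fun i x => (m i x)⁻¹) := by
    refine SymbolBound.inv hm sm hV fun k => ?_
    simp only [hmd]
    exact hsb (fun i => (sD i).dirDeriv (hV i)) (hD (k + 1)).2
  have hcont : ∀ i, ContDiff ℝ ∞ (fun x => (divergence (V i) x : ℂ)) := fun i =>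
    (hV i).divergence.complex_ofReal
  have h1c : ∀ k, SymbolBound V (fun i => Ω ∩ U i) k (fun _ _ => 1)
      (fun i x => 1 + (divergence (V i) x : ℂ)) := by
    intro k
    refine SymbolBound.add ?_ (hc k) (fun i => contDiff_const) hcont hV
    exact SymbolBound.const (fun _ => 1) ⟨1, zero_le_one, by simp⟩ k
  -- The amplitude after `n` integrations by parts. Each one leaves the integral and the support
  -- condition intact and multiplies the weight by `‖m⁻¹‖`.
  let ψ : ℕ → ι → E → ℂ := fun n i => (transposeStep (V i) (u i) (s i))^[n] (φ i)
  have hψs : ∀ n i, ψ (n + 1) i = transposeStep (V i) (u i) (s i) (ψ n i) := fun n i => by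
    simp only [ψ, Function.iterate_succ_apply']
  have main : ∀ n, (∀ i, ContDiff ℝ ∞ (ψ n i)) ∧ (∀ i, tsupport (ψ n i) ⊆ tsupport (φ i)) ∧
      (∀ k, SymbolBound V (fun i => Ω ∩ U i) k (fun i x => w i x * ‖(m i x)⁻¹‖ ^ n) (ψ n)) ∧
      (∀ i, ∫ x in Ω, ψ n i x * Complex.exp (Complex.I * s i * (u i x : ℂ)) =
        ∫ x in Ω, φ i x * Complex.exp (Complex.I * s i * (u i x : ℂ))) := by
    intro n
    induction n with
    | zero => exact ⟨hφ, fun i => subset_rfl, by simpa [ψ] using hφw, fun i => rfl⟩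
    | succ n ih =>
      obtain ⟨i1, i2, i3, i4⟩ := ih
      refine ⟨fun i => ?_, fun i => ?_, fun k => ?_, fun i => ?_⟩
      · rw [hψs]
        exact contDiff_transposeStep (hV i) (hu i) (hm i) (i1 i)
      · rw [hψs]
        exact tsupport_transposeStep_subset.trans (i2 i)
      · have sb : ∀ i, ContDiff ℝ ∞ (fun x => (m i x)⁻¹ * ψ n i x) := fun i => (sa i).mul (i1 i)
        have hb : ∀ k, SymbolBound V (fun i => Ω ∩ U i) k
            (fun i x => w i x * ‖(m i x)⁻¹‖ ^ (n + 1)) (fun i x => (m i x)⁻¹ * ψ n i x) := by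
          intro k
          refine ((ha k).mul (i3 k) sa i1 hV).mono ⟨1, zero_le_one, fun i x _ => le_of_eq ?_⟩
          ring
        have h1 : SymbolBound V (fun i => Ω ∩ U i) k
            (fun i x => w i x * ‖(m i x)⁻¹‖ ^ (n + 1))
            (fun i x => (1 + (divergence (V i) x : ℂ)) * ((m i x)⁻¹ * ψ n i x)) := by
          refine ((h1c k).mul (hb k) (fun i => contDiff_const.add (hcont i)) sb hV).mono
            ⟨1, zero_le_one, fun i x _ => le_of_eq ?_⟩
          ring
        have h2 := h1.add (hb (k + 1)).2 (fun i => (contDiff_const.add (hcont i)).mul (sb i))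
          (fun i => (sb i).dirDeriv (hV i)) hV
        have h3 : ψ (n + 1) = fun i x => (1 + (divergence (V i) x : ℂ)) * ((m i x)⁻¹ * ψ n i x) +
            dirDeriv (V i) (fun x => (m i x)⁻¹ * ψ n i x) x := by
          funext i
          rw [hψs]
          rfl
        rw [h3]
        exact h2
      · rw [hψs, ← i4]
        exact integral_transposeStep_mul_cexp (hT i) hΩ (hV i) (hu i) (hm i) (i1 i)
          ((hs i).mono' ((subset_tsupport _).trans (i2 i))) ((i2 i).trans (hsU i))
  obtain ⟨-, i2, i3, i4⟩ := main N
  obtain ⟨C, hC, hb⟩ := (i3 0).bound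
  refine ⟨C, hC, fun B hBi hB0 hB i => ?_⟩
  rw [← i4, ← integral_const_mul]
  refine norm_integral_le_of_norm_le ((hBi i).const_mul C) ?_
  filter_upwards [ae_restrict_mem hΩ.measurableSet] with x hx
  by_cases hxU : x ∈ U i
  -- The modulus is `exp(-Im s · u)`, and `Im s · u ≥ 0` on `Ω ∩ U i`.
  · have h1 : ‖Complex.exp (Complex.I * s i * (u i x : ℂ))‖ ≤ 1 := by
      rw [Complex.norm_exp, Real.exp_le_one_iff]
      have := hre i x ⟨hx, hxU⟩
      simp
      linarith
    rw [norm_mul]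
    calc ‖ψ N i x‖ * ‖Complex.exp (Complex.I * s i * (u i x : ℂ))‖ ≤ ‖ψ N i x‖ :=
          mul_le_of_le_one_right (norm_nonneg _) h1
      _ ≤ C * (w i x * ‖(m i x)⁻¹‖ ^ N) := hb i x ⟨hx, hxU⟩
      _ ≤ C * B i x := mul_le_mul_of_nonneg_left (hB i x ⟨hx, hxU⟩) hC
  · have : ψ N i x = 0 := image_eq_zero_of_notMem_tsupport fun h => hxU (hsU i (i2 i h))
    rw [this]
    simpa using mul_nonneg hC (hB0 i x hx)

end IntegrationByParts

/-! ### Volumes of slabs and caps, and the integral of inverse powers of the height. -/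

section SlabVolume

variable {E : Type*} [NormedAddCommGroup E] [InnerProductSpace ℝ E] [FiniteDimensional ℝ E]

open Module

lemma exists_orthonormalBasis_eq {Θ : E} (hΘ : ‖Θ‖ = 1) :
    ∃ (u : Finset E) (b : OrthonormalBasis u ℝ E) (i : u), b i = Θ := by
  have ho : Orthonormal ℝ ((↑) : ({Θ} : Set E) → E) := by
    rw [orthonormal_iff_ite]
    rintro ⟨x, rfl⟩ ⟨y, rfl⟩
    simp [hΘ]
  obtain ⟨u, b, hu, hb⟩ := ho.exists_orthonormalBasis_extension
  exact ⟨u, b, ⟨Θ, by simpa using hu⟩, by simp [hb]⟩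

variable [MeasurableSpace E] [BorelSpace E]

lemma OrthonormalBasis.volume_real_box {ι : Type*} [Fintype ι] (b : OrthonormalBasis ι ℝ E) (i : ι)
    {γ α β : ℝ} (hγ : 0 ≤ γ) (hαβ : α ≤ β) :
    volume.real {x : E | ⟪b i, x⟫ ∈ Icc α β ∧ ∀ j, j ≠ i → ⟪b j, x⟫ ∈ Icc (-γ) γ} =
      (2 * γ) ^ (finrank ℝ E - 1) * (β - α) := by
  classical
  let l : ι → ℝ := fun j => if j = i then α else -γ
  let r : ι → ℝ := fun j => if j = i then β else γ
  have hlr : l ≤ r := by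
    intro j
    simp only [l, r]
    split_ifs
    · exact hαβ
    · linarith
  let f : E → ι → ℝ := fun x => (b.repr x).ofLp
  have hf : MeasurePreserving f volume volume :=
    (PiLp.volume_preserving_ofLp ι).comp b.measurePreserving_repr
  have hset : {x : E | ⟪b i, x⟫ ∈ Icc α β ∧ ∀ j, j ≠ i → ⟪b j, x⟫ ∈ Icc (-γ) γ} =
      f ⁻¹' (Icc l r) := by
    ext x
    simp only [mem_preimage, mem_Icc, Pi.le_def, f, OrthonormalBasis.repr_apply_apply, l, r]
    constructor
    · rintro ⟨h1, h2⟩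
      refine ⟨fun j => ?_, fun j => ?_⟩
      · split_ifs with h
        · exact h ▸ h1.1
        · exact (h2 j h).1
      · split_ifs with h
        · exact h ▸ h1.2
        · exact (h2 j h).2
    · rintro ⟨h1, h2⟩
      refine ⟨⟨by simpa using h1 i, by simpa using h2 i⟩, fun j hj => ⟨?_, ?_⟩⟩
      · simpa [hj] using h1 j
      · simpa [hj] using h2 j
  rw [hset, measureReal_def, hf.measure_preimage measurableSet_Icc.nullMeasurableSet,
    Real.volume_Icc_pi_toReal hlr, ← Finset.prod_erase_mul _ _ (Finset.mem_univ i)]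
  have h1 : ∏ j ∈ Finset.univ.erase i, (r j - l j) = (2 * γ) ^ (finrank ℝ E - 1) := by
    rw [Finset.prod_congr rfl (g := fun _ => 2 * γ), Finset.prod_const, Finset.card_erase_of_mem
      (Finset.mem_univ i), finrank_eq_card_basis b.toBasis, Finset.card_univ]
    intro j hj
    have : j ≠ i := Finset.ne_of_mem_erase hj
    simp [r, l, this]
    ring
  rw [h1]
  simp [r, l]

/-- The reflected slab lies in a box with side `β - α` along `Θ` and sides `2 r` across. -/
lemma volume_real_slab_le {Θ : E} (hΘ : ‖Θ‖ = 1) (p : E) {r α β : ℝ} (hr : 0 ≤ r) (hαβ : α ≤ β) :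
    volume.real {x : E | ‖x - p‖ ≤ r ∧ ⟪Θ, p - x⟫ ∈ Icc α β} ≤
      (2 * r) ^ (finrank ℝ E - 1) * (β - α) := by
  obtain ⟨u, b, i, hb⟩ := exists_orthonormalBasis_eq hΘ
  rw [← b.volume_real_box i hr hαβ]
  set B : Set E := {x : E | ⟪b i, x⟫ ∈ Icc α β ∧ ∀ j, j ≠ i → ⟪b j, x⟫ ∈ Icc (-r) r}
  have hmp : MeasurePreserving (fun x : E => p - x) volume volume :=
    Measure.measurePreserving_sub_left volume p
  have hBc : IsClosed B := by
    have : B = {x : E | ⟪b i, x⟫ ∈ Icc α β} ∩ ⋂ j, ⋂ (_ : j ≠ i), {x : E | ⟪b j, x⟫ ∈ Icc (-r) r} := by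
      ext x; simp [B]
    rw [this]
    refine IsClosed.inter (isClosed_Icc.preimage (by fun_prop)) ?_
    exact isClosed_iInter fun j => isClosed_iInter fun _ => isClosed_Icc.preimage (by fun_prop)
  have h1 : volume.real ((fun x : E => p - x) ⁻¹' B) = volume.real B := by
    rw [measureReal_def, hmp.measure_preimage hBc.measurableSet.nullMeasurableSet, measureReal_def]
  rw [← h1]
  refine measureReal_mono ?_ ?_
  · rintro x ⟨hx1, hx2⟩
    refine ⟨by rwa [hb], fun j _ => ?_⟩
    have : |⟪b j, p - x⟫| ≤ r := by
      refine (abs_real_inner_le_norm _ _).trans ?_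
      rw [b.norm_eq_one, one_mul, norm_sub_rev]
      exact hx1
    exact abs_le.1 this
  · rw [hmp.measure_preimage hBc.measurableSet.nullMeasurableSet]
    refine (Bornology.IsBounded.measure_lt_top ?_).ne
    refine (Metric.isBounded_closedBall (x := (0:E)) (r := ∑ j : u, max (max |α| |β|) r)).subset ?_
    intro x hx
    rw [mem_closedBall_zero_iff, ← b.sum_repr' x]
    refine (norm_sum_le _ _).trans (Finset.sum_le_sum fun j _ => ?_)
    rw [norm_smul, b.norm_eq_one, mul_one, Real.norm_eq_abs]
    by_cases hj : j = i
    · subst hj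
      exact (abs_le_max_abs_abs hx.1.1 hx.1.2).trans (le_max_left _ _)
    · exact (abs_le.2 (hx.2 j hj)).trans (le_max_right _ _)

lemma le_volume_real_slab {Θ : E} (hΘ : ‖Θ‖ = 1) (p : E) {r α β : ℝ} (hr : 0 ≤ r) (hαβ : α ≤ β)
    (hα : 0 ≤ α) (hβ : β ≤ r / 2) :
    (r / (finrank ℝ E : ℝ)) ^ (finrank ℝ E - 1) * (β - α) ≤
      volume.real {x : E | ‖x - p‖ ≤ r ∧ ⟪Θ, p - x⟫ ∈ Icc α β} := by
  classical
  obtain ⟨u, b, i, hb⟩ := exists_orthonormalBasis_eq hΘ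
  set n : ℝ := (finrank ℝ E : ℝ) with hn
  have hcard : (Fintype.card u : ℝ) = n := by rw [hn, finrank_eq_card_basis b.toBasis]
  have hn1 : 1 ≤ n := by
    rw [← hcard]; exact_mod_cast Fintype.card_pos_iff.2 ⟨i⟩
  have hγ : 0 ≤ r / (2 * n) := by positivity
  have h0 := b.volume_real_box i hγ hαβ
  have h2 : 2 * (r / (2 * n)) = r / n := by field_simp
  rw [h2] at h0
  rw [← h0]
  set B : Set E := {x : E | ⟪b i, x⟫ ∈ Icc α β ∧ ∀ j, j ≠ i → ⟪b j, x⟫ ∈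
    Icc (-(r / (2 * n))) (r / (2 * n))}
  have hmp : MeasurePreserving (fun x : E => p - x) volume volume :=
    Measure.measurePreserving_sub_left volume p
  have hBc : IsClosed B := by
    have : B = {x : E | ⟪b i, x⟫ ∈ Icc α β} ∩ ⋂ j, ⋂ (_ : j ≠ i),
        {x : E | ⟪b j, x⟫ ∈ Icc (-(r / (2 * n))) (r / (2 * n))} := by
      ext x; simp [B]
    rw [this]
    refine IsClosed.inter (isClosed_Icc.preimage (by fun_prop)) ?_
    exact isClosed_iInter fun j => isClosed_iInter fun _ => isClosed_Icc.preimage (by fun_prop)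
  have h1 : volume.real ((fun x : E => p - x) ⁻¹' B) = volume.real B := by
    rw [measureReal_def, hmp.measure_preimage hBc.measurableSet.nullMeasurableSet, measureReal_def]
  rw [← h1]
  refine measureReal_mono ?_ ?_
  · rintro x ⟨hx1, hx2⟩
    refine ⟨?_, by rwa [← hb]⟩
    have hx1' : |⟪b i, p - x⟫| ≤ r / 2 := by
      rw [abs_of_nonneg (hα.trans hx1.1)]; exact hx1.2.trans hβ
    rw [norm_sub_rev, ← b.sum_repr' (p - x)]
    -- The box has half-sides `r / (2 n)` across `Θ`. Together with height at most `r / 2`, the sum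
    -- of the coordinates is at most `r / 2 + n · r / (2 n) = r`, so the box fits into the ball.
    have hle : ∀ j, ‖⟪b j, p - x⟫ • b j‖ ≤ (if j = i then r / 2 else 0) + r / (2 * n) := by
      intro j
      rw [norm_smul, b.norm_eq_one, mul_one, Real.norm_eq_abs]
      by_cases hj : j = i
      · subst hj; simp only [if_true]; linarith
      · have := abs_le.2 (hx2 j hj)
        simpa [hj] using this
    refine (norm_sum_le _ _).trans ((Finset.sum_le_sum fun j _ => hle j).trans ?_)
    rw [Finset.sum_add_distrib, Finset.sum_ite_eq' Finset.univ i]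
    simp only [Finset.mem_univ, if_true, Finset.sum_const, Finset.card_univ, nsmul_eq_mul, hcard]
    apply le_of_eq
    field_simp
    ring
  · refine (Bornology.IsBounded.measure_lt_top ?_).ne
    refine (Metric.isBounded_closedBall (x := p) (r := r)).subset ?_
    rintro x ⟨hx, -⟩
    rwa [mem_closedBall_iff_norm]

/-- The cap of height `ε` at a point where `Ω` lies inside a paraboloid. -/
lemma volume_real_cap_le {Ω : Set E} {Θ p : E} (hΘ : ‖Θ‖ = 1) {c : ℝ} (hc : 0 < c)
    (hu : ∀ x ∈ Ω, c * ‖x - p‖ ^ 2 ≤ ⟪Θ, p - x⟫) {ε : ℝ} (hε : 0 < ε) :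
    volume.real (Ω ∩ {x | ⟪Θ, p - x⟫ ≤ ε}) ≤
      (2 / √c) ^ (finrank ℝ E - 1) * ε ^ (((finrank ℝ E : ℝ) + 1) / 2) := by
  have hr : 0 ≤ √(ε / c) := Real.sqrt_nonneg _
  have hfin : 1 ≤ finrank ℝ E := by
    have : Nontrivial E := ⟨Θ, 0, fun h => by simp [h] at hΘ⟩
    exact finrank_pos
  calc volume.real (Ω ∩ {x | ⟪Θ, p - x⟫ ≤ ε})
      ≤ volume.real {x : E | ‖x - p‖ ≤ √(ε / c) ∧ ⟪Θ, p - x⟫ ∈ Icc 0 ε} := by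
        refine measureReal_mono ?_ ?_
        · rintro x ⟨hx, hxε⟩
          have h := hu x hx
          have hxε' : ⟪Θ, p - x⟫ ≤ ε := hxε
          refine ⟨Real.le_sqrt_of_sq_le ?_, (by positivity : 0 ≤ c * ‖x - p‖ ^ 2).trans h, hxε⟩
          rw [le_div_iff₀ hc]
          linarith
        · refine (Bornology.IsBounded.measure_lt_top ?_).ne
          refine (Metric.isBounded_closedBall (x := p) (r := √(ε / c))).subset ?_
          rintro x ⟨hx, -⟩
          rwa [mem_closedBall_iff_norm]
    _ ≤ (2 * √(ε / c)) ^ (finrank ℝ E - 1) * (ε - 0) := volume_real_slab_le hΘ p hr hε.le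
    _ = (2 / √c) ^ (finrank ℝ E - 1) * ε ^ (((finrank ℝ E : ℝ) + 1) / 2) := by
        have h1 : 2 * √(ε / c) = 2 / √c * √ε := by
          rw [Real.sqrt_div hε.le]; ring
        have h2 : √ε ^ (finrank ℝ E - 1) * ε = ε ^ (((finrank ℝ E : ℝ) + 1) / 2) := by
          rw [Real.sqrt_eq_rpow, ← Real.rpow_natCast, ← Real.rpow_mul hε.le]
          nth_rewrite 2 [← Real.rpow_one ε]
          rw [← Real.rpow_add hε, Nat.cast_sub hfin]
          congr 1
          push_cast
          ring
        rw [h1, mul_pow, sub_zero, mul_assoc, h2]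

/-- Cut `Ω` into layers `j ≤ R ⟪Θ, p - x⟫ < j + 1`. A layer lies in the cap of height `(j + 1) / R`,
of volume at most `K ((j + 1) / R)^((d + 1) / 2)`, and the integrand there is at most `(j + 1)^(-(d
+ 3))`. The exponent `d + 3` leaves at least `(j + 1)^(-2)`, which is summable. -/
lemma exists_integral_inv_pow_le (E : Type*) [NormedAddCommGroup E] [InnerProductSpace ℝ E]
    [FiniteDimensional ℝ E] [MeasurableSpace E] [BorelSpace E] {c : ℝ} (hc : 0 < c) :
    ∃ C, 0 ≤ C ∧ ∀ Ω : Set E, IsCompact Ω → ∀ Θ p : E, ‖Θ‖ = 1 →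
      (∀ x ∈ Ω, c * ‖x - p‖ ^ 2 ≤ ⟪Θ, p - x⟫) → ∀ R : ℝ, 0 < R →
      ∫ x in Ω, ((1 + R * ⟪Θ, p - x⟫) ^ (finrank ℝ E + 3))⁻¹ ≤
        C * R ^ (-(((finrank ℝ E : ℝ) + 1) / 2)) := by
  set d := finrank ℝ E with hd
  have hsum : Summable (fun j : ℕ => 1 / ((j:ℝ) + 1) ^ 2) := by
    have := (summable_nat_add_iff 1).2 (Real.summable_one_div_nat_pow.2 (le_refl 2))
    simpa using this
  set K := (2 / √c) ^ (d - 1) with hK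
  have hK0 : 0 ≤ K := by positivity
  refine ⟨K * ∑' j : ℕ, 1 / ((j:ℝ) + 1) ^ 2, mul_nonneg hK0 (tsum_nonneg fun j => by positivity),
    fun Ω hΩ Θ p hΘ hu R hR => ?_⟩
  have hu0 : ∀ x ∈ Ω, 0 ≤ ⟪Θ, p - x⟫ := fun x hx =>
    (by positivity : 0 ≤ c * ‖x - p‖ ^ 2).trans (hu x hx)
  have hcont : Continuous (fun x : E => ⟪Θ, p - x⟫) := by fun_prop
  -- Compactness leaves only finitely many layers, so no infinite sum has to be integrated; `J`
  -- depends on `Ω` and `R` but the final constant does not.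
  obtain ⟨A, hA⟩ := hΩ.exists_bound_of_continuousOn hcont.continuousOn
  obtain ⟨J, hJ⟩ := exists_nat_gt (R * A)
  have hmeas : ∀ j : ℕ, MeasurableSet {x : E | ⟪Θ, p - x⟫ ≤ ((j:ℝ) + 1) / R} := fun j =>
    (isClosed_le hcont continuous_const).measurableSet
  have hfinΩ : volume Ω ≠ ⊤ := hΩ.measure_lt_top.ne
  have hconst : ∀ (j : ℕ) (a : ℝ), IntegrableOn ({x : E | ⟪Θ, p - x⟫ ≤ ((j:ℝ) + 1) / R}.indicator
      (fun _ => a)) Ω := fun j a =>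
    (integrableOn_const hfinΩ).indicator (hmeas j)
  calc ∫ x in Ω, ((1 + R * ⟪Θ, p - x⟫) ^ (d + 3))⁻¹
      ≤ ∫ x in Ω, ∑ j ∈ Finset.range J, {x : E | ⟪Θ, p - x⟫ ≤ ((j:ℝ) + 1) / R}.indicator
          (fun _ => (((j:ℝ) + 1) ^ (d + 3))⁻¹) x := by
        refine setIntegral_mono_on ?_ ?_ hΩ.measurableSet fun x hx => ?_
        · refine ContinuousOn.integrableOn_compact (f := fun x =>
            ((1 + R * ⟪Θ, p - x⟫) ^ (d + 3))⁻¹) hΩ ?_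
          refine ContinuousOn.inv₀ (by fun_prop) fun x hx => ?_
          have := hu0 x hx
          positivity
        · exact integrable_finsetSum _ fun j _ => hconst j _
        · have hx0 := hu0 x hx
          have hRu : 0 ≤ R * ⟪Θ, p - x⟫ := by positivity
          set j := ⌊R * ⟪Θ, p - x⟫⌋₊ with hj
          have h1 : (j:ℝ) ≤ R * ⟪Θ, p - x⟫ := Nat.floor_le hRu
          have h2 : R * ⟪Θ, p - x⟫ < j + 1 := Nat.lt_floor_add_one _
          have h3 : ⟪Θ, p - x⟫ ≤ A := (le_abs_self _).trans (hA x hx)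
          have hjJ : j ∈ Finset.range J := by
            rw [Finset.mem_range]
            have : (j:ℝ) < J := lt_of_le_of_lt (h1.trans (by gcongr)) hJ
            exact_mod_cast this
          have hnn : ∀ k ∈ Finset.range J, 0 ≤ {x : E | ⟪Θ, p - x⟫ ≤ ((k:ℝ) + 1) / R}.indicator
              (fun _ => (((k:ℝ) + 1) ^ (d + 3))⁻¹) x := fun k _ =>
            indicator_nonneg (fun _ _ => by positivity) x
          refine le_trans ?_ (Finset.single_le_sum hnn hjJ)
          have hmem : x ∈ {x : E | ⟪Θ, p - x⟫ ≤ ((j:ℝ) + 1) / R} := by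
            show ⟪Θ, p - x⟫ ≤ ((j:ℝ) + 1) / R
            rw [le_div_iff₀ hR]; linarith
          rw [indicator_of_mem hmem]
          have : (j:ℝ) + 1 ≤ 1 + R * ⟪Θ, p - x⟫ := by linarith
          gcongr
    _ = ∑ j ∈ Finset.range J, volume.real (Ω ∩ {x | ⟪Θ, p - x⟫ ≤ ((j:ℝ) + 1) / R}) *
          (((j:ℝ) + 1) ^ (d + 3))⁻¹ := by
        rw [integral_finsetSum _ fun j _ => hconst j _]
        refine Finset.sum_congr rfl fun j _ => ?_
        rw [setIntegral_indicator (hmeas j), setIntegral_const, smul_eq_mul]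
    _ ≤ ∑ j ∈ Finset.range J, (K * (((j:ℝ) + 1) / R) ^ (((d : ℝ) + 1) / 2)) *
          (((j:ℝ) + 1) ^ (d + 3))⁻¹ := by
        refine Finset.sum_le_sum fun j _ => ?_
        gcongr
        exact volume_real_cap_le hΘ hc hu (by positivity)
    _ ≤ ∑ j ∈ Finset.range J, K * R ^ (-(((d : ℝ) + 1) / 2)) * (1 / ((j:ℝ) + 1) ^ 2) := by
        refine Finset.sum_le_sum fun j _ => ?_
        rw [Real.div_rpow (by positivity) hR.le, Real.rpow_neg hR.le]
        have h1 : ((j:ℝ) + 1) ^ (((d : ℝ) + 1) / 2) ≤ ((j:ℝ) + 1) ^ (d + 1) := by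
          rw [← Real.rpow_natCast]
          refine Real.rpow_le_rpow_of_exponent_le (by linarith [Nat.cast_nonneg (α := ℝ) j]) ?_
          push_cast
          have : (0:ℝ) ≤ d := Nat.cast_nonneg d
          linarith
        have h2 : ((j:ℝ) + 1) ^ (d + 3) = ((j:ℝ) + 1) ^ (d + 1) * ((j:ℝ) + 1) ^ 2 := by
          rw [← pow_add]
        have h3 : (0:ℝ) < ((j:ℝ) + 1) ^ (d + 1) := by positivity
        have h4 : ((j:ℝ) + 1) ^ (((d : ℝ) + 1) / 2) * (((j:ℝ) + 1) ^ (d + 3))⁻¹ ≤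
            1 / ((j:ℝ) + 1) ^ 2 := by
          rw [h2, mul_inv, ← mul_assoc, one_div]
          refine mul_le_of_le_one_left (by positivity) ?_
          rw [← div_eq_mul_inv]
          exact div_le_one_of_le₀ h1 h3.le
        have hR' : 0 ≤ (R ^ (((d : ℝ) + 1) / 2))⁻¹ := by positivity
        calc _ = K * (R ^ (((d : ℝ) + 1) / 2))⁻¹ *
              (((j:ℝ) + 1) ^ (((d : ℝ) + 1) / 2) * (((j:ℝ) + 1) ^ (d + 3))⁻¹) := by ring
          _ ≤ _ := by gcongr
    _ ≤ K * (∑' j : ℕ, 1 / ((j:ℝ) + 1) ^ 2) * R ^ (-(((d : ℝ) + 1) / 2)) := by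
        rw [← Finset.mul_sum, mul_right_comm]
        gcongr
        exact hsum.sum_le_tsum _ fun j _ => by positivity

end SlabVolume

set_option maxSynthPendingDepth 3

/-! ### Graph functions and the field of parabolic dilations. -/

section GraphFunction

set_option maxSynthPendingDepth 3

variable {E : Type*} [NormedAddCommGroup E] [InnerProductSpace ℝ E]

lemma fderiv_add_smul_of_invariant {W : Type*} [NormedAddCommGroup W] [NormedSpace ℝ W]
    {g : E → W} {n : E} (h : ∀ x (t : ℝ), g (x + t • n) = g x) (x : E) (t : ℝ) :
    fderiv ℝ g (x + t • n) = fderiv ℝ g x := by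
  rw [← fderiv_comp_add_right]
  congr 1
  funext y
  exact h y t

lemma fderiv_apply_of_invariant {W : Type*} [NormedAddCommGroup W] [NormedSpace ℝ W]
    {g : E → W} {n : E} (h : ∀ x (t : ℝ), g (x + t • n) = g x) (hg : Differentiable ℝ g) (x : E) :
    fderiv ℝ g x n = 0 := by
  have h1 : HasDerivAt (fun t : ℝ => g (x + t • n)) (fderiv ℝ g x n) 0 := by
    have h2 : HasDerivAt (fun t : ℝ => x + t • n) n 0 := by
      simpa using ((hasDerivAt_id (0:ℝ)).smul_const n).const_add x
    have h3 : HasFDerivAt g (fderiv ℝ g x) (x + (0:ℝ) • n) := by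
      simpa using (hg x).hasFDerivAt
    exact h3.comp_hasDerivAt 0 h2
  have h2 : HasDerivAt (fun t : ℝ => g (x + t • n)) 0 0 := by
    simp only [h]
    exact hasDerivAt_const _ _
  exact h1.unique h2

/-- A smooth function of the form `⟪n, x⟫ - φ (x)` where `n` is a unit vector and `φ` does not
depend on the component of `x` along `n`. -/
structure IsGraphFunction (n : E) (F : E → ℝ) : Prop where
  norm_eq_one : ‖n‖ = 1
  contDiff : ContDiff ℝ ∞ F
  translate : ∀ x (t : ℝ), F (x + t • n) = F x + t

/-- The component orthogonal to the unit vector `n`. -/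
noncomputable def orthComponent (n : E) : E →L[ℝ] E :=
  ContinuousLinearMap.id ℝ E - (innerSL ℝ n).smulRight n

lemma orthComponent_apply (n v : E) : orthComponent n v = v - ⟪n, v⟫ • n := by
  simp [orthComponent]

lemma inner_orthComponent {n : E} (hn : ‖n‖ = 1) (v : E) : ⟪n, orthComponent n v⟫ = 0 := by
  simp [orthComponent_apply, inner_sub_right, inner_smul_right, hn]

lemma orthComponent_self {n : E} (hn : ‖n‖ = 1) : orthComponent n n = 0 := by
  simp [orthComponent_apply, hn]

lemma orthComponent_orthComponent {n : E} (hn : ‖n‖ = 1) (v : E) :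
    orthComponent n (orthComponent n v) = orthComponent n v := by
  rw [orthComponent_apply n (orthComponent n v), inner_orthComponent hn]
  simp

lemma norm_orthComponent_le {n : E} (hn : ‖n‖ = 1) (v : E) : ‖orthComponent n v‖ ≤ ‖v‖ := by
  have h : ‖v‖ ^ 2 = ‖orthComponent n v‖ ^ 2 + ⟪n, v⟫ ^ 2 := by
    have h1 : v = orthComponent n v + ⟪n, v⟫ • n := by simp [orthComponent_apply]
    conv_lhs => rw [h1]
    rw [norm_add_sq_real, inner_smul_right, real_inner_comm n (orthComponent n v),
      inner_orthComponent hn, norm_smul, hn]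
    simp
  nlinarith [norm_nonneg v, norm_nonneg (orthComponent n v), sq_nonneg ⟪n, v⟫]

variable {n : E} {F : E → ℝ}

namespace IsGraphFunction

lemma contDiff_fderiv (hF : IsGraphFunction n F) : ContDiff ℝ ∞ (fderiv ℝ F) :=
  hF.contDiff.fderiv_right (m := ∞) (by simp)

lemma contDiff_fderiv_two (hF : IsGraphFunction n F) : ContDiff ℝ ∞ (fderiv ℝ (fderiv ℝ F)) :=
  hF.contDiff_fderiv.fderiv_right (m := ∞) (by simp)

lemma contDiff_fderiv_three (hF : IsGraphFunction n F) :
    ContDiff ℝ ∞ (fderiv ℝ (fderiv ℝ (fderiv ℝ F))) :=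
  hF.contDiff_fderiv_two.fderiv_right (m := ∞) (by simp)

lemma fderiv_translate (hF : IsGraphFunction n F) (x : E) (t : ℝ) :
    fderiv ℝ F (x + t • n) = fderiv ℝ F x := by
  rw [← fderiv_comp_add_right]
  have : (fun y => F (y + t • n)) = fun y => F y + t := by
    funext y; exact hF.translate y t
  rw [this, fderiv_add_const]

lemma fderiv_apply_normal (hF : IsGraphFunction n F) (x : E) : fderiv ℝ F x n = 1 := by
  have h1 : HasDerivAt (fun t : ℝ => F (x + t • n)) (fderiv ℝ F x n) 0 := by
    have h2 : HasDerivAt (fun t : ℝ => x + t • n) n 0 := by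
      simpa using ((hasDerivAt_id (0:ℝ)).smul_const n).const_add x
    have h3 : HasFDerivAt F (fderiv ℝ F x) (x + (0:ℝ) • n) := by
      simpa using (hF.contDiff.differentiable (by simp) x).hasFDerivAt
    exact h3.comp_hasDerivAt 0 h2
  have h2 : HasDerivAt (fun t : ℝ => F (x + t • n)) 1 0 := by
    simp only [hF.translate]
    exact (hasDerivAt_id (0:ℝ)).const_add _
  exact h1.unique h2

lemma fderiv_two_normal (hF : IsGraphFunction n F) (x : E) :
    fderiv ℝ (fderiv ℝ F) x n = 0 :=
  fderiv_apply_of_invariant hF.fderiv_translate (hF.contDiff_fderiv.differentiable (by simp)) x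

lemma fderiv_three_normal (hF : IsGraphFunction n F) (x : E) :
    fderiv ℝ (fderiv ℝ (fderiv ℝ F)) x n = 0 :=
  fderiv_apply_of_invariant (fderiv_add_smul_of_invariant hF.fderiv_translate)
    (hF.contDiff_fderiv_two.differentiable (by simp)) x

lemma fderiv_two_apply (hF : IsGraphFunction n F) (x v : E) :
    fderiv ℝ (fderiv ℝ F) x v = fderiv ℝ (fderiv ℝ F) x (orthComponent n v) := by
  simp [orthComponent_apply, hF.fderiv_two_normal]

end IsGraphFunction

/-- The vector field generating the parabolic dilations centred at `p`, adapted to the graph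
function `F`: it is tangent to the level set `{F = 0}`. -/
noncomputable def parabolicField (n : E) (F : E → ℝ) (p x : E) : E :=
  (1 / 2 : ℝ) • orthComponent n (x - p) +
    (F x - 1 / 2 * fderiv ℝ F x (orthComponent n (x - p))) • n

/-- The phase `F' p (p - x)`, which vanishes on the tangent plane at `p`. -/
noncomputable def tangentPhase (F : E → ℝ) (p x : E) : ℝ := fderiv ℝ F p (p - x)

/-- With `z = orthComponent n (x - p)`, this is the derivative of `graphBregman` along
`parabolicField`. When `F` is quadratic in `z` the two coincide; their difference is the cubic
defect of homogeneity of the phase. -/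
noncomputable def graphEuler (n : E) (F : E → ℝ) (p x : E) : ℝ :=
  1 / 2 * (fderiv ℝ F x - fderiv ℝ F p) (orthComponent n (x - p))

/-- For a graph function this is independent of the coordinate along `n`. If `F p = 0`, the tangent
phase is `graphBregman - F`. -/
noncomputable def graphBregman (F : E → ℝ) (p x : E) : ℝ :=
  F x - F p - fderiv ℝ F p (x - p)

/-- The factor `1 / 4` here, like `1 / 8` in `graphCubic`, is a power of the rate `1 / 2` at which
the parabolic field scales `z`. These are the inhomogeneous terms in the successive derivatives of
`graphEuler` and `graphQuadratic` along the field. -/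
noncomputable def graphQuadratic (n : E) (F : E → ℝ) (p x : E) : ℝ :=
  1 / 4 * fderiv ℝ (fderiv ℝ F) x (orthComponent n (x - p)) (orthComponent n (x - p))

noncomputable def graphCubic (n : E) (F : E → ℝ) (p x : E) : ℝ :=
  1 / 8 * fderiv ℝ (fderiv ℝ (fderiv ℝ F)) x (orthComponent n (x - p)) (orthComponent n (x - p))
    (orthComponent n (x - p))

namespace IsGraphFunction


end IsGraphFunction

lemma contDiff_orthComponent_sub (n p : E) : ContDiff ℝ ∞ (fun x => orthComponent n (x - p)) :=
  (orthComponent n).contDiff.comp (contDiff_id.sub contDiff_const)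

namespace IsGraphFunction

lemma contDiff_parabolicField (hF : IsGraphFunction n F) (p : E) :
    ContDiff ℝ ∞ (parabolicField n F p) := by
  have := contDiff_orthComponent_sub n p
  exact (contDiff_const.smul this).add ((hF.contDiff.sub (contDiff_const.mul
    (hF.contDiff_fderiv.clm_apply this))).smul contDiff_const)

lemma contDiff_tangentPhase (p : E) : ContDiff ℝ ∞ (tangentPhase F p) :=
  (fderiv ℝ F p).contDiff.comp (contDiff_const.sub contDiff_id)

lemma contDiff_graphEuler (hF : IsGraphFunction n F) (p : E) :
    ContDiff ℝ ∞ (graphEuler n F p) :=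
  contDiff_const.mul ((hF.contDiff_fderiv.sub contDiff_const).clm_apply
    (contDiff_orthComponent_sub n p))

lemma contDiff_graphBregman (hF : IsGraphFunction n F) (p : E) :
    ContDiff ℝ ∞ (graphBregman F p) :=
  (hF.contDiff.sub contDiff_const).sub
    ((fderiv ℝ F p).contDiff.comp (contDiff_id.sub contDiff_const))

lemma contDiff_graphQuadratic (hF : IsGraphFunction n F) (p : E) :
    ContDiff ℝ ∞ (graphQuadratic n F p) :=
  contDiff_const.mul ((hF.contDiff_fderiv_two.clm_apply
    (contDiff_orthComponent_sub n p)).clm_apply (contDiff_orthComponent_sub n p))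

lemma contDiff_graphCubic (hF : IsGraphFunction n F) (p : E) :
    ContDiff ℝ ∞ (graphCubic n F p) :=
  contDiff_const.mul (((hF.contDiff_fderiv_three.clm_apply
    (contDiff_orthComponent_sub n p)).clm_apply (contDiff_orthComponent_sub n p)).clm_apply
    (contDiff_orthComponent_sub n p))

lemma orthComponent_parabolicField (hF : IsGraphFunction n F) (p x : E) :
    orthComponent n (parabolicField n F p x) = (1 / 2 : ℝ) • orthComponent n (x - p) := by
  rw [parabolicField, map_add, map_smul, map_smul, orthComponent_self hF.norm_eq_one,
    orthComponent_orthComponent hF.norm_eq_one]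
  simp

lemma fderiv_parabolicField (hF : IsGraphFunction n F) (p x : E) :
    fderiv ℝ F x (parabolicField n F p x) = F x := by
  simp only [parabolicField, map_add, map_smul, smul_eq_mul, hF.fderiv_apply_normal]
  ring

lemma fderiv_two_parabolicField (hF : IsGraphFunction n F) (p x : E) :
    fderiv ℝ (fderiv ℝ F) x (parabolicField n F p x) =
      (1 / 2 : ℝ) • fderiv ℝ (fderiv ℝ F) x (orthComponent n (x - p)) := by
  simp only [parabolicField, map_add, map_smul, hF.fderiv_two_normal]
  simp

lemma fderiv_three_parabolicField (hF : IsGraphFunction n F) (p x : E) :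
    fderiv ℝ (fderiv ℝ (fderiv ℝ F)) x (parabolicField n F p x) =
      (1 / 2 : ℝ) • fderiv ℝ (fderiv ℝ (fderiv ℝ F)) x (orthComponent n (x - p)) := by
  simp only [parabolicField, map_add, map_smul, hF.fderiv_three_normal]
  simp

lemma hasFDerivAt_orthComponent_sub (n p x : E) :
    HasFDerivAt (fun x => orthComponent n (x - p)) (orthComponent n) x := by
  have h : HasFDerivAt (fun x => x - p) (ContinuousLinearMap.id ℝ E) x :=
    (hasFDerivAt_id x).sub_const p
  exact (orthComponent n).hasFDerivAt.comp x h

lemma hasFDerivAt_fderiv (hF : IsGraphFunction n F) (x : E) :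
    HasFDerivAt (fderiv ℝ F) (fderiv ℝ (fderiv ℝ F) x) x :=
  (hF.contDiff_fderiv.differentiable (by simp) x).hasFDerivAt

lemma hasFDerivAt_fderiv_two (hF : IsGraphFunction n F) (x : E) :
    HasFDerivAt (fderiv ℝ (fderiv ℝ F)) (fderiv ℝ (fderiv ℝ (fderiv ℝ F)) x) x :=
  (hF.contDiff_fderiv_two.differentiable (by simp) x).hasFDerivAt

lemma dirDeriv_self (hF : IsGraphFunction n F) (p x : E) :
    dirDeriv (parabolicField n F p) F x = F x := hF.fderiv_parabolicField p x

/-- To be compared with the phase itself, which is `graphBregman - F` when `F p = 0`: the phase is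
homogeneous of degree one up to `graphEuler - graphBregman`. -/
lemma dirDeriv_tangentPhase (hF : IsGraphFunction n F) (p x : E) :
    dirDeriv (parabolicField n F p) (tangentPhase F p) x = graphEuler n F p x - F x := by
  have h : HasFDerivAt (tangentPhase F p) (-(fderiv ℝ F p)) x := by
    have h1 : HasFDerivAt (fun x => p - x) (-(ContinuousLinearMap.id ℝ E)) x :=
      (hasFDerivAt_id x).const_sub p
    have := (fderiv ℝ F p).hasFDerivAt.comp x h1
    convert! this using 1
    ext v; simp
  simp only [dirDeriv, h.fderiv, graphEuler, parabolicField]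
  simp only [map_add, map_smul, smul_eq_mul, hF.fderiv_apply_normal, _root_.neg_apply,
    _root_.sub_apply]
  ring

lemma dirDeriv_graphEuler (hF : IsGraphFunction n F) (p x : E) :
    dirDeriv (parabolicField n F p) (graphEuler n F p) x =
      1 / 2 * graphEuler n F p x + graphQuadratic n F p x := by
  have h := (((hF.hasFDerivAt_fderiv x).sub_const (fderiv ℝ F p)).clm_apply
    (hasFDerivAt_orthComponent_sub n p x)).const_mul (1 / 2 : ℝ)
  have h' : fderiv ℝ (graphEuler n F p) x = _ := h.fderiv
  simp only [dirDeriv, h']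
  simp [hF.orthComponent_parabolicField, hF.fderiv_two_parabolicField, graphEuler, graphQuadratic]
  ring

lemma dirDeriv_graphBregman (hF : IsGraphFunction n F) (p x : E) :
    dirDeriv (parabolicField n F p) (graphBregman F p) x = graphEuler n F p x := by
  have h1 : HasFDerivAt (fun x => x - p) (ContinuousLinearMap.id ℝ E) x :=
    (hasFDerivAt_id x).sub_const p
  have h := ((hF.contDiff.differentiable (by simp) x).hasFDerivAt.sub_const (F p)).sub
    ((fderiv ℝ F p).hasFDerivAt.comp x h1)
  have h' : fderiv ℝ (graphBregman F p) x = _ := h.fderiv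
  simp only [dirDeriv, h', graphEuler]
  simp only [_root_.sub_apply, ContinuousLinearMap.comp_id, hF.fderiv_parabolicField]
  simp only [parabolicField, map_add, map_smul, smul_eq_mul, hF.fderiv_apply_normal]
  ring

lemma dirDeriv_graphQuadratic (hF : IsGraphFunction n F) (p x : E) :
    dirDeriv (parabolicField n F p) (graphQuadratic n F p) x =
      graphQuadratic n F p x + graphCubic n F p x := by
  have h := (((hF.hasFDerivAt_fderiv_two x).clm_apply
    (hasFDerivAt_orthComponent_sub n p x)).clm_apply
    (hasFDerivAt_orthComponent_sub n p x)).const_mul (1 / 4 : ℝ)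
  have h' : fderiv ℝ (graphQuadratic n F p) x = _ := h.fderiv
  simp only [dirDeriv, h']
  simp [hF.orthComponent_parabolicField, hF.fderiv_three_parabolicField, graphQuadratic, graphCubic]
  ring

lemma dirDeriv_inner_orthComponent (hF : IsGraphFunction n F) (p v x : E) :
    dirDeriv (parabolicField n F p) (fun x => ⟪v, orthComponent n (x - p)⟫) x =
      1 / 2 * ⟪v, orthComponent n (x - p)⟫ := by
  have h : HasFDerivAt (fun x => ⟪v, orthComponent n (x - p)⟫)
      ((innerSL ℝ v).comp (orthComponent n)) x :=
    (innerSL ℝ v).hasFDerivAt.comp x (hasFDerivAt_orthComponent_sub n p x)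
  simp only [dirDeriv, h.fderiv]
  simp [hF.orthComponent_parabolicField]

/-- Half the projection to the orthogonal complement of `n` has trace `(d - 1) / 2`, and `F n`
contributes `F'(x) n = 1`. The last term contributes nothing, since `orthComponent n` and the second
derivative both kill `n`. This constant is the decay exponent of the pole integrals. -/
lemma divergence_parabolicField [FiniteDimensional ℝ E] (hF : IsGraphFunction n F) (p x : E) :
    divergence (parabolicField n F p) x = ((Module.finrank ℝ E : ℝ) + 1) / 2 := by
  have hn := hF.norm_eq_one
  have h1 := hasFDerivAt_orthComponent_sub n p x
  have h2 := (hF.hasFDerivAt_fderiv x).clm_apply h1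
  have h3 := (hF.contDiff.differentiable (by simp) x).hasFDerivAt.sub (h2.const_mul (1 / 2 : ℝ))
  have h := (h1.const_smul (1 / 2 : ℝ)).add (h3.smul_const n)
  have h' : fderiv ℝ (parabolicField n F p) x = _ := h.fderiv
  set b := stdOrthonormalBasis ℝ E
  have hb : ∀ (f : E →L[ℝ] ℝ), ∑ i, ⟪b i, n⟫ * f (b i) = f n := by
    intro f
    conv_rhs => rw [← b.sum_repr' n]
    simp
  have hsq : ∑ i, ⟪b i, n⟫ * ⟪n, b i⟫ = 1 := by
    have := hb (innerSL ℝ n)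
    simpa [hn] using this
  have key : ∀ i, ⟪b i, fderiv ℝ (parabolicField n F p) x (b i)⟫ =
      1 / 2 * (1 - ⟪b i, n⟫ * ⟪n, b i⟫) + ⟪b i, n⟫ * (fderiv ℝ F x (b i)) -
      1 / 2 * (⟪b i, n⟫ * ((fderiv ℝ F x).comp (orthComponent n)) (b i)) -
      1 / 2 * (⟪b i, n⟫ *
        ((fderiv ℝ (fderiv ℝ F) x).flip (orthComponent n (x - p))) (b i)) := by
    intro i
    rw [h']
    simp [inner_add_right, inner_smul_right, orthComponent_apply, inner_sub_right]
    ring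
  rw [divergence]
  simp only [b, key, Finset.sum_add_distrib, Finset.sum_sub_distrib, ← Finset.mul_sum]
  simp only [← show b = stdOrthonormalBasis ℝ E from rfl]
  rw [hsq, hb, hb, hb]
  simp [hF.fderiv_apply_normal, orthComponent_self hn, hF.fderiv_two_normal]
  ring

end IsGraphFunction

end GraphFunction

/-! ### Restricting families of symbols and changing weights. -/

section SymbolReindex

variable {E : Type*} [NormedAddCommGroup E] [NormedSpace ℝ E] {ι ι' : Type*}
variable {V : ι → E → E} {S : ι → Set E} {w w' : ι → E → ℝ} {g : ι → E → ℂ}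

lemma SymbolBound.reindex {k : ℕ} (hg : SymbolBound V S k w g) (f : ι' → ι) {S' : ι' → Set E}
    (hS : ∀ i, S' i ⊆ S (f i)) :
    SymbolBound (fun i => V (f i)) S' k (fun i => w (f i)) (fun i => g (f i)) := by
  have key : ∀ {g : ι → E → ℂ}, (∃ C, 0 ≤ C ∧ ∀ i, ∀ x ∈ S i, ‖g i x‖ ≤ C * w i x) →
      (∃ C, 0 ≤ C ∧ ∀ i, ∀ x ∈ S' i, ‖g (f i) x‖ ≤ C * w (f i) x) := by
    rintro g ⟨C, hC, h⟩
    exact ⟨C, hC, fun i x hx => h (f i) x (hS i hx)⟩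
  induction k generalizing g with
  | zero => exact key hg
  | succ k ih => exact ⟨key hg.1, ih hg.2⟩

/-- A symbol vanishing identically where the weight is small. -/
lemma SymbolBound.of_eq_zero {k : ℕ} (hg : SymbolBound V S k (fun _ _ => 1) g)
    {O : Set E} (hO : IsOpen O) (h0 : ∀ i, ∀ x ∈ O, g i x = 0)
    (hw0 : ∀ i, ∀ x ∈ S i, 0 ≤ w i x)
    (hw : ∃ C, 0 ≤ C ∧ ∀ i, ∀ x ∈ S i, x ∉ O → 1 ≤ C * w i x) : SymbolBound V S k w g := by
  have key : ∀ {g : ι → E → ℂ}, (∀ i, ∀ x ∈ O, g i x = 0) →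
      (∃ C, 0 ≤ C ∧ ∀ i, ∀ x ∈ S i, ‖g i x‖ ≤ C * 1) →
      (∃ C, 0 ≤ C ∧ ∀ i, ∀ x ∈ S i, ‖g i x‖ ≤ C * w i x) := by
    rintro g h0 ⟨C, hC, h⟩
    obtain ⟨C', hC', h'⟩ := hw
    refine ⟨C * C', by positivity, fun i x hx => ?_⟩
    by_cases hxO : x ∈ O
    · rw [h0 i x hxO, norm_zero]
      exact mul_nonneg (by positivity) (hw0 i x hx)
    · refine (h i x hx).trans ?_
      rw [mul_assoc]
      exact mul_le_mul_of_nonneg_left (h' i x hx hxO) hC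
  have hd : ∀ {g : ι → E → ℂ}, (∀ i, ∀ x ∈ O, g i x = 0) →
      ∀ i, ∀ x ∈ O, dirDeriv (V i) (g i) x = 0 := by
    intro g h0 i x hx
    have : g i =ᶠ[𝓝 x] fun _ => 0 := by
      filter_upwards [hO.mem_nhds hx] with y hy using h0 i y hy
    simp [dirDeriv, this.fderiv_eq]
  induction k generalizing g with
  | zero => exact key h0 hg
  | succ k ih => exact ⟨key h0 hg.1, ih hg.2 (hd h0)⟩

end SymbolReindex

/-! ### One-variable Taylor estimates, later applied on the segment from `p` to `x`. -/

section OneVariable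

variable {h k k' b : ℝ → ℝ} {A₁ A₂ M : ℝ}

lemma sub_mem_Icc_of_deriv (hh : ∀ t, HasDerivAt h (k t) t)
    (hk : ∀ t ∈ Icc (0:ℝ) 1, k t ∈ Icc A₁ A₂) {t : ℝ} (ht : t ∈ Icc (0:ℝ) 1) :
    h t - h 0 ∈ Icc (A₁ * t) (A₂ * t) := by
  rcases ht.1.eq_or_lt with rfl | h0
  · simp
  obtain ⟨ξ, hξ, he⟩ := exists_hasDerivAt_eq_slope h k h0
    (fun x _ => (hh x).continuousAt.continuousWithinAt) (fun x _ => hh x)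
  have h1 := hk ξ ⟨hξ.1.le, hξ.2.le.trans ht.2⟩
  rw [sub_zero, eq_div_iff h0.ne'] at he
  rw [← he]
  exact ⟨mul_le_mul_of_nonneg_right h1.1 h0.le, mul_le_mul_of_nonneg_right h1.2 h0.le⟩

/-- By the first-order bounds, `b t - A t² / 2` is monotone for `A = A₁` and antitone for `A = A₂`.
-/
lemma remainder_mem_Icc_of_deriv (hh : ∀ t, HasDerivAt h (k t) t)
    (hk : ∀ t ∈ Icc (0:ℝ) 1, k t ∈ Icc A₁ A₂) (hb : ∀ t, HasDerivAt b (h t - h 0) t)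
    (hb0 : b 0 = 0) : b 1 ∈ Icc (A₁ / 2) (A₂ / 2) := by
  have hsub := fun t ht => sub_mem_Icc_of_deriv hh hk (t := t) ht
  have hd : ∀ A t : ℝ, HasDerivAt (fun t => b t - A / 2 * t ^ 2) (h t - h 0 - A * t) t := by
    intro A t
    have := (hb t).sub ((hasDerivAt_pow 2 t).const_mul (A / 2))
    convert! this using 1
    simp
    ring
  constructor
  · have hm : MonotoneOn (fun t => b t - A₁ / 2 * t ^ 2) (Icc 0 1) := by
      refine monotoneOn_of_deriv_nonneg (convex_Icc 0 1)
        (fun t _ => (hd A₁ t).continuousAt.continuousWithinAt)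
        (fun t _ => (hd A₁ t).differentiableAt.differentiableWithinAt) fun t ht => ?_
      rw [(hd A₁ t).deriv]
      have := (hsub t (interior_subset ht)).1
      linarith
    have := hm (left_mem_Icc.2 zero_le_one) (right_mem_Icc.2 zero_le_one) zero_le_one
    simp only [hb0] at this
    linarith
  · have hm : AntitoneOn (fun t => b t - A₂ / 2 * t ^ 2) (Icc 0 1) := by
      refine antitoneOn_of_deriv_nonpos (convex_Icc 0 1)
        (fun t _ => (hd A₂ t).continuousAt.continuousWithinAt)
        (fun t _ => (hd A₂ t).differentiableAt.differentiableWithinAt) fun t ht => ?_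
      rw [(hd A₂ t).deriv]
      have := (hsub t (interior_subset ht)).2
      linarith
    have := hm (left_mem_Icc.2 zero_le_one) (right_mem_Icc.2 zero_le_one) zero_le_one
    simp only [hb0] at this
    linarith

/-- Two applications of the mean value theorem: `h t - h 0 = t k(ξ)`, and then `k t - k ξ = k'(η) (t
- ξ)`. -/
lemma abs_mul_sub_sub_le (hh : ∀ t, HasDerivAt h (k t) t) (hk : ∀ t, HasDerivAt k (k' t) t)
    (hM : ∀ t ∈ Icc (0:ℝ) 1, |k' t| ≤ M) {t : ℝ} (ht : t ∈ Icc (0:ℝ) 1) :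
    |t * k t - (h t - h 0)| ≤ M := by
  have hM0 : 0 ≤ M := (abs_nonneg _).trans (hM 0 (by simp))
  rcases ht.1.eq_or_lt with rfl | h0
  · simpa using hM0
  obtain ⟨ξ, hξ, he⟩ := exists_hasDerivAt_eq_slope h k h0
    (fun x _ => (hh x).continuousAt.continuousWithinAt) (fun x _ => hh x)
  rw [sub_zero, eq_div_iff h0.ne'] at he
  obtain ⟨η, hη, he'⟩ := exists_hasDerivAt_eq_slope k k' hξ.2
    (fun x _ => (hk x).continuousAt.continuousWithinAt) (fun x _ => hk x)
  rw [eq_div_iff (by linarith [hξ.2])] at he'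
  have h1 := hM η ⟨(hξ.1.trans hη.1).le, hη.2.le.trans ht.2⟩
  rw [← he, show t * k t - k ξ * t = t * (k' η * (t - ξ)) by rw [he']; ring, abs_mul, abs_mul,
    abs_of_pos h0, abs_of_pos (sub_pos.2 hξ.2)]
  have h2 : t - ξ ≤ 1 := by linarith [hξ.1, ht.2]
  have h3 : 0 ≤ t - ξ := sub_nonneg.2 hξ.2.le
  calc t * (|k' η| * (t - ξ)) ≤ 1 * (M * 1) :=
        mul_le_mul ht.2 (mul_le_mul h1 h2 h3 hM0) (by positivity) zero_le_one
    _ = M := by ring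

/-- The function `t (h t - h 0) / 2 - b t` vanishes at `0`, and its derivative is half the quantity
bounded in `abs_mul_sub_sub_le`. It measures how far the remainder is from being exactly quadratic.
-/
lemma abs_half_sub_remainder_le (hh : ∀ t, HasDerivAt h (k t) t)
    (hk : ∀ t, HasDerivAt k (k' t) t)
    (hM : ∀ t ∈ Icc (0:ℝ) 1, |k' t| ≤ M) (hb : ∀ t, HasDerivAt b (h t - h 0) t)
    (hb0 : b 0 = 0) : |1 / 2 * (h 1 - h 0) - b 1| ≤ M := by
  have hM0 : 0 ≤ M := (abs_nonneg _).trans (hM 0 (by simp))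
  have hd : ∀ t, HasDerivAt (fun t => 1 / 2 * (t * (h t - h 0)) - b t)
      (1 / 2 * (t * k t - (h t - h 0))) t := by
    intro t
    have := (((hasDerivAt_id t).mul ((hh t).sub_const (h 0))).const_mul (1 / 2)).sub (hb t)
    convert! this using 1
    simp
    ring
  obtain ⟨ξ, hξ, he⟩ := exists_hasDerivAt_eq_slope _ _ (zero_lt_one (α := ℝ))
    (fun x _ => (hd x).continuousAt.continuousWithinAt) (fun x _ => hd x)
  have h1 := abs_mul_sub_sub_le hh hk hM (t := ξ) ⟨hξ.1.le, hξ.2.le⟩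
  simp only [hb0] at he
  have h2 : 1 / 2 * (h 1 - h 0) - b 1 = 1 / 2 * (ξ * k ξ - (h ξ - h 0)) := by
    rw [he]; ring
  rw [h2, abs_mul]
  have : |(1 / 2 : ℝ)| = 1 / 2 := by norm_num
  rw [this]
  linarith

end OneVariable

/-! ### Strictly convex graphs: Taylor estimates. -/

section StrictGraph

variable {E : Type*} [NormedAddCommGroup E] [InnerProductSpace ℝ E]

/-- Near `p₀` the set `Ω` is the sublevel set `{F ≤ 0}` of a graph function `F` whose Hessian is
uniformly positive in the directions orthogonal to `n`. -/
structure IsStrictGraph (Ω : Set E) (n p₀ : E) (F : E → ℝ) (r κ : ℝ) : Prop where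
  graph : IsGraphFunction n F
  r_pos : 0 < r
  κ_pos : 0 < κ
  mem_iff : ∀ x ∈ Metric.ball p₀ r, x ∈ Ω ↔ F x ≤ 0
  strict : ∀ x ∈ Metric.ball p₀ r, ∀ v, ⟪n, v⟫ = 0 → κ * ‖v‖ ^ 2 ≤ fderiv ℝ (fderiv ℝ F) x v v

variable {Ω : Set E} {n p₀ : E} {F : E → ℝ} {r κ : ℝ}

lemma add_smul_sub_mem_ball {p x : E} (hp : p ∈ Metric.ball p₀ r) (hx : x ∈ Metric.ball p₀ r)
    {t : ℝ} (ht : t ∈ Icc (0:ℝ) 1) : p + t • (x - p) ∈ Metric.ball p₀ r :=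
  (convex_ball p₀ r).add_smul_sub_mem hp hx ht

lemma hasDerivAt_segment (p v : E) (t : ℝ) : HasDerivAt (fun t : ℝ => p + t • v) v t := by
  simpa using ((hasDerivAt_id t).smul_const v).const_add p

lemma Continuous.exists_bound_ball [FiniteDimensional ℝ E] {W : Type*} [NormedAddCommGroup W]
    {g : E → W} (hg : Continuous g) (p₀ : E) (r : ℝ) :
    ∃ C, 0 ≤ C ∧ ∀ x ∈ Metric.ball p₀ r, ‖g x‖ ≤ C := by
  obtain ⟨C, hC⟩ := (isCompact_closedBall p₀ r).exists_bound_of_continuousOn hg.continuousOn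
  exact ⟨max C 0, le_max_right _ _, fun x hx =>
    (hC x (Metric.ball_subset_closedBall hx)).trans (le_max_left _ _)⟩

namespace IsStrictGraph

lemma tangentPhase_eq (hp : F p₀ = 0) (x : E) :
    tangentPhase F p₀ x = graphBregman F p₀ x - F x := by
  simp only [tangentPhase, graphBregman, hp, map_sub]
  ring

variable [FiniteDimensional ℝ E]

/-- Taylor estimates for a graph function with base point `p`. -/
lemma exists_taylor_bounds (H : IsStrictGraph Ω n p₀ F r κ) :
    ∃ C, 0 ≤ C ∧ ∀ p ∈ Metric.ball p₀ r, ∀ x ∈ Metric.ball p₀ r,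
      κ / 2 * ‖orthComponent n (x - p)‖ ^ 2 ≤ graphEuler n F p x ∧
      graphEuler n F p x ≤ C * ‖orthComponent n (x - p)‖ ^ 2 ∧
      κ / 2 * ‖orthComponent n (x - p)‖ ^ 2 ≤ graphBregman F p x ∧
      graphBregman F p x ≤ C * ‖orthComponent n (x - p)‖ ^ 2 ∧
      |graphQuadratic n F p x| ≤ C * ‖orthComponent n (x - p)‖ ^ 2 ∧
      |graphEuler n F p x - graphBregman F p x| ≤ C * ‖orthComponent n (x - p)‖ ^ 3 ∧
      |graphQuadratic n F p x - 1 / 2 * graphEuler n F p x| ≤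
        C * ‖orthComponent n (x - p)‖ ^ 3 := by
  obtain ⟨M₂, hM₂, hb₂⟩ := H.graph.contDiff_fderiv_two.continuous.exists_bound_ball p₀ r
  obtain ⟨M₃, hM₃, hb₃⟩ := H.graph.contDiff_fderiv_three.continuous.exists_bound_ball p₀ r
  refine ⟨M₂ + M₃, by positivity, fun p hp x hx => ?_⟩
  have hn := H.graph.norm_eq_one
  set v := x - p with hv
  set z := orthComponent n v with hz
  let γ : ℝ → E := fun t => p + t • v
  have hγ : ∀ t, HasDerivAt γ v t := hasDerivAt_segment p v
  have hγm : ∀ t ∈ Icc (0:ℝ) 1, γ t ∈ Metric.ball p₀ r := fun t ht =>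
    add_smul_sub_mem_ball hp hx ht
  have hγ0 : γ 0 = p := by simp [γ]
  have hγ1 : γ 1 = x := by simp [γ, hv]
  -- The restrictions to the segment of `F' z`, `F''(z, z)`, `F'''(z, z, z)` and of the Taylor
  -- remainder. The velocity `v` may be replaced by `z` because the second and third derivatives
  -- kill `n`.
  let h : ℝ → ℝ := fun t => fderiv ℝ F (γ t) z
  let k : ℝ → ℝ := fun t => fderiv ℝ (fderiv ℝ F) (γ t) z z
  let k' : ℝ → ℝ := fun t => fderiv ℝ (fderiv ℝ (fderiv ℝ F)) (γ t) z z z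
  let b : ℝ → ℝ := fun t => F (γ t) - F p - t * fderiv ℝ F p v
  have hh : ∀ t, HasDerivAt h (k t) t := by
    intro t
    have h1 := (H.graph.hasFDerivAt_fderiv (γ t)).comp_hasDerivAt t (hγ t)
    have h2 := h1.clm_apply (hasDerivAt_const t z)
    simpa [h, k, H.graph.fderiv_two_apply (γ t) v] using h2
  have hk : ∀ t, HasDerivAt k (k' t) t := by
    intro t
    have h1 := (H.graph.hasFDerivAt_fderiv_two (γ t)).comp_hasDerivAt t (hγ t)
    have h2 := (h1.clm_apply (hasDerivAt_const t z)).clm_apply (hasDerivAt_const t z)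
    have h3 : fderiv ℝ (fderiv ℝ (fderiv ℝ F)) (γ t) v =
        fderiv ℝ (fderiv ℝ (fderiv ℝ F)) (γ t) z := by
      simp [hz, orthComponent_apply, H.graph.fderiv_three_normal]
    simpa [k, k', h3] using h2
  -- Both derivatives take the value `1` on `n`, so their difference sees only `z`.
  have hvz : ∀ y, (fderiv ℝ F y - fderiv ℝ F p) v = (fderiv ℝ F y - fderiv ℝ F p) z := by
    intro y
    simp [hz, orthComponent_apply, H.graph.fderiv_apply_normal]
  have hb : ∀ t, HasDerivAt b (h t - h 0) t := by
    intro t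
    have h1 := ((H.graph.contDiff.differentiable (by simp) (γ t)).hasFDerivAt.comp_hasDerivAt t
      (hγ t)).sub_const (F p)
    have h2 := h1.sub ((hasDerivAt_id t).mul_const (fderiv ℝ F p v))
    convert! h2 using 1
    have := hvz (γ t)
    simp only [_root_.sub_apply] at this
    simp only [h, hγ0, one_mul]
    linarith
  have hb0 : b 0 = 0 := by simp [b, hγ0]
  have hkI : ∀ t ∈ Icc (0:ℝ) 1, k t ∈ Icc (κ * ‖z‖ ^ 2) (M₂ * ‖z‖ ^ 2) := by
    intro t ht
    refine ⟨H.strict _ (hγm t ht) z (inner_orthComponent hn v), ?_⟩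
    refine (le_abs_self _).trans ?_
    rw [← Real.norm_eq_abs]
    refine (ContinuousLinearMap.le_opNorm₂ _ _ _).trans ?_
    rw [mul_assoc, ← sq]
    gcongr
    exact hb₂ _ (hγm t ht)
  have hk'I : ∀ t ∈ Icc (0:ℝ) 1, |k' t| ≤ M₃ * ‖z‖ ^ 3 := by
    intro t ht
    rw [← Real.norm_eq_abs]
    refine (ContinuousLinearMap.le_opNorm₂ _ _ _).trans ?_
    refine (mul_le_mul_of_nonneg_right (mul_le_mul_of_nonneg_right
      (ContinuousLinearMap.le_opNorm _ _) (norm_nonneg _)) (norm_nonneg _)).trans ?_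
    have := hb₃ _ (hγm t ht)
    calc _ = ‖fderiv ℝ (fderiv ℝ (fderiv ℝ F)) (γ t)‖ * ‖z‖ ^ 3 := by ring
      _ ≤ _ := by gcongr
  have hE : graphEuler n F p x = 1 / 2 * (h 1 - h 0) := by
    simp [graphEuler, h, hγ0, hγ1, ← hv, ← hz]
  have hB : graphBregman F p x = b 1 := by
    simp [graphBregman, b, hγ1, ← hv]
  have hS : graphQuadratic n F p x = 1 / 4 * k 1 := by
    simp [graphQuadratic, k, hγ1, ← hv, ← hz]
  have m1 : (1:ℝ) ∈ Icc (0:ℝ) 1 := by simp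
  have r1 := sub_mem_Icc_of_deriv hh hkI m1
  have r2 := remainder_mem_Icc_of_deriv hh hkI hb hb0
  have r3 := abs_mul_sub_sub_le hh hk hk'I m1
  have r4 := abs_half_sub_remainder_le hh hk hk'I hb hb0
  have r5 := hkI 1 m1
  rw [mul_one, mul_one] at r1
  rw [one_mul] at r3
  have z2 : 0 ≤ ‖z‖ ^ 2 := by positivity
  have z3 : 0 ≤ ‖z‖ ^ 3 := by positivity
  have p1 : 0 ≤ M₂ * ‖z‖ ^ 2 := by positivity
  have p2 : 0 ≤ M₃ * ‖z‖ ^ 2 := by positivity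
  have p3 : 0 ≤ M₂ * ‖z‖ ^ 3 := by positivity
  have p4 : 0 ≤ M₃ * ‖z‖ ^ 3 := by positivity
  have p5 : 0 ≤ κ * ‖z‖ ^ 2 := mul_nonneg H.κ_pos.le z2
  rw [hE, hB, hS]
  rw [abs_le] at r3 r4
  obtain ⟨r1a, r1b⟩ := r1
  obtain ⟨r2a, r2b⟩ := r2
  obtain ⟨r5a, r5b⟩ := r5
  refine ⟨by linarith, by linarith, by linarith, by linarith, ?_, ?_, ?_⟩
  · rw [abs_le]; constructor <;> linarith
  · rw [abs_le]; constructor <;> linarith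
  · rw [abs_le]; constructor <;> linarith

/-- Writing `x = p + z + ⟪n, x - p⟫ n`, one has `⟪n, x - p⟫ = F x - F (p + z)`, and `F (p + z)` is
controlled by `‖z‖` because `F p = 0` and `F` is Lipschitz. Thus `z` and `F` together serve as
coordinates centred at `p`. -/
lemma exists_norm_sub_le (H : IsStrictGraph Ω n p₀ F r κ) :
    ∃ L, 1 ≤ L ∧ ∀ p ∈ Metric.ball p₀ r, F p = 0 → ∀ x ∈ Metric.ball p₀ r,
      ‖x - p‖ ≤ L * ‖orthComponent n (x - p)‖ + |F x| := by
  have hn := H.graph.norm_eq_one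
  -- The point `p + z` may leave the ball, but `‖z‖ ≤ 2 r` keeps it within `3 r`.
  obtain ⟨M₁, hM₁, hb₁⟩ := H.graph.contDiff_fderiv.continuous.exists_bound_ball p₀ (3 * r)
  refine ⟨1 + M₁, by linarith, fun p hp hFp x hx => ?_⟩
  set v := x - p with hv
  set z := orthComponent n v with hz
  have hx' : x = (p + z) + ⟪n, v⟫ • n := by
    rw [hz, orthComponent_apply, hv]
    abel
  have hFx : F x = F (p + z) + ⟪n, v⟫ := by
    conv_lhs => rw [hx']
    exact H.graph.translate _ _
  have hz' : ‖z‖ ≤ ‖v‖ := norm_orthComponent_le hn v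
  have hpd : ‖p - p₀‖ < r := mem_ball_iff_norm.1 hp
  have hxd : ‖x - p₀‖ < r := mem_ball_iff_norm.1 hx
  have hvd : ‖v‖ < 2 * r := by
    calc ‖v‖ = ‖(x - p₀) - (p - p₀)‖ := by rw [hv]; congr 1; abel
      _ ≤ ‖x - p₀‖ + ‖p - p₀‖ := norm_sub_le _ _
      _ < 2 * r := by linarith
  have hp3 : p ∈ Metric.ball p₀ (3 * r) := Metric.ball_subset_ball (by linarith [H.r_pos]) hp
  have hpz : p + z ∈ Metric.ball p₀ (3 * r) := by
    rw [mem_ball_iff_norm]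
    calc ‖p + z - p₀‖ = ‖(p - p₀) + z‖ := by congr 1; abel
      _ ≤ ‖p - p₀‖ + ‖z‖ := norm_add_le _ _
      _ < 3 * r := by linarith
  have hlip := (convex_ball p₀ (3 * r)).norm_image_sub_le_of_norm_fderiv_le (𝕜 := ℝ) (f := F)
    (fun y _ => H.graph.contDiff.differentiable (by simp) y) hb₁ hp3 hpz
  rw [hFp, sub_zero, add_sub_cancel_left, Real.norm_eq_abs] at hlip
  have h1 : |⟪n, v⟫| ≤ |F x| + M₁ * ‖z‖ := by
    have : ⟪n, v⟫ = F x - F (p + z) := by linarith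
    rw [this]
    exact (abs_sub _ _).trans (by linarith)
  have h2 : ‖v‖ ≤ ‖z‖ + |⟪n, v⟫| := by
    have h3 : v = z + ⟪n, v⟫ • n := by simp [hz, orthComponent_apply]
    calc ‖v‖ = ‖z + ⟪n, v⟫ • n‖ := by rw [← h3]
      _ ≤ ‖z‖ + ‖⟪n, v⟫ • n‖ := norm_add_le _ _
      _ = ‖z‖ + |⟪n, v⟫| := by rw [norm_smul, hn, mul_one, Real.norm_eq_abs]
  linarith

end IsStrictGraph

end StrictGraph

/-! ### Symbol bounds along the parabolic fields, uniform in the base point. -/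

section GraphSymbols

variable {E : Type*} [NormedAddCommGroup E] [InnerProductSpace ℝ E]
variable {Ω : Set E} {n p₀ : E} {F : E → ℝ} {r κ : ℝ}

/-- The base points of the family of parabolic fields: zeros of `F` in the ball. -/
abbrev GraphPoint (F : E → ℝ) (p₀ : E) (r : ℝ) : Type _ := {p : E // p ∈ Metric.ball p₀ r ∧ F p = 0}

namespace IsStrictGraph

/-- Symbol bounds along the family of parabolic fields on the ball. -/
abbrev GraphSymbol (n p₀ : E) (F : E → ℝ) (r : ℝ) (k : ℕ) (w : E → E → ℝ) (g : E → E → ℝ) : Prop :=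
  SymbolBound (ι := GraphPoint F p₀ r) (fun p => parabolicField n F p.1)
    (fun _ => Metric.ball p₀ r) k (fun p => w p.1) (fun p x => (g p.1 x : ℂ))

lemma contDiff_field (H : IsStrictGraph Ω n p₀ F r κ) (i : GraphPoint F p₀ r) :
    ContDiff ℝ ∞ (parabolicField n F i.1) := H.graph.contDiff_parabolicField _

lemma graphSymbol_of_dirDeriv (H : IsStrictGraph Ω n p₀ F r κ) {w g h : E → E → ℝ} (c : ℝ)
    (hg : ∃ C, 0 ≤ C ∧ ∀ p ∈ Metric.ball p₀ r, F p = 0 → ∀ x ∈ Metric.ball p₀ r,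
      |g p x| ≤ C * w p x)
    (hd : ∀ p x, dirDeriv (parabolicField n F p) (g p) x = c * g p x + h p x)
    (hh : ∀ k, GraphSymbol n p₀ F r k w h) (sg : ∀ p, ContDiff ℝ ∞ (g p))
    (sh : ∀ p, ContDiff ℝ ∞ (h p)) (k : ℕ) : GraphSymbol n p₀ F r k w g := by
  refine SymbolBound.of_dirDeriv_eq (fun _ => (c : ℂ)) ⟨‖(c : ℂ)‖, fun _ => le_rfl⟩ ?_ ?_ hh
    (fun i => (sg _).complex_ofReal) (fun i => (sh _).complex_ofReal) H.contDiff_field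
  · obtain ⟨C, hC, hb⟩ := hg
    refine ⟨C, hC, fun i x hx => ?_⟩
    rw [Complex.norm_real, Real.norm_eq_abs]
    exact hb i.1 i.2.1 i.2.2 x hx
  · intro i
    rw [dirDeriv_ofReal (sg _)]
    funext x
    rw [hd]
    push_cast
    rfl

lemma graphSymbol_inner (H : IsStrictGraph Ω n p₀ F r κ) (v : E) (k : ℕ) :
    GraphSymbol n p₀ F r k (fun p x => ‖orthComponent n (x - p)‖)
      (fun p x => ⟪v, orthComponent n (x - p)⟫) := by
  refine H.graphSymbol_of_dirDeriv (h := fun _ _ => 0) (1 / 2)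
    ⟨‖v‖, norm_nonneg _, fun p _ _ x _ => abs_real_inner_le_norm _ _⟩ (fun p x => ?_) (fun k => ?_)
    (fun p => contDiff_const.inner ℝ (contDiff_orthComponent_sub n p)) (fun _ => contDiff_const) k
  · rw [H.graph.dirDeriv_inner_orthComponent, add_zero]
  · simpa [GraphSymbol] using! SymbolBound.zero k

lemma norm_orthComponent_sub_le (H : IsStrictGraph Ω n p₀ F r κ) {p x : E}
    (hp : p ∈ Metric.ball p₀ r) (hx : x ∈ Metric.ball p₀ r) :
    ‖orthComponent n (x - p)‖ ≤ 2 * r := by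
  refine (norm_orthComponent_le H.graph.norm_eq_one _).trans ?_
  rw [mem_ball_iff_norm] at hp hx
  calc ‖x - p‖ = ‖(x - p₀) - (p - p₀)‖ := by congr 1; abel
    _ ≤ ‖x - p₀‖ + ‖p - p₀‖ := norm_sub_le _ _
    _ ≤ 2 * r := by linarith

lemma graphSymbol_inner_one (H : IsStrictGraph Ω n p₀ F r κ) (v : E) (k : ℕ) :
    GraphSymbol n p₀ F r k (fun _ _ => 1) (fun p x => ⟪v, orthComponent n (x - p)⟫) :=
  (H.graphSymbol_inner v k).mono ⟨2 * r, by linarith [H.r_pos], fun i x hx => by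
    rw [mul_one]; exact H.norm_orthComponent_sub_le i.2.1 hx⟩

lemma graphSymbol_self (H : IsStrictGraph Ω n p₀ F r κ) (k : ℕ) :
    GraphSymbol n p₀ F r k (fun _ x => |F x|) (fun _ x => F x) := by
  refine H.graphSymbol_of_dirDeriv (h := fun _ _ => 0) 1
    ⟨1, zero_le_one, fun p _ _ x _ => by simp⟩ (fun p x => ?_) (fun k => ?_)
    (fun _ => H.graph.contDiff) (fun _ => contDiff_const) k
  · rw [H.graph.dirDeriv_self]; simp
  · simpa [GraphSymbol] using! SymbolBound.zero k

variable [FiniteDimensional ℝ E]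

/-- The dependence on `p` is isolated in the coordinates of `z`, which are uniformly bounded
symbols; the other factors are fixed smooth functions. -/
lemma dirDeriv_parabolicField_eq_sum (p x : E) (g : E → ℝ) :
    dirDeriv (parabolicField n F p) g x =
      ∑ a, (1 / 2 * ⟪stdOrthonormalBasis ℝ E a, orthComponent n (x - p)⟫) *
        fderiv ℝ g x (stdOrthonormalBasis ℝ E a) +
      (F x + -1 * ∑ a, (1 / 2 * ⟪stdOrthonormalBasis ℝ E a, orthComponent n (x - p)⟫) *
        fderiv ℝ F x (stdOrthonormalBasis ℝ E a)) * fderiv ℝ g x n := by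
  set b := stdOrthonormalBasis ℝ E
  have key : ∀ f : E →L[ℝ] ℝ, 1 / 2 * f (orthComponent n (x - p)) =
      ∑ a, (1 / 2 * ⟪b a, orthComponent n (x - p)⟫) * f (b a) := by
    intro f
    conv_lhs => rw [← b.sum_repr' (orthComponent n (x - p))]
    rw [map_sum, Finset.mul_sum]
    refine Finset.sum_congr rfl fun a _ => ?_
    simp
    ring
  rw [← key, ← key]
  simp only [dirDeriv, parabolicField, map_add, map_smul, smul_eq_mul]
  ring

/-- The induction on `k` runs over all smooth `g` at once: one derivative along the field is a
combination of products of coordinates of `z`, of `F`, and of partial derivatives of `F` and `g`, to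
which the hypothesis applies. -/
lemma graphSymbol_smooth (H : IsStrictGraph Ω n p₀ F r κ) (k : ℕ) :
    ∀ g : E → ℝ, ContDiff ℝ ∞ g → GraphSymbol n p₀ F r k (fun _ _ => 1) (fun _ x => g x) := by
  have hb : ∀ g : E → ℝ, ContDiff ℝ ∞ g → ∃ C, 0 ≤ C ∧ ∀ i : GraphPoint F p₀ r,
      ∀ x ∈ Metric.ball p₀ r, ‖(g x : ℂ)‖ ≤ C * 1 := by
    intro g hg
    obtain ⟨C, hC, h⟩ := hg.continuous.exists_bound_ball p₀ r
    exact ⟨C, hC, fun i x hx => by simpa using h x hx⟩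
  induction k with
  | zero => exact hb
  | succ k ih =>
    intro g hg
    refine ⟨hb g hg, ?_⟩
    have hsub : ∀ (g : E → ℝ), ContDiff ℝ ∞ g → ∀ v, ContDiff ℝ ∞ (fun x => fderiv ℝ g x v) :=
      fun g hg v => (hg.fderiv_right (m := ∞) (by simp)).clm_apply contDiff_const
    let b := stdOrthonormalBasis ℝ E
    have hzs : ∀ a, ∀ i : GraphPoint F p₀ r,
        ContDiff ℝ ∞ (fun x => ((⟪b a, orthComponent n (x - i.1)⟫ : ℝ) : ℂ)) := fun a i =>
      (contDiff_const.inner ℝ (contDiff_orthComponent_sub n i.1)).complex_ofReal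
    have hterm_s : ∀ (g : E → ℝ), ContDiff ℝ ∞ g → ∀ a, ∀ i : GraphPoint F p₀ r,
        ContDiff ℝ ∞ (fun x => ((1 / 2 : ℂ) * ((⟪b a, orthComponent n (x - i.1)⟫ : ℝ) : ℂ)) *
          ((fderiv ℝ g x (b a) : ℝ) : ℂ)) := fun g hg a i =>
      (contDiff_const.mul (hzs a i)).mul (hsub g hg _).complex_ofReal
    have hterm : ∀ (g : E → ℝ), ContDiff ℝ ∞ g → ∀ a,
        SymbolBound (ι := GraphPoint F p₀ r) (fun p => parabolicField n F p.1)
          (fun _ => Metric.ball p₀ r) k (fun _ _ => 1)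
          (fun i x => ((1 / 2 : ℂ) * ((⟪b a, orthComponent n (x - i.1)⟫ : ℝ) : ℂ)) *
          ((fderiv ℝ g x (b a) : ℝ) : ℂ)) := by
      intro g hg a
      have h1 := SymbolBound.const_mul (fun _ => (1 / 2 : ℂ)) ⟨‖(1 / 2 : ℂ)‖, fun _ => le_rfl⟩
        (H.graphSymbol_inner_one (b a) k) (hzs a) H.contDiff_field
      have h2 := h1.mul (ih _ (hsub g hg (b a))) (fun i => contDiff_const.mul (hzs a i))
        (fun i => (hsub g hg _).complex_ofReal) H.contDiff_field
      simpa using h2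
    have hsum := fun (g : E → ℝ) (hg : ContDiff ℝ ∞ g) =>
      SymbolBound.sum Finset.univ (fun a _ => hterm g hg a) (hterm_s g hg) H.contDiff_field
    have hsum_s : ∀ (g : E → ℝ), ContDiff ℝ ∞ g → ∀ i : GraphPoint F p₀ r,
        ContDiff ℝ ∞ (fun x => ∑ a, ((1 / 2 : ℂ) * ((⟪b a, orthComponent n (x - i.1)⟫ : ℝ) : ℂ)) *
          ((fderiv ℝ g x (b a) : ℝ) : ℂ)) := fun g hg i =>
      ContDiff.sum fun a _ => hterm_s g hg a i
    have hF := H.graph.contDiff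
    have h1 := (ih F hF).add (SymbolBound.const_mul (fun _ => (-1 : ℂ)) ⟨1, by simp⟩ (hsum F hF)
      (hsum_s F hF) H.contDiff_field) (fun _ => hF.complex_ofReal)
      (fun i => contDiff_const.mul (hsum_s F hF i)) H.contDiff_field
    have h2 := h1.mul (ih _ (hsub g hg n))
      (fun i => hF.complex_ofReal.add (contDiff_const.mul (hsum_s F hF i)))
      (fun _ => (hsub g hg n).complex_ofReal) H.contDiff_field
    simp only [mul_one] at h2
    have h3 := (hsum g hg).add h2 (hsum_s g hg)
      (fun i => (hF.complex_ofReal.add (contDiff_const.mul (hsum_s F hF i))).mul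
        (hsub g hg n).complex_ofReal) H.contDiff_field
    convert h3 using 1
    funext i x
    rw [dirDeriv_ofReal hg]
    simp only
    rw [dirDeriv_parabolicField_eq_sum]
    push_cast
    rfl

lemma graphCubic_eq_sum (p x : E) :
    graphCubic n F p x = ∑ a, ∑ b, ∑ c,
      ⟪stdOrthonormalBasis ℝ E a, orthComponent n (x - p)⟫ *
      (⟪stdOrthonormalBasis ℝ E b, orthComponent n (x - p)⟫ *
      (⟪stdOrthonormalBasis ℝ E c, orthComponent n (x - p)⟫ *
        (1 / 8 * fderiv ℝ (fderiv ℝ (fderiv ℝ F)) x (stdOrthonormalBasis ℝ E a)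
          (stdOrthonormalBasis ℝ E b) (stdOrthonormalBasis ℝ E c)))) := by
  set e := stdOrthonormalBasis ℝ E
  set z := orthComponent n (x - p)
  have h : z = ∑ a, ⟪e a, z⟫ • e a := (e.sum_repr' z).symm
  have key : ∀ T : E →L[ℝ] E →L[ℝ] E →L[ℝ] ℝ, T z z z =
      ∑ a, ∑ b, ∑ c, ⟪e a, z⟫ * (⟪e b, z⟫ * (⟪e c, z⟫ * T (e a) (e b) (e c))) := by
    intro T
    have h1 : T z z z = ∑ a, ⟪e a, z⟫ * T (e a) z z := by
      conv_lhs => enter [1, 1, 2]; rw [h]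
      simp
    have h2 : ∀ a, T (e a) z z = ∑ b, ⟪e b, z⟫ * T (e a) (e b) z := by
      intro a
      conv_lhs => enter [1, 2]; rw [h]
      simp
    have h3 : ∀ a b, T (e a) (e b) z = ∑ c, ⟪e c, z⟫ * T (e a) (e b) (e c) := by
      intro a b
      conv_lhs => enter [2]; rw [h]
      simp
    rw [h1]
    simp only [h2, h3, Finset.mul_sum]
  rw [graphCubic, key]
  simp only [Finset.mul_sum]
  refine Finset.sum_congr rfl fun a _ => Finset.sum_congr rfl fun b _ =>
    Finset.sum_congr rfl fun c _ => ?_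
  ring

/-- Expanded in a basis, each term carries three coordinates of `z`, each a symbol of weight `‖z‖`,
and a smooth coefficient. -/
lemma graphSymbol_cubic (H : IsStrictGraph Ω n p₀ F r κ) (k : ℕ) :
    GraphSymbol n p₀ F r k (fun p x => ‖orthComponent n (x - p)‖ ^ 3) (graphCubic n F) := by
  set e := stdOrthonormalBasis ℝ E with he
  have hzs : ∀ a, ∀ i : GraphPoint F p₀ r,
      ContDiff ℝ ∞ (fun x => ((⟪e a, orthComponent n (x - i.1)⟫ : ℝ) : ℂ)) := fun a i =>
    (contDiff_const.inner ℝ (contDiff_orthComponent_sub n i.1)).complex_ofReal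
  have hT : ∀ a b c, ContDiff ℝ ∞ (fun x =>
      1 / 8 * fderiv ℝ (fderiv ℝ (fderiv ℝ F)) x (e a) (e b) (e c)) := fun a b c =>
    contDiff_const.mul (((H.graph.contDiff_fderiv_three.clm_apply contDiff_const).clm_apply
      contDiff_const).clm_apply contDiff_const)
  have hterm_s : ∀ a b c, ∀ i : GraphPoint F p₀ r, ContDiff ℝ ∞ (fun x =>
      ((⟪e a, orthComponent n (x - i.1)⟫ : ℝ) : ℂ) * (((⟪e b, orthComponent n (x - i.1)⟫ : ℝ) : ℂ) *
      (((⟪e c, orthComponent n (x - i.1)⟫ : ℝ) : ℂ) *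
        ((1 / 8 * fderiv ℝ (fderiv ℝ (fderiv ℝ F)) x (e a) (e b) (e c) : ℝ) : ℂ)))) :=
    fun a b c i => (hzs a i).mul ((hzs b i).mul ((hzs c i).mul (hT a b c).complex_ofReal))
  have hterm : ∀ a b c, SymbolBound (ι := GraphPoint F p₀ r) (fun p => parabolicField n F p.1)
      (fun _ => Metric.ball p₀ r) k (fun p x => ‖orthComponent n (x - p.1)‖ ^ 3) (fun i x =>
      ((⟪e a, orthComponent n (x - i.1)⟫ : ℝ) : ℂ) * (((⟪e b, orthComponent n (x - i.1)⟫ : ℝ) : ℂ) *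
      (((⟪e c, orthComponent n (x - i.1)⟫ : ℝ) : ℂ) *
        ((1 / 8 * fderiv ℝ (fderiv ℝ (fderiv ℝ F)) x (e a) (e b) (e c) : ℝ) : ℂ)))) := by
    intro a b c
    have h1 := (H.graphSymbol_inner (e c) k).mul (H.graphSymbol_smooth k _ (hT a b c)) (hzs c)
      (fun _ => (hT a b c).complex_ofReal) H.contDiff_field
    have h2 := (H.graphSymbol_inner (e b) k).mul h1 (hzs b)
      (fun i => (hzs c i).mul (hT a b c).complex_ofReal) H.contDiff_field
    have h3 := (H.graphSymbol_inner (e a) k).mul h2 (hzs a)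
      (fun i => (hzs b i).mul ((hzs c i).mul (hT a b c).complex_ofReal)) H.contDiff_field
    refine h3.mono ⟨1, zero_le_one, fun i x _ => le_of_eq ?_⟩
    ring
  have h := SymbolBound.sum Finset.univ (fun a _ => SymbolBound.sum Finset.univ (fun b _ =>
    SymbolBound.sum Finset.univ (fun c _ => hterm a b c) (hterm_s a b) H.contDiff_field)
    (fun b i => ContDiff.sum fun c _ => hterm_s a b c i) H.contDiff_field)
    (fun a i => ContDiff.sum fun b _ => ContDiff.sum fun c _ => hterm_s a b c i) H.contDiff_field
  unfold GraphSymbol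
  convert h using 1
  funext i x
  rw [graphCubic_eq_sum]
  push_cast
  rfl

/-- The derivatives along the field form a chain that the cubic term closes: from `graphCubic` one
obtains `graphQuadratic`, and from this `graphEuler`. -/
lemma graphSymbol_quadratic (H : IsStrictGraph Ω n p₀ F r κ) (k : ℕ) :
    GraphSymbol n p₀ F r k (fun p x => ‖orthComponent n (x - p)‖ ^ 2) (graphQuadratic n F) := by
  obtain ⟨C, hC, hb⟩ := H.exists_taylor_bounds
  refine H.graphSymbol_of_dirDeriv (h := graphCubic n F) 1
    ⟨C, hC, fun p hp _ x hx => (hb p hp x hx).2.2.2.2.1⟩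
    (fun p x => by rw [H.graph.dirDeriv_graphQuadratic, one_mul]) (fun k => ?_)
    H.graph.contDiff_graphQuadratic H.graph.contDiff_graphCubic k
  refine (H.graphSymbol_cubic k).mono ⟨2 * r, by linarith [H.r_pos], fun i x hx => ?_⟩
  show ‖orthComponent n (x - i.1)‖ ^ 3 ≤ 2 * r * ‖orthComponent n (x - i.1)‖ ^ 2
  rw [pow_succ, mul_comm]
  exact mul_le_mul_of_nonneg_right (H.norm_orthComponent_sub_le i.2.1 hx) (by positivity)

lemma graphSymbol_euler (H : IsStrictGraph Ω n p₀ F r κ) (k : ℕ) :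
    GraphSymbol n p₀ F r k (fun p x => ‖orthComponent n (x - p)‖ ^ 2) (graphEuler n F) := by
  obtain ⟨C, hC, hb⟩ := H.exists_taylor_bounds
  refine H.graphSymbol_of_dirDeriv (h := graphQuadratic n F) (1 / 2)
    ⟨C, hC, fun p hp _ x hx => ?_⟩ H.graph.dirDeriv_graphEuler H.graphSymbol_quadratic
    H.graph.contDiff_graphEuler H.graph.contDiff_graphQuadratic k
  obtain ⟨h1, h2, -⟩ := hb p hp x hx
  have := H.κ_pos
  rw [abs_of_nonneg (le_trans (by positivity) h1)]
  exact h2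

/-- With `S`, `E`, `T` the quadratic, Euler and cubic terms, `V (S - E / 2) = (S - E / 2) / 2 + T`.
The combination is homogeneous up to a term of third order, like the bound it satisfies. -/
lemma graphSymbol_quadratic_sub (H : IsStrictGraph Ω n p₀ F r κ) (k : ℕ) :
    GraphSymbol n p₀ F r k (fun p x => ‖orthComponent n (x - p)‖ ^ 3)
      (fun p x => graphQuadratic n F p x - 1 / 2 * graphEuler n F p x) := by
  obtain ⟨C, hC, hb⟩ := H.exists_taylor_bounds
  refine H.graphSymbol_of_dirDeriv (h := graphCubic n F) (1 / 2)
    ⟨C, hC, fun p hp _ x hx => (hb p hp x hx).2.2.2.2.2.2⟩ (fun p x => ?_) H.graphSymbol_cubic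
    (fun p => (H.graph.contDiff_graphQuadratic p).sub
      (contDiff_const.mul (H.graph.contDiff_graphEuler p))) H.graph.contDiff_graphCubic k
  have h1 := ((H.graph.contDiff_graphQuadratic p).differentiable (by simp) x).hasFDerivAt
  have h2 := ((H.graph.contDiff_graphEuler p).differentiable (by simp) x).hasFDerivAt
  have h3 := H.graph.dirDeriv_graphQuadratic p x
  have h4 := H.graph.dirDeriv_graphEuler p x
  simp only [dirDeriv] at h3 h4 ⊢
  rw [(h1.fun_sub (h2.const_mul (1 / 2))).fderiv, _root_.sub_apply, _root_.smul_apply, h3, h4]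
  simp only [smul_eq_mul]
  ring

/-- The derivative of this defect along the field is exactly the combination treated in
`graphSymbol_quadratic_sub`. -/
lemma graphSymbol_euler_sub_bregman (H : IsStrictGraph Ω n p₀ F r κ) (k : ℕ) :
    GraphSymbol n p₀ F r k (fun p x => ‖orthComponent n (x - p)‖ ^ 3)
      (fun p x => graphEuler n F p x - graphBregman F p x) := by
  obtain ⟨C, hC, hb⟩ := H.exists_taylor_bounds
  refine H.graphSymbol_of_dirDeriv
    (h := fun p x => graphQuadratic n F p x - 1 / 2 * graphEuler n F p x) 0
    ⟨C, hC, fun p hp _ x hx => (hb p hp x hx).2.2.2.2.2.1⟩ (fun p x => ?_)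
    H.graphSymbol_quadratic_sub
    (fun p => (H.graph.contDiff_graphEuler p).sub (H.graph.contDiff_graphBregman p))
    (fun p => (H.graph.contDiff_graphQuadratic p).sub
      (contDiff_const.mul (H.graph.contDiff_graphEuler p))) k
  have h1 := ((H.graph.contDiff_graphBregman p).differentiable (by simp) x).hasFDerivAt
  have h2 := ((H.graph.contDiff_graphEuler p).differentiable (by simp) x).hasFDerivAt
  have h3 := H.graph.dirDeriv_graphBregman p x
  have h4 := H.graph.dirDeriv_graphEuler p x
  simp only [dirDeriv] at h3 h4 ⊢
  rw [(h2.fun_sub h1).fderiv, _root_.sub_apply, h3, h4]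
  ring

lemma graphSymbol_dirDeriv_tangentPhase (H : IsStrictGraph Ω n p₀ F r κ) (k : ℕ) :
    GraphSymbol n p₀ F r k (fun p x => ‖orthComponent n (x - p)‖ ^ 2 + |F x|)
      (fun p => dirDeriv (parabolicField n F p) (tangentPhase F p)) := by
  have h1 := (H.graphSymbol_euler k).mono
    (w' := fun i x => ‖orthComponent n (x - i.1)‖ ^ 2 + |F x|)
    ⟨1, zero_le_one, fun i x _ => by rw [one_mul]; linarith [abs_nonneg (F x)]⟩
  have h2 := (SymbolBound.const_mul (fun _ => (-1 : ℂ)) ⟨1, by simp⟩ (H.graphSymbol_self k)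
    (fun _ => H.graph.contDiff.complex_ofReal) H.contDiff_field).mono
    (w' := fun i x => ‖orthComponent n (x - i.1)‖ ^ 2 + |F x|)
    ⟨1, zero_le_one, fun i x _ => by rw [one_mul]; simp⟩
  have h3 := h1.add h2 (fun i => (H.graph.contDiff_graphEuler _).complex_ofReal)
    (fun i => contDiff_const.mul H.graph.contDiff.complex_ofReal) H.contDiff_field
  unfold GraphSymbol
  convert h3 using 1
  funext i x
  simp only
  rw [H.graph.dirDeriv_tangentPhase]
  push_cast
  ring

end IsStrictGraph

end GraphSymbols

/-! ### Size of the phase on `Ω` and quadratic growth at boundary points. -/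

section PoleEstimates

variable {E : Type*} [NormedAddCommGroup E] [InnerProductSpace ℝ E]
variable {Ω : Set E} {n p₀ : E} {F : E → ℝ} {r κ : ℝ}

namespace IsStrictGraph

/-- The weight comparable to the tangent phase on `Ω`. -/
noncomputable def phaseWeight (n : E) (F : E → ℝ) (p x : E) : ℝ :=
  ‖orthComponent n (x - p)‖ ^ 2 + |F x|

lemma phaseWeight_nonneg (p x : E) : 0 ≤ phaseWeight n F p x := by
  unfold phaseWeight; positivity

variable [FiniteDimensional ℝ E]

/-- On `Ω` one has `-F = |F|`, so the phase is `graphBregman + |F|` and its derivative along the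
field is `graphEuler + |F|`. Both first summands are at least a multiple of `‖z‖²` by strict
convexity, and nothing can cancel. -/
lemma exists_phaseWeight_bounds (H : IsStrictGraph Ω n p₀ F r κ) :
    ∃ c C, 0 < c ∧ c ≤ 1 ∧ 1 ≤ C ∧ ∀ p ∈ Metric.ball p₀ r, F p = 0 → ∀ x ∈ Ω ∩ Metric.ball p₀ r,
      c * phaseWeight n F p x ≤ dirDeriv (parabolicField n F p) (tangentPhase F p) x ∧
      c * phaseWeight n F p x ≤ tangentPhase F p x ∧
      tangentPhase F p x ≤ C * phaseWeight n F p x := by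
  obtain ⟨C, hC, hb⟩ := H.exists_taylor_bounds
  have hκ := H.κ_pos
  refine ⟨min (κ / 2) 1, max C 1, lt_min (by positivity) one_pos, min_le_right _ _,
    le_max_right _ _, fun p hp hFp x hx => ?_⟩
  obtain ⟨h1, h2, h3, h4, -⟩ := hb p hp x hx.2
  have hFx : F x ≤ 0 := (H.mem_iff x hx.2).1 hx.1
  rw [H.graph.dirDeriv_tangentPhase, tangentPhase_eq hFp, phaseWeight, abs_of_nonpos hFx]
  set z2 := ‖orthComponent n (x - p)‖ ^ 2
  have hz2 : 0 ≤ z2 := by positivity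
  have e1 : min (κ / 2) 1 * z2 ≤ κ / 2 * z2 := mul_le_mul_of_nonneg_right (min_le_left _ _) hz2
  have e2 : min (κ / 2) 1 * -F x ≤ 1 * -F x :=
    mul_le_mul_of_nonneg_right (min_le_right _ _) (by linarith)
  have e3 : C * z2 ≤ max C 1 * z2 := mul_le_mul_of_nonneg_right (le_max_left _ _) hz2
  have e4 : 1 * -F x ≤ max C 1 * -F x :=
    mul_le_mul_of_nonneg_right (le_max_right _ _) (by linarith)
  refine ⟨?_, ?_, ?_⟩ <;> rw [mul_add] <;> linarith

/-- `Ω` lies inside a uniform paraboloid at its boundary points near `p₀`. -/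
lemma exists_growth (H : IsStrictGraph Ω n p₀ F r κ) (hΩ : IsCompact Ω) (hconv : Convex ℝ Ω) :
    ∃ c, 0 < c ∧ ∀ p ∈ Metric.ball p₀ (r / 2), F p = 0 → ∀ x ∈ Ω,
      c * ‖x - p‖ ^ 2 ≤ tangentPhase F p x := by
  obtain ⟨c₁, C₁, hc₁, -, -, hb⟩ := H.exists_phaseWeight_bounds
  obtain ⟨L, hL, hL'⟩ := H.exists_norm_sub_le
  obtain ⟨M, hM, hM'⟩ := H.graph.contDiff.continuous.exists_bound_ball p₀ r
  have hr := H.r_pos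
  set A := 2 * L ^ 2 + 2 * M with hA
  have hA0 : 0 < A := by positivity
  have loc : ∀ p ∈ Metric.ball p₀ r, F p = 0 → ∀ x ∈ Ω ∩ Metric.ball p₀ r,
      c₁ / A * ‖x - p‖ ^ 2 ≤ tangentPhase F p x := by
    intro p hp hFp x hx
    refine le_trans ?_ (hb p hp hFp x hx).2.1
    have h1 := hL' p hp hFp x hx.2
    have h2 := hM' x hx.2
    rw [Real.norm_eq_abs] at h2
    set z := ‖orthComponent n (x - p)‖ with hz
    have hz0 : 0 ≤ z := norm_nonneg _
    have h3 : ‖x - p‖ ^ 2 ≤ A * phaseWeight n F p x := by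
      have h4 : ‖x - p‖ ^ 2 ≤ (L * z + |F x|) ^ 2 := by gcongr
      have h5 : |F x| ^ 2 ≤ M * |F x| := by
        rw [sq]; gcongr
      have h6 : (L * z + |F x|) ^ 2 ≤ 2 * L ^ 2 * z ^ 2 + 2 * |F x| ^ 2 := by
        nlinarith [sq_nonneg (L * z - |F x|)]
      have h7 : 0 ≤ 2 * L ^ 2 * |F x| + 2 * M * z ^ 2 := by positivity
      rw [phaseWeight, ← hz, hA]
      nlinarith
    rw [div_mul_eq_mul_div, div_le_iff₀ hA0, mul_assoc, mul_comm _ A]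
    gcongr
  obtain ⟨Δ, hΔ⟩ := hΩ.isBounded.subset_closedBall p₀
  set c₂ := c₁ / A with hc₂
  have hc₂0 : 0 < c₂ := by positivity
  set Δ' := max Δ 0 + r with hΔ'
  have hΔ'0 : 0 < Δ' := by positivity
  refine ⟨min c₂ (c₂ * (r / 2) / Δ'), lt_min hc₂0 (by positivity), fun p hp hFp x hx => ?_⟩
  have hpr : p ∈ Metric.ball p₀ r := Metric.ball_subset_ball (by linarith) hp
  by_cases hxr : x ∈ Metric.ball p₀ r
  · refine le_trans ?_ (loc p hpr hFp x ⟨hx, hxr⟩)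
    gcongr
    exact min_le_left _ _
  · have hpd : ‖p - p₀‖ < r / 2 := mem_ball_iff_norm.1 hp
    have hxd : r ≤ ‖x - p₀‖ := by
      by_contra h
      exact hxr (mem_ball_iff_norm.2 (not_le.1 h))
    have hpx : r / 2 ≤ ‖x - p‖ := by
      have : ‖x - p₀‖ ≤ ‖x - p‖ + ‖p - p₀‖ := by
        calc ‖x - p₀‖ = ‖(x - p) + (p - p₀)‖ := by congr 1; abel
          _ ≤ _ := norm_add_le _ _
      linarith
    have hpx0 : 0 < ‖x - p‖ := by linarith
    -- A far point `x` is pulled back along the segment to distance `r / 2` from `p`. The new point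
    -- lies in `Ω` by convexity and in the ball, where the local bound holds. Since the phase is
    -- linear in `x - p`, it grows linearly, and `‖x - p‖ ≤ Δ'` turns this into a quadratic bound.
    set τ := r / 2 / ‖x - p‖ with hτ
    have hτ0 : 0 < τ := by positivity
    have hτ1 : τ ≤ 1 := by rw [hτ, div_le_one hpx0]; exact hpx
    have hpΩ : p ∈ Ω := (H.mem_iff p hpr).2 hFp.le
    have hy : p + τ • (x - p) ∈ Ω := hconv.add_smul_sub_mem hpΩ hx ⟨hτ0.le, hτ1⟩
    have hτn : ‖τ • (x - p)‖ = r / 2 := by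
      rw [norm_smul, Real.norm_eq_abs, abs_of_pos hτ0, hτ]
      field_simp
    have hyr : p + τ • (x - p) ∈ Metric.ball p₀ r := by
      rw [mem_ball_iff_norm]
      calc ‖p + τ • (x - p) - p₀‖ = ‖(p - p₀) + τ • (x - p)‖ := by congr 1; abel
        _ ≤ ‖p - p₀‖ + ‖τ • (x - p)‖ := norm_add_le _ _
        _ < r := by rw [hτn]; linarith
    have h1 := loc p hpr hFp _ ⟨hy, hyr⟩
    have h2 : tangentPhase F p (p + τ • (x - p)) = τ * tangentPhase F p x := by
      have : p - (p + τ • (x - p)) = τ • (p - x) := by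
        rw [← neg_sub x p, smul_neg]; abel
      rw [tangentPhase, this, map_smul, smul_eq_mul, tangentPhase]
    rw [h2, add_sub_cancel_left, hτn] at h1
    have h3 : c₂ * (r / 2) * ‖x - p‖ ≤ tangentPhase F p x := by
      have h4 : c₂ * (r / 2) ^ 2 * ‖x - p‖ ≤ (r / 2) * tangentPhase F p x := by
        have := mul_le_mul_of_nonneg_right h1 hpx0.le
        have e : τ * tangentPhase F p x * ‖x - p‖ = r / 2 * tangentPhase F p x := by
          rw [hτ]; field_simp
        linarith
      have h5 : (r / 2) * (c₂ * (r / 2) * ‖x - p‖) ≤ (r / 2) * tangentPhase F p x := by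
        linarith
      exact le_of_mul_le_mul_left h5 (by positivity)
    have h6 : ‖x - p‖ ≤ Δ' := by
      have hx1 : ‖x - p₀‖ ≤ Δ := mem_closedBall_iff_norm.1 (hΔ hx)
      calc ‖x - p‖ = ‖(x - p₀) - (p - p₀)‖ := by congr 1; abel
        _ ≤ ‖x - p₀‖ + ‖p - p₀‖ := norm_sub_le _ _
        _ ≤ Δ' := by rw [hΔ']; linarith [le_max_left Δ 0]
    refine le_trans ?_ h3
    calc min c₂ (c₂ * (r / 2) / Δ') * ‖x - p‖ ^ 2 ≤ c₂ * (r / 2) / Δ' * ‖x - p‖ ^ 2 := by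
          gcongr; exact min_le_right _ _
      _ = c₂ * (r / 2) * ‖x - p‖ * (‖x - p‖ / Δ') := by field_simp
      _ ≤ c₂ * (r / 2) * ‖x - p‖ * 1 := by
          gcongr; exact (div_le_one hΔ'0).2 h6
      _ = _ := mul_one _

end IsStrictGraph

section Factor

/-- In `(1 + Im s · D)² + (Re s · D)²` the cross term is nonnegative, so the square of the norm is
at least `1 + (‖s‖ D)²`. -/
lemma norm_one_sub_I_mul_ge {s : ℂ} (hs : 0 ≤ s.im) {D : ℝ} (hD : 0 ≤ D) :
    (1 + ‖s‖ * D) / 2 ≤ ‖1 - Complex.I * s * (D : ℂ)‖ := by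
  have h1 : ‖1 - Complex.I * s * (D : ℂ)‖ ^ 2 = (1 + s.im * D) ^ 2 + (s.re * D) ^ 2 := by
    rw [Complex.sq_norm, Complex.normSq_apply]
    simp
    ring
  have h2 : ‖s‖ ^ 2 = s.re ^ 2 + s.im ^ 2 := by
    rw [Complex.sq_norm, Complex.normSq_apply]; ring
  have h3 : 0 ≤ s.im * D := mul_nonneg hs hD
  have h4 : (‖s‖ * D) ^ 2 = (s.re * D) ^ 2 + (s.im * D) ^ 2 := by
    rw [mul_pow, h2]; ring
  refine le_of_sq_le_sq ?_ (norm_nonneg _)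
  rw [h1]
  nlinarith [sq_nonneg (1 - ‖s‖ * D), sq_nonneg (s.re * D), sq_nonneg (s.im * D)]

/-- Here `D` has no sign: the phase factor has to be invertible on the whole space, also outside
`Ω`. This is why frequencies with `Re s > 0` are taken. -/
lemma one_sub_I_mul_ne_zero {s : ℂ} (hs : 0 < s.re) (D : ℝ) : 1 - Complex.I * s * (D : ℂ) ≠ 0 := by
  intro h
  have h1 := congrArg Complex.im h
  have h2 := congrArg Complex.re h
  simp at h1 h2
  rcases h1 with h1 | h1
  · exact hs.ne' h1
  · simp [h1] at h2

end Factor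

end PoleEstimates

/-! ### Upper bounds for oscillatory integrals at a boundary point. -/

section PoleIntegral

variable {E : Type*} [NormedAddCommGroup E] [InnerProductSpace ℝ E] [FiniteDimensional ℝ E]
variable {Ω : Set E} {n p₀ : E} {F : E → ℝ} {r κ : ℝ}

lemma fderiv_apply_eq_inner_gradient (x v : E) : fderiv ℝ F x v = ⟪gradient F x, v⟫ := by
  rw [← InnerProductSpace.toDual_apply_apply (𝕜 := ℝ), toDual_gradient]

namespace IsStrictGraph

lemma one_le_norm_gradient (H : IsStrictGraph Ω n p₀ F r κ) (x : E) : 1 ≤ ‖gradient F x‖ := by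
  have h1 := H.graph.fderiv_apply_normal x
  rw [fderiv_apply_eq_inner_gradient] at h1
  have h2 := real_inner_le_norm (gradient F x) n
  rw [h1, H.graph.norm_eq_one, mul_one] at h2
  exact h2

lemma norm_gradient_eq (x : E) : ‖gradient F x‖ = ‖fderiv ℝ F x‖ := by
  rw [← toDual_gradient, LinearIsometryEquiv.norm_map]

lemma exists_norm_gradient_le (H : IsStrictGraph Ω n p₀ F r κ) :
    ∃ Λ, 1 ≤ Λ ∧ ∀ p ∈ Metric.ball p₀ r, ‖gradient F p‖ ≤ Λ := by
  obtain ⟨M, hM, hb⟩ := H.graph.contDiff_fderiv.continuous.exists_bound_ball p₀ r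
  exact ⟨max M 1, le_max_right _ _, fun p hp => by
    rw [norm_gradient_eq]; exact (hb p hp).trans (le_max_left _ _)⟩

lemma tangentPhase_eq_inner (H : IsStrictGraph Ω n p₀ F r κ) (p x : E) :
    tangentPhase F p x = ‖gradient F p‖ * ⟪‖gradient F p‖⁻¹ • gradient F p, p - x⟫ := by
  have h := H.one_le_norm_gradient p
  rw [tangentPhase, fderiv_apply_eq_inner_gradient, real_inner_smul_left, ← mul_assoc,
    mul_inv_cancel₀ (by linarith), one_mul]

lemma norm_normalized_gradient (H : IsStrictGraph Ω n p₀ F r κ) (p : E) :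
    ‖‖gradient F p‖⁻¹ • gradient F p‖ = 1 := by
  have h := H.one_le_norm_gradient p
  rw [norm_smul, norm_inv, norm_norm, inv_mul_cancel₀ (by linarith)]

variable [MeasurableSpace E] [BorelSpace E]

/-- The phase is `‖∇F(p)‖` times the height above the supporting plane, and `1 ≤ ‖∇F(p)‖ ≤ Λ`, so
the bound for caps applies with `R ‖∇F(p)‖` in place of `R`. -/
lemma exists_integral_inv_pow_tangentPhase_le (H : IsStrictGraph Ω n p₀ F r κ) (hΩ : IsCompact Ω)
    (hconv : Convex ℝ Ω) :
    ∃ C, 0 ≤ C ∧ ∀ p ∈ Metric.ball p₀ (r / 2), F p = 0 → ∀ R : ℝ, 0 < R →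
      ∫ x in Ω, ((1 + R * tangentPhase F p x) ^ (Module.finrank ℝ E + 3))⁻¹ ≤
        C * R ^ (-(((Module.finrank ℝ E : ℝ) + 1) / 2)) := by
  obtain ⟨c, hc, hg⟩ := H.exists_growth hΩ hconv
  obtain ⟨Λ, hΛ, hΛ'⟩ := H.exists_norm_gradient_le
  have hΛ0 : 0 < Λ := by linarith
  obtain ⟨C, hC, hb⟩ := exists_integral_inv_pow_le E (div_pos hc hΛ0)
  refine ⟨C, hC, fun p hp hFp R hR => ?_⟩
  have hpr : p ∈ Metric.ball p₀ r := Metric.ball_subset_ball (by linarith [H.r_pos]) hp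
  set l := ‖gradient F p‖ with hl
  have hl1 : 1 ≤ l := H.one_le_norm_gradient p
  have hl0 : 0 < l := by linarith
  have h := hb Ω hΩ (l⁻¹ • gradient F p) p (H.norm_normalized_gradient p) (fun x hx => ?_)
    (R * l) (by positivity)
  · simp only [H.tangentPhase_eq_inner, ← hl]
    simp only [← mul_assoc]
    refine h.trans ?_
    gcongr C * ?_
    refine Real.rpow_le_rpow_of_nonpos hR ?_ ?_
    · nlinarith
    · have : (0:ℝ) ≤ Module.finrank ℝ E := Nat.cast_nonneg _
      linarith
  · have h1 := hg p hp hFp x hx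
    rw [H.tangentPhase_eq_inner, ← hl] at h1
    set q := ⟪l⁻¹ • gradient F p, p - x⟫
    rw [div_mul_eq_mul_div, div_le_iff₀ hΛ0]
    have hq : 0 ≤ q := by
      by_contra hq
      have : l * q < 0 := mul_neg_of_pos_of_neg hl0 (not_le.1 hq)
      have : 0 ≤ c * ‖x - p‖ ^ 2 := by positivity
      linarith
    have := mul_le_mul_of_nonneg_right (hΛ' p hpr) hq
    linarith

lemma tangentTo_parabolicField (H : IsStrictGraph Ω n p₀ F r κ) (hΩ : IsCompact Ω) (p : E) :
    TangentTo Ω (Metric.ball p₀ r) (parabolicField n F p) :=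
  tangentTo_of_dirDeriv_eq hΩ.measurableSet (H.graph.contDiff_parabolicField p) H.graph.contDiff 1
    H.mem_iff (fun x _ => by rw [H.graph.dirDeriv_self, one_mul])

/-- Oscillatory integrals with phase `tangentPhase F p` and an amplitude which vanishes at `p`
to the order `j`, in the parabolic sense. -/
theorem exists_norm_integral_le (H : IsStrictGraph Ω n p₀ F r κ) (hΩ : IsCompact Ω)
    (hconv : Convex ℝ Ω) {ρ : ℝ} (hρ : ρ ≤ r / 2) {φ : E → E → ℂ} {w : E → E → ℝ} (j : ℕ)
    (hφ : ∀ p, ContDiff ℝ ∞ (φ p)) (hs : ∀ p, HasCompactSupport (φ p))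
    (hsU : ∀ p, tsupport (φ p) ⊆ Metric.ball p₀ r)
    (hφw : ∀ k, SymbolBound (ι := GraphPoint F p₀ ρ) (fun p => parabolicField n F p.1)
      (fun _ => Metric.ball p₀ r) k (fun p => w p.1) (fun p => φ p.1))
    (hw : ∃ C, 0 ≤ C ∧ ∀ p ∈ Metric.ball p₀ ρ, F p = 0 → ∀ x ∈ Ω ∩ Metric.ball p₀ r, ∀ R : ℝ,
      1 ≤ R → √R ^ j * w p x ≤ C * (1 + R * phaseWeight n F p x) ^ 2) :
    ∃ C, 0 ≤ C ∧ ∀ p ∈ Metric.ball p₀ ρ, F p = 0 → ∀ s : ℂ, 0 < s.re → 0 ≤ s.im → 1 ≤ ‖s‖ →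
      ‖∫ x in Ω, φ p x * Complex.exp (Complex.I * s * (tangentPhase F p x : ℂ))‖ ≤
        C * (√‖s‖ ^ j)⁻¹ * ‖s‖ ^ (-(((Module.finrank ℝ E : ℝ) + 1) / 2)) := by
  have hr := H.r_pos
  set d := Module.finrank ℝ E with hd
  obtain ⟨c, C₁, hc, hc1, hC₁, hpw⟩ := H.exists_phaseWeight_bounds
  obtain ⟨Cw, hCw, hCw'⟩ := hw
  obtain ⟨CI, hCI, hCI'⟩ := H.exists_integral_inv_pow_tangentPhase_le hΩ hconv
  obtain ⟨c₂, hc₂, hg⟩ := H.exists_growth hΩ hconv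
  -- Base point and complex frequency together index one family, which makes the constant uniform in
  -- both.
  let ι := {i : E × ℂ // (i.1 ∈ Metric.ball p₀ ρ ∧ F i.1 = 0) ∧ 0 < i.2.re ∧ 0 ≤ i.2.im ∧ 1 ≤ ‖i.2‖}
  have hρr : Metric.ball p₀ ρ ⊆ Metric.ball p₀ r := Metric.ball_subset_ball (by linarith)
  let f : ι → GraphPoint F p₀ ρ := fun i => ⟨i.1.1, i.2.1⟩
  let f' : ι → GraphPoint F p₀ r := fun i => ⟨i.1.1, hρr i.2.1.1, i.2.1.2⟩
  have hmem : ∀ i : ι, i.1.1 ∈ Metric.ball p₀ r := fun i => hρr i.2.1.1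
  have hu0 : ∀ i : ι, ∀ x ∈ Ω, 0 ≤ tangentPhase F i.1.1 x := fun i x hx =>
    (by positivity : 0 ≤ c₂ * ‖x - i.1.1‖ ^ 2).trans
      (hg _ (Metric.ball_subset_ball hρ i.2.1.1) i.2.1.2 x hx)
  have hD0 : ∀ i : ι, ∀ x ∈ Ω ∩ Metric.ball p₀ r,
      0 ≤ dirDeriv (parabolicField n F i.1.1) (tangentPhase F i.1.1) x := fun i x hx =>
    (mul_nonneg hc.le (phaseWeight_nonneg _ _)).trans (hpw _ (hmem i) i.2.1.2 x hx).1
  have hmge : ∀ i : ι, ∀ x ∈ Ω ∩ Metric.ball p₀ r,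
      (1 + ‖i.1.2‖ * dirDeriv (parabolicField n F i.1.1) (tangentPhase F i.1.1) x) / 2 ≤
      ‖phaseFactor (parabolicField n F i.1.1) (tangentPhase F i.1.1) i.1.2 x‖ := fun i x hx =>
    norm_one_sub_I_mul_ge i.2.2.2.1 (hD0 i x hx)
  -- weights against the factor
  have hwm : ∀ i : ι, ∀ x ∈ Ω ∩ Metric.ball p₀ r, 1 + ‖i.1.2‖ * phaseWeight n F i.1.1 x ≤
      2 / c * ‖phaseFactor (parabolicField n F i.1.1) (tangentPhase F i.1.1) i.1.2 x‖ := by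
    intro i x hx
    have h1 := hmge i x hx
    have h2 := (hpw _ (hmem i) i.2.1.2 x hx).1
    have h3 : c * (1 + ‖i.1.2‖ * phaseWeight n F i.1.1 x) ≤
        1 + ‖i.1.2‖ * dirDeriv (parabolicField n F i.1.1) (tangentPhase F i.1.1) x := by
      have := mul_le_mul_of_nonneg_left h2 (norm_nonneg i.1.2)
      linarith
    rw [div_mul_eq_mul_div, le_div_iff₀ hc]
    linarith
  -- Of the `d + 5` inverse powers of the phase factor, two absorb the weight of the amplitude
  -- through `hw`; the other `d + 3` are those of the integral over caps.
  obtain ⟨C, hC, hmain⟩ := exists_norm_integral_cexp_le (ι := ι) hΩ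
    (U := fun _ => Metric.ball p₀ r) (V := fun i => parabolicField n F i.1.1)
    (u := fun i => tangentPhase F i.1.1) (s := fun i => i.1.2) (φ := fun i => φ i.1.1)
    (w := fun i => w i.1.1) (wD := fun i => phaseWeight n F i.1.1)
    (fun i => H.tangentTo_parabolicField hΩ _) (fun i => H.graph.contDiff_parabolicField _)
    (fun i => IsGraphFunction.contDiff_tangentPhase _)
    (fun i x => one_sub_I_mul_ne_zero i.2.2.1 _) (fun i => hφ _) (fun i => hs _) (fun i => hsU _)
    (fun i x hx => mul_nonneg i.2.2.2.1 (hu0 i x hx.1))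
    (fun k => by
      simp only [H.graph.divergence_parabolicField]
      exact SymbolBound.const (fun _ => (((((d:ℝ) + 1) / 2 : ℝ)) : ℂ))
        ⟨((d:ℝ) + 1) / 2, by positivity, fun i x hx => by
          rw [Complex.norm_real, Real.norm_eq_abs, abs_of_nonneg (by positivity), mul_one]⟩ k)
    (fun k => (H.graphSymbol_dirDeriv_tangentPhase k).reindex f' fun i => inter_subset_right)
    ⟨2 / c, by positivity, fun i x hx => by
      have := hwm i x hx
      linarith⟩
    (fun k => (hφw k).reindex f fun i => inter_subset_right) (d + 5)
  set A := 2 * C₁ / c with hA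
  have hA0 : 0 < A := by positivity
  refine ⟨C * ((Cw * (2 / c) ^ 2) * A ^ (d + 3)) * CI, by positivity,
    fun p hp hFp s hs1 hs2 hs3 => ?_⟩
  set R := ‖s‖ with hR
  have hR0 : 0 < R := by linarith
  have hRj : 0 < √R ^ j := by positivity
  let K : ℝ := (√R ^ j)⁻¹ * ((Cw * (2 / c) ^ 2) * A ^ (d + 3))
  have hK0 : 0 ≤ K := by positivity
  let B : ι → E → ℝ := fun i x => (√‖i.1.2‖ ^ j)⁻¹ * ((Cw * (2 / c) ^ 2) * A ^ (d + 3)) *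
    ((1 + ‖i.1.2‖ * tangentPhase F i.1.1 x) ^ (d + 3))⁻¹
  have h := hmain B (fun i => ?_) (fun i x hx => ?_) (fun i x hx => ?_)
    ⟨(p, s), ⟨hp, hFp⟩, hs1, hs2, hs3⟩
  · refine h.trans ?_
    have hBI : ∫ x in Ω, B ⟨(p, s), ⟨hp, hFp⟩, hs1, hs2, hs3⟩ x =
        K * ∫ x in Ω, ((1 + R * tangentPhase F p x) ^ (d + 3))⁻¹ := by
      rw [← integral_const_mul]
    rw [hBI]
    have h2 := hCI' p (Metric.ball_subset_ball hρ hp) hFp R hR0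
    calc C * (K * ∫ x in Ω, ((1 + R * tangentPhase F p x) ^ (d + 3))⁻¹)
        ≤ C * (K * (CI * R ^ (-(((d : ℝ) + 1) / 2)))) := by gcongr
      _ = _ := by simp only [K]; ring
  · have hcont : ContinuousOn (fun x => ((1 + ‖i.1.2‖ * tangentPhase F i.1.1 x) ^ (d + 3))⁻¹) Ω := by
      refine ContinuousOn.inv₀ ?_ fun x hx => ?_
      · have := (IsGraphFunction.contDiff_tangentPhase (F := F) i.1.1).continuous
        fun_prop
      · have := hu0 i x hx
        positivity
    exact (hcont.integrableOn_compact hΩ).const_mul _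
  · have := hu0 i x hx
    have h3 : 0 ≤ ((1 + ‖i.1.2‖ * tangentPhase F i.1.1 x) ^ (d + 3))⁻¹ := by positivity
    exact mul_nonneg (mul_nonneg (by positivity) (by positivity)) h3
  · set m := ‖phaseFactor (parabolicField n F i.1.1) (tangentPhase F i.1.1) i.1.2 x‖ with hm
    have hiR : 0 < ‖i.1.2‖ := by linarith [i.2.2.2.2]
    have hwt := hwm i x hx
    have hu := hu0 i x hx.1
    have hpw0 := phaseWeight_nonneg (n := n) (F := F) i.1.1 x
    have hm0 : 0 < m := norm_pos_iff.2 (one_sub_I_mul_ne_zero i.2.2.1 _)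
    have h1 := hCw' _ i.2.1.1 i.2.1.2 x hx _ i.2.2.2.2
    have h2 : √‖i.1.2‖ ^ j * w i.1.1 x ≤ (Cw * (2 / c) ^ 2) * m ^ 2 := by
      refine h1.trans ?_
      rw [mul_assoc, ← mul_pow]
      gcongr
    have h3 : 1 + ‖i.1.2‖ * tangentPhase F i.1.1 x ≤ A * m := by
      have h4 := (hpw _ (hmem i) i.2.1.2 x hx).2.2
      have h5 := mul_le_mul_of_nonneg_left h4 hiR.le
      have h6 : 1 + ‖i.1.2‖ * tangentPhase F i.1.1 x ≤
          C₁ * (1 + ‖i.1.2‖ * phaseWeight n F i.1.1 x) := by linarith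
      refine h6.trans ?_
      calc _ ≤ C₁ * (2 / c * m) := by gcongr
        _ = A * m := by rw [hA]; ring
    have hj0 : 0 < √‖i.1.2‖ ^ j := by positivity
    have h7 : w i.1.1 x ≤ (√‖i.1.2‖ ^ j)⁻¹ * ((Cw * (2 / c) ^ 2) * m ^ 2) := by
      rw [inv_mul_eq_div, le_div_iff₀ hj0, mul_comm]
      exact h2
    rw [norm_inv, ← hm]
    have h8 : (m⁻¹) ^ (d + 3) ≤ A ^ (d + 3) *
        ((1 + ‖i.1.2‖ * tangentPhase F i.1.1 x) ^ (d + 3))⁻¹ := by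
      rw [inv_pow, ← div_eq_mul_inv, le_div_iff₀ (by positivity), inv_mul_eq_div,
        div_le_iff₀ (by positivity), ← mul_pow]
      gcongr
    have h9 : m⁻¹ ^ (d + 5) = (m ^ 2)⁻¹ * m⁻¹ ^ (d + 3) := by
      rw [show d + 5 = 2 + (d + 3) by ring, pow_add, inv_pow m 2]
    calc w i.1.1 x * m⁻¹ ^ (d + 5)
        ≤ (√‖i.1.2‖ ^ j)⁻¹ * ((Cw * (2 / c) ^ 2) * m ^ 2) * m⁻¹ ^ (d + 5) := by gcongr
      _ = (√‖i.1.2‖ ^ j)⁻¹ * (Cw * (2 / c) ^ 2) * m⁻¹ ^ (d + 3) := by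
          rw [h9]; field_simp
      _ ≤ (√‖i.1.2‖ ^ j)⁻¹ * (Cw * (2 / c) ^ 2) * (A ^ (d + 3) *
        ((1 + ‖i.1.2‖ * tangentPhase F i.1.1 x) ^ (d + 3))⁻¹) := by gcongr
      _ = B i x := by simp only [B]; ring

end IsStrictGraph

end PoleIntegral

/-! ### Differentiation under the integral sign. -/

section ExponentialIntegral

variable {E : Type*} [MeasurableSpace E] [TopologicalSpace E] [BorelSpace E] [T2Space E]
  {μ : Measure E} [IsFiniteMeasureOnCompacts μ]

lemma hasDerivAt_setIntegral_mul_cexp {Ω : Set E} (hΩ : IsCompact Ω) {a g : E → ℂ}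
    (ha : Continuous a) (hg : Continuous g) (s : ℂ) :
    HasDerivAt (fun s => ∫ x in Ω, a x * Complex.exp (s * g x) ∂μ)
      (∫ x in Ω, a x * (g x * Complex.exp (s * g x)) ∂μ) s := by
  obtain ⟨A, hA⟩ := hΩ.exists_bound_of_continuousOn ha.continuousOn
  obtain ⟨G, hG⟩ := hΩ.exists_bound_of_continuousOn hg.continuousOn
  have hcont : ∀ s, Continuous (fun x => a x * Complex.exp (s * g x)) := fun s => by fun_prop
  have hcont' : Continuous (fun x => a x * (g x * Complex.exp (s * g x))) := by fun_prop
  refine (hasDerivAt_integral_of_dominated_loc_of_deriv_le (𝕜 := ℂ) (μ := μ.restrict Ω)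
    (F := fun s x => a x * Complex.exp (s * g x))
    (F' := fun s x => a x * (g x * Complex.exp (s * g x)))
    (bound := fun _ => A * (G * Real.exp ((‖s‖ + 1) * G)))
    (Metric.ball_mem_nhds s one_pos) ?_ ?_ ?_ ?_ ?_ ?_).2
  · exact Eventually.of_forall fun s =>
      ((hcont s).continuousOn.integrableOn_compact hΩ).aestronglyMeasurable
  · exact (hcont s).continuousOn.integrableOn_compact hΩ
  · exact (hcont'.continuousOn.integrableOn_compact hΩ).aestronglyMeasurable
  · filter_upwards [ae_restrict_mem hΩ.measurableSet] with x hx t ht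
    have hA0 := (norm_nonneg _).trans (hA x hx)
    have hG0 := (norm_nonneg _).trans (hG x hx)
    have ht' : ‖t‖ ≤ ‖s‖ + 1 := by
      have : ‖t - s‖ < 1 := mem_ball_iff_norm.1 ht
      calc ‖t‖ = ‖s + (t - s)‖ := by congr 1; ring
        _ ≤ ‖s‖ + ‖t - s‖ := norm_add_le _ _
        _ ≤ _ := by linarith
    rw [norm_mul, norm_mul]
    gcongr
    · exact hA x hx
    · exact hG x hx
    · rw [Complex.norm_exp]
      gcongr
      refine (Complex.re_le_norm _).trans ?_
      rw [norm_mul]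
      gcongr
      exact hG x hx
  · exact integrableOn_const hΩ.measure_lt_top.ne
  · refine Eventually.of_forall fun x t _ => ?_
    have h1 : HasDerivAt (fun s : ℂ => s * g x) (g x) t := by
      simpa using (hasDerivAt_id t).mul_const (g x)
    have := (h1.cexp).const_mul (a x)
    convert! this using 1
    ring

end ExponentialIntegral

/-! ### The pole integral and its approximate homogeneity. -/

section PoleIntegral

variable {E : Type*} [NormedAddCommGroup E] [InnerProductSpace ℝ E] [FiniteDimensional ℝ E]
variable {Ω : Set E} {n p₀ : E} {F : E → ℝ} {r κ : ℝ}

namespace IsStrictGraph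

variable [MeasurableSpace E] [BorelSpace E]

/-- The contribution to the Fourier transform of a neighbourhood of the boundary point `p`. -/
noncomputable def poleIntegral (Ω : Set E) (F η : E → ℝ) (p : E) (s : ℂ) : ℂ :=
  ∫ x in Ω, (η x : ℂ) * Complex.exp (Complex.I * s * (tangentPhase F p x : ℂ))

/-- This is `s` times the derivative in `s` of `poleIntegral`; see `hasDerivAt_poleIntegral`. -/
noncomputable def poleIntegralEuler (Ω : Set E) (F η : E → ℝ) (p : E) (s : ℂ) : ℂ :=
  ∫ x in Ω, (η x : ℂ) * (Complex.I * s * (tangentPhase F p x : ℂ) *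
    Complex.exp (Complex.I * s * (tangentPhase F p x : ℂ)))

lemma hasDerivAt_poleIntegral (hΩ : IsCompact Ω) {η : E → ℝ} (hη : Continuous η) (p : E) (s : ℂ) :
    ∃ D, HasDerivAt (poleIntegral Ω F η p) D s ∧ s * D = poleIntegralEuler Ω F η p s := by
  have hu : Continuous (tangentPhase F p) :=
    (IsGraphFunction.contDiff_tangentPhase (F := F) p).continuous
  have h := hasDerivAt_setIntegral_mul_cexp (μ := volume) hΩ (a := fun x => (η x : ℂ))
    (g := fun x => Complex.I * (tangentPhase F p x : ℂ)) (by fun_prop) (by fun_prop) s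
  have he : poleIntegral Ω F η p = fun s => ∫ x in Ω, (η x : ℂ) *
      Complex.exp (s * (Complex.I * (tangentPhase F p x : ℂ))) := by
    funext s
    simp only [poleIntegral]
    congr 1
    funext x
    congr 2
    ring
  rw [he]
  refine ⟨_, h, ?_⟩
  · rw [poleIntegralEuler, ← integral_const_mul]
    congr 1
    funext x
    rw [show s * (Complex.I * (tangentPhase F p x : ℂ)) =
      Complex.I * s * (tangentPhase F p x : ℂ) by ring]
    ring

/-- Tangency of the parabolic field, applied to `η exp(isu)`, gives `0 = ∫ (a η + V η + i s η V u)
exp(isu)` with `a` the divergence. Splitting `V u` into `u` and the cubic defect gives the formula.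
-/
lemma poleIntegral_euler_identity (H : IsStrictGraph Ω n p₀ F r κ) (hΩ : IsCompact Ω) {η : E → ℝ}
    (hη : ContDiff ℝ ∞ η) (hηs : HasCompactSupport η) (hηU : tsupport η ⊆ Metric.ball p₀ r)
    {p : E} (hFp : F p = 0) (s : ℂ) :
    (((Module.finrank ℝ E : ℝ) + 1) / 2 : ℝ) * poleIntegral Ω F η p s +
      poleIntegralEuler Ω F η p s =
    -(∫ x in Ω, dirDeriv (parabolicField n F p) (fun x => (η x : ℂ)) x *
        Complex.exp (Complex.I * s * (tangentPhase F p x : ℂ))) -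
      Complex.I * s * ∫ x in Ω, ((η x * (graphEuler n F p x - graphBregman F p x) : ℝ) : ℂ) *
        Complex.exp (Complex.I * s * (tangentPhase F p x : ℂ)) := by
  have hV := H.graph.contDiff_parabolicField p
  have hu : ContDiff ℝ ∞ (tangentPhase F p) := IsGraphFunction.contDiff_tangentPhase p
  have hes := contDiff_cexp_phase (s := s) hu
  have hηc := hη.complex_ofReal
  have hts : tsupport (fun x => (η x : ℂ)) ⊆ tsupport η :=
    closure_mono fun x hx => by simpa using hx
  have hT := H.tangentTo_parabolicField hΩ p
    (fun x => (η x : ℂ) * Complex.exp (Complex.I * s * (tangentPhase F p x : ℂ)))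
    (hηc.mul hes) ((hηs.mono' (hts.trans' (subset_tsupport _))).mul_right)
    (tsupport_mul_subset_left.trans (hts.trans hηU))
  have hQ : ContDiff ℝ ∞ (fun x => ((η x * (graphEuler n F p x - graphBregman F p x) : ℝ) : ℂ)) :=
    (hη.mul ((H.graph.contDiff_graphEuler p).sub
      (H.graph.contDiff_graphBregman p))).complex_ofReal
  have hint : ∀ g : E → ℂ, Continuous g → IntegrableOn g Ω := fun g hg =>
    hg.continuousOn.integrableOn_compact hΩ
  have hd := hηc.dirDeriv hV
  have hη0 := hηc.continuous
  have hu0 := hu.continuous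
  have he0 := hes.continuous
  have hd0 := hd.continuous
  have hQ0 := hQ.continuous
  have i1 : IntegrableOn (fun x => (((Module.finrank ℝ E : ℝ) + 1) / 2 : ℝ) * ((η x : ℂ) *
      Complex.exp (Complex.I * s * (tangentPhase F p x : ℂ)))) Ω := hint _ (by fun_prop)
  have i2 : IntegrableOn (fun x => (η x : ℂ) * (Complex.I * s * (tangentPhase F p x : ℂ) *
      Complex.exp (Complex.I * s * (tangentPhase F p x : ℂ)))) Ω := hint _ (by fun_prop)
  have i3 : IntegrableOn (fun x => dirDeriv (parabolicField n F p) (fun x => (η x : ℂ)) x *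
      Complex.exp (Complex.I * s * (tangentPhase F p x : ℂ))) Ω := hint _ (hd0.mul he0)
  have i4 : IntegrableOn (fun x => Complex.I * s *
      (((η x * (graphEuler n F p x - graphBregman F p x) : ℝ) : ℂ) *
      Complex.exp (Complex.I * s * (tangentPhase F p x : ℂ)))) Ω :=
    hint _ (continuous_const.mul (hQ0.mul he0))
  rw [poleIntegral, poleIntegralEuler, ← integral_const_mul, ← integral_const_mul,
    ← sub_eq_zero, ← integral_add i1 i2, ← integral_neg]
  have i5 := integral_sub i3.neg i4
  have i6 := integral_sub (i1.add i2) (i3.neg.sub i4)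
  simp only [Pi.neg_apply, Pi.add_apply, Pi.sub_apply] at i5 i6
  rw [← i5, ← i6, ← hT]
  refine integral_congr_ae (Eventually.of_forall fun x => ?_)
  have he' : dirDeriv (parabolicField n F p)
      (fun x => Complex.exp (Complex.I * s * (tangentPhase F p x : ℂ))) x = _ :=
    dirDeriv_cexp_phase hu x
  have hm := congrFun (dirDeriv_mul (V := parabolicField n F p) hηc hes) x
  beta_reduce
  rw [hm, he', H.graph.divergence_parabolicField, H.graph.dirDeriv_tangentPhase]
  generalize Complex.exp (Complex.I * s * (tangentPhase F p x : ℂ)) = e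
  generalize dirDeriv (parabolicField n F p) (fun x => (η x : ℂ)) x = δ
  rw [tangentPhase_eq hFp]
  push_cast
  ring

lemma exists_norm_poleIntegral_le (H : IsStrictGraph Ω n p₀ F r κ) (hΩ : IsCompact Ω)
    (hconv : Convex ℝ Ω) {η : E → ℝ}
    (hη : ContDiff ℝ ∞ η) (hηs : HasCompactSupport η) (hηU : tsupport η ⊆ Metric.ball p₀ r) :
    ∃ C, 0 ≤ C ∧ ∀ p ∈ Metric.ball p₀ (r / 2), F p = 0 → ∀ s : ℂ, 0 < s.re → 0 ≤ s.im → 1 ≤ ‖s‖ →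
      ‖poleIntegral Ω F η p s‖ ≤ C * ‖s‖ ^ (-(((Module.finrank ℝ E : ℝ) + 1) / 2)) := by
  have hr := H.r_pos
  have hts : tsupport (fun x => (η x : ℂ)) ⊆ tsupport η :=
    closure_mono fun x hx => by simpa using hx
  obtain ⟨C, hC, h⟩ := H.exists_norm_integral_le hΩ hconv (le_refl (r / 2))
    (φ := fun _ x => (η x : ℂ)) (w := fun _ _ => 1) 0 (fun _ => hη.complex_ofReal)
    (fun _ => hηs.mono' (hts.trans' (subset_tsupport _))) (fun _ => hts.trans hηU)
    (fun k => (H.graphSymbol_smooth k η hη).reindex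
      (fun i : GraphPoint F p₀ (r / 2) => (⟨i.1, Metric.ball_subset_ball (by linarith) i.2.1,
        i.2.2⟩ : GraphPoint F p₀ r)) fun i => subset_rfl)
    ⟨1, zero_le_one, fun p _ _ x _ R hR => by
      have := phaseWeight_nonneg (n := n) (F := F) p x
      have h1 : 0 ≤ R * phaseWeight n F p x := by positivity
      rw [pow_zero, one_mul, one_mul]
      exact one_le_pow₀ (by linarith)⟩
  refine ⟨C, hC, fun p hp hFp s h1 h2 h3 => ?_⟩
  simpa [poleIntegral] using h p hp hFp s h1 h2 h3

/-- The pole integral is homogeneous of degree `-(d + 1) / 2` up to lower order terms. -/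
lemma exists_norm_euler_le (H : IsStrictGraph Ω n p₀ F r κ) (hΩ : IsCompact Ω)
    (hconv : Convex ℝ Ω) {η : E → ℝ}
    (hη : ContDiff ℝ ∞ η) (hηs : HasCompactSupport η) (hηU : tsupport η ⊆ Metric.ball p₀ r)
    {r' : ℝ} (hr' : 0 < r') (hrr' : r' ≤ r) (hη1 : ∀ x ∈ Metric.ball p₀ r', η x = 1) :
    ∃ C, 0 ≤ C ∧ ∀ p ∈ Metric.ball p₀ (r' / 2), F p = 0 →
      ∀ s : ℂ, 0 < s.re → 0 ≤ s.im → 1 ≤ ‖s‖ →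
      ‖(((Module.finrank ℝ E : ℝ) + 1) / 2 : ℝ) * poleIntegral Ω F η p s +
        poleIntegralEuler Ω F η p s‖ ≤
        C * (√‖s‖)⁻¹ * ‖s‖ ^ (-(((Module.finrank ℝ E : ℝ) + 1) / 2)) := by
  have hr := H.r_pos
  have hts : tsupport (fun x => (η x : ℂ)) ⊆ tsupport η :=
    closure_mono fun x hx => by simpa using hx
  have hρ : r' / 2 ≤ r / 2 := by linarith
  let f : GraphPoint F p₀ (r' / 2) → GraphPoint F p₀ r := fun i =>
    ⟨i.1, Metric.ball_subset_ball (by linarith) i.2.1, i.2.2⟩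
  have hQs : ∀ p, ContDiff ℝ ∞ (fun x => graphEuler n F p x - graphBregman F p x) := fun p =>
    (H.graph.contDiff_graphEuler p).sub (H.graph.contDiff_graphBregman p)
  -- the amplitude with the cubic defect
  obtain ⟨C₁, hC₁, h₁⟩ := H.exists_norm_integral_le hΩ hconv hρ
    (φ := fun p x => ((η x * (graphEuler n F p x - graphBregman F p x) : ℝ) : ℂ))
    (w := fun p x => ‖orthComponent n (x - p)‖ ^ 3) 3
    (fun p => (hη.mul (hQs p)).complex_ofReal)
    (fun p => by
      refine hηs.mono' fun x hx => subset_tsupport _ fun h => hx ?_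
      simp [h])
    (fun p => (closure_mono fun x hx => by
      simp only [Function.mem_support, ne_eq, Complex.ofReal_eq_zero, mul_eq_zero, not_or] at hx
      exact hx.1).trans hηU)
    (fun k => by
      have h1 := (H.graphSymbol_smooth k η hη).mul (H.graphSymbol_euler_sub_bregman k)
        (fun _ => hη.complex_ofReal) (fun i => (hQs _).complex_ofReal) H.contDiff_field
      have h2 := h1.reindex f (S' := fun _ => Metric.ball p₀ r) fun i => subset_rfl
      simpa [f] using h2)
    ⟨1, zero_le_one, fun p _ _ x _ R hR => by
      set z := ‖orthComponent n (x - p)‖ with hz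
      have hR0 : 0 ≤ R := by linarith
      -- In the parabolic scale `y = √R ‖z‖` the requirement is `y³ ≤ (1 + y²)²`: the cubic defect
      -- gains `R^(-3/2)`.
      set y := √R * z with hy
      have hy0 : 0 ≤ y := by positivity
      have h1 : y ^ 2 = R * z ^ 2 := by rw [hy, mul_pow, Real.sq_sqrt hR0]
      have h2 : √R ^ 3 * z ^ 3 = y ^ 3 := by rw [hy, mul_pow]
      have h3 : y ^ 2 ≤ R * phaseWeight n F p x := by
        rw [h1, phaseWeight, ← hz]
        gcongr
        linarith [abs_nonneg (F x)]
      rw [h2, one_mul]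
      calc y ^ 3 ≤ (1 + y ^ 2) ^ 2 := by nlinarith [sq_nonneg (y ^ 2 - y), sq_nonneg (y - 1)]
        _ ≤ _ := by gcongr⟩
  -- the derivative of the cutoff
  obtain ⟨L, hL, hL'⟩ := H.exists_norm_sub_le
  obtain ⟨C₂, hC₂, h₂⟩ := H.exists_norm_integral_le hΩ hconv hρ
    (φ := fun p => dirDeriv (parabolicField n F p) (fun x => (η x : ℂ)))
    (w := fun p x => phaseWeight n F p x ^ 2) 3
    (fun p => hη.complex_ofReal.dirDeriv (H.graph.contDiff_parabolicField p))
    (fun p => hηs.mono' ((subset_tsupport _).trans ((tsupport_dirDeriv_subset _ _).trans hts)))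
    (fun p => (tsupport_dirDeriv_subset _ _).trans (hts.trans hηU))
    (fun k => by
      have h1 := (H.graphSymbol_smooth (k + 1) η hη).2.reindex f
        (S' := fun _ => Metric.ball p₀ r) fun i => subset_rfl
      refine h1.of_eq_zero (O := Metric.ball p₀ r') Metric.isOpen_ball (fun i x hx => ?_)
        (fun i x _ => by positivity) ?_
      · have : (fun x => (η x : ℂ)) =ᶠ[𝓝 x] fun _ => 1 := by
          filter_upwards [Metric.isOpen_ball.mem_nhds hx] with y hy
          simp [hη1 y hy]
        simp [dirDeriv, this.fderiv_eq]
      -- Where `η` is not locally constant, `‖x - p‖ > r' / 2`. A weight below `δ²` would give `‖z‖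
      -- < δ` and, as `δ ≤ 1`, `|F x| < δ`, hence `‖x - p‖ ≤ (L + 1) δ ≤ r' / 2`. So the weight is
      -- at least `δ²`, and its square is at least `δ⁴`.
      · set δ := min 1 (r' / 2 / (L + 1)) with hδ
        have hδ0 : 0 < δ := lt_min one_pos (by positivity)
        have hδ1 : δ ≤ 1 := min_le_left _ _
        have hδ2 : δ * (L + 1) ≤ r' / 2 := by
          rw [← le_div_iff₀ (by positivity)]
          exact min_le_right _ _
        refine ⟨(δ ^ 4)⁻¹, by positivity, fun i x hx hxO => ?_⟩
        have hip : ‖i.1 - p₀‖ < r' / 2 := mem_ball_iff_norm.1 i.2.1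
        have hxp : r' ≤ ‖x - p₀‖ := by
          by_contra h
          exact hxO (mem_ball_iff_norm.2 (not_le.1 h))
        have hxi : r' / 2 < ‖x - i.1‖ := by
          have : ‖x - p₀‖ ≤ ‖x - i.1‖ + ‖i.1 - p₀‖ := by
            calc ‖x - p₀‖ = ‖(x - i.1) + (i.1 - p₀)‖ := by congr 1; abel
              _ ≤ _ := norm_add_le _ _
          linarith
        have h3 := hL' i.1 (f i).2.1 i.2.2 x hx
        have h4 : δ ^ 2 ≤ phaseWeight n F i.1 x := by
          by_contra hcon
          rw [not_le, phaseWeight] at hcon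
          have ha := abs_nonneg (F x)
          have hzz : 0 ≤ ‖orthComponent n (x - i.1)‖ ^ 2 := by positivity
          have hz : ‖orthComponent n (x - i.1)‖ < δ :=
            lt_of_pow_lt_pow_left₀ 2 hδ0.le (by linarith)
          have hF : |F x| < δ := by nlinarith
          have : L * ‖orthComponent n (x - i.1)‖ ≤ L * δ := by gcongr
          linarith
        rw [inv_mul_eq_div, le_div_iff₀ (by positivity), one_mul]
        calc δ ^ 4 = (δ ^ 2) ^ 2 := by ring
          _ ≤ _ := by gcongr)
    ⟨1, zero_le_one, fun p _ _ x _ R hR => by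
      have hw := phaseWeight_nonneg (n := n) (F := F) p x
      have hR0 : 0 ≤ R := by linarith
      have h1 : 1 ≤ √R := Real.one_le_sqrt.2 hR
      have h2 : √R ^ 3 ≤ R ^ 2 := by
        calc √R ^ 3 ≤ √R ^ 4 := pow_le_pow_right₀ h1 (by norm_num)
          _ = (√R ^ 2) ^ 2 := by ring
          _ = R ^ 2 := by rw [Real.sq_sqrt hR0]
      rw [one_mul]
      calc √R ^ 3 * phaseWeight n F p x ^ 2 ≤ R ^ 2 * phaseWeight n F p x ^ 2 := by gcongr
        _ = (R * phaseWeight n F p x) ^ 2 := by ring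
        _ ≤ _ := by gcongr; linarith⟩
  refine ⟨C₂ + C₁, by positivity, fun p hp hFp s hs1 hs2 hs3 => ?_⟩
  rw [H.poleIntegral_euler_identity hΩ hη hηs hηU hFp]
  have e1 := h₁ p hp hFp s hs1 hs2 hs3
  have e2 := h₂ p hp hFp s hs1 hs2 hs3
  set R := ‖s‖ with hR
  have hR0 : 0 < R := by linarith
  set X := R ^ (-(((Module.finrank ℝ E : ℝ) + 1) / 2)) with hX
  have hX0 : 0 ≤ X := by positivity
  have hsq : 1 ≤ √R := Real.one_le_sqrt.2 hs3
  have hsq0 : 0 < √R := by linarith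
  -- The factor `s` in front of the cubic defect costs `R`, against a gain of `R^(-3/2)`.
  have hRs : R * (√R ^ 3)⁻¹ = (√R)⁻¹ := by
    have : R = √R ^ 2 := (Real.sq_sqrt hR0.le).symm
    rw [show R * (√R ^ 3)⁻¹ = √R ^ 2 * (√R ^ 3)⁻¹ by rw [← this]]
    field_simp
  have h3 : (√R ^ 3)⁻¹ ≤ (√R)⁻¹ := by
    gcongr
    exact le_self_pow₀ hsq (by norm_num)
  refine (norm_sub_le _ _).trans ?_
  rw [norm_neg, norm_mul, norm_mul, Complex.norm_I, one_mul, ← hR]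
  calc _ ≤ C₂ * (√R ^ 3)⁻¹ * X + R * (C₁ * (√R ^ 3)⁻¹ * X) := by gcongr
    _ = C₂ * (√R ^ 3)⁻¹ * X + C₁ * (R * (√R ^ 3)⁻¹) * X := by ring
    _ ≤ C₂ * (√R)⁻¹ * X + C₁ * (√R)⁻¹ * X := by rw [hRs]; gcongr
    _ = _ := by ring

end IsStrictGraph

end PoleIntegral

/-! ### Lower bounds: from the imaginary axis to the real axis. -/

section PoleIntegral

variable {E : Type*} [NormedAddCommGroup E] [InnerProductSpace ℝ E] [FiniteDimensional ℝ E]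
variable {Ω : Set E} {n p₀ : E} {F : E → ℝ} {r κ : ℝ}

namespace IsStrictGraph

variable [MeasurableSpace E] [BorelSpace E]

/-- Caps of height comparable to `ε` have volume at least a multiple of `ε ^ ((d + 1) / 2)`. -/
lemma exists_le_volume_real_cap (H : IsStrictGraph Ω n p₀ F r κ) (hΩ : IsCompact Ω)
    {r' : ℝ} (hr' : 0 < r') (hrr' : r' ≤ r) :
    ∃ c ε₀, 0 < c ∧ 0 < ε₀ ∧ ∀ p ∈ Metric.ball p₀ (r' / 2), F p = 0 → ∀ ε, 0 < ε → ε ≤ ε₀ →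
      c * ε ^ (((Module.finrank ℝ E : ℝ) + 1) / 2) ≤
        volume.real (Ω ∩ Metric.ball p₀ r' ∩ {x | tangentPhase F p x ≤ ε}) := by
  obtain ⟨C, hC, hT⟩ := H.exists_taylor_bounds
  obtain ⟨Λ, hΛ, hΛ'⟩ := H.exists_norm_gradient_le
  have hN : 0 < Module.finrank ℝ E := by
    have : Nontrivial E := ⟨n, 0, fun h => by simpa [h] using H.graph.norm_eq_one⟩
    exact Module.finrank_pos
  set N := Module.finrank ℝ E with hNdef
  -- With this `α`, `‖x - p‖ ≤ α √ε` makes `graphBregman` at most `ε / 2`. If the phase is at least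
  -- `ε / 2`, then `F = graphBregman - phase ≤ 0`, and the slab lies in `Ω`.
  set α : ℝ := √(1 / (2 * (C + 1))) with hα
  have hα0 : 0 < α := by positivity
  have hα2 : α ^ 2 = 1 / (2 * (C + 1)) := Real.sq_sqrt (by positivity)
  have hΛ0 : 0 < Λ := by linarith
  -- The first bound on `ε` keeps the height of the slab below half its radius `α √ε`, as
  -- `le_volume_real_slab` requires; the second keeps the slab within `r' / 2` of `p`.
  refine ⟨(α / N) ^ (N - 1) / (2 * Λ), min ((α / 2) ^ 2) ((r' / (4 * α)) ^ 2), by positivity,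
    lt_min (by positivity) (by positivity), fun p hp hFp ε hε hε' => ?_⟩
  have hpr : p ∈ Metric.ball p₀ r := Metric.ball_subset_ball (by linarith) hp
  have hs1 : √ε ≤ α / 2 := by
    rw [Real.sqrt_le_left (by positivity)]; exact hε'.trans (min_le_left _ _)
  have hs2 : √ε ≤ r' / (4 * α) := by
    rw [Real.sqrt_le_left (by positivity)]; exact hε'.trans (min_le_right _ _)
  have hs0 : 0 < √ε := Real.sqrt_pos.2 hε
  have hsq : √ε ^ 2 = ε := Real.sq_sqrt hε.le
  set l := ‖gradient F p‖ with hl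
  have hl1 : 1 ≤ l := H.one_le_norm_gradient p
  have hl0 : 0 < l := by linarith
  have hlΛ : l ≤ Λ := hΛ' p hpr
  have hslab := le_volume_real_slab (H.norm_normalized_gradient p) p (r := α * √ε)
    (α := ε / (2 * l)) (β := ε / l) (by positivity)
    (by gcongr; linarith) (by positivity) (by
      calc ε / l ≤ ε := div_le_self hε.le hl1
        _ = √ε * √ε := by rw [← sq, hsq]
        _ ≤ (α / 2) * √ε := by gcongr
        _ = _ := by ring)
  have hsub : {x : E | ‖x - p‖ ≤ α * √ε ∧ ⟪l⁻¹ • gradient F p, p - x⟫ ∈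
      Icc (ε / (2 * l)) (ε / l)} ⊆ Ω ∩ Metric.ball p₀ r' ∩ {x | tangentPhase F p x ≤ ε} := by
    rintro x ⟨hx1, hx2, hx3⟩
    have hx4 : ‖x - p‖ < r' / 2 := by
      refine hx1.trans_lt ?_
      calc α * √ε ≤ α * (r' / (4 * α)) := by gcongr
        _ = r' / 4 := by field_simp
        _ < _ := by linarith
    have hxr' : x ∈ Metric.ball p₀ r' := by
      rw [mem_ball_iff_norm] at hp ⊢
      calc ‖x - p₀‖ = ‖(x - p) + (p - p₀)‖ := by congr 1; abel
        _ ≤ ‖x - p‖ + ‖p - p₀‖ := norm_add_le _ _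
        _ < _ := by linarith
    have hxr := Metric.ball_subset_ball hrr' hxr'
    have hu := H.tangentPhase_eq_inner p x
    rw [← hl] at hu
    have hu1 : ε / 2 ≤ tangentPhase F p x := by
      rw [hu]
      calc ε / 2 = l * (ε / (2 * l)) := by field_simp
        _ ≤ _ := by gcongr
    have hu2 : tangentPhase F p x ≤ ε := by
      rw [hu]
      calc _ ≤ l * (ε / l) := by gcongr
        _ = ε := by field_simp
    refine ⟨⟨(H.mem_iff x hxr).2 ?_, hxr'⟩, hu2⟩
    have hB := (hT p hpr x hxr).2.2.2.1
    rw [tangentPhase_eq hFp] at hu1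
    have hz : ‖orthComponent n (x - p)‖ ^ 2 ≤ α ^ 2 * ε := by
      calc _ ≤ (α * √ε) ^ 2 := by
            gcongr; exact (norm_orthComponent_le H.graph.norm_eq_one _).trans hx1
        _ = _ := by rw [mul_pow, hsq]
    have : C * ‖orthComponent n (x - p)‖ ^ 2 ≤ ε / 2 := by
      calc _ ≤ (C + 1) * (α ^ 2 * ε) := by gcongr; linarith
        _ = ε / 2 := by rw [hα2]; field_simp
    linarith
  have hfin : volume (Ω ∩ Metric.ball p₀ r' ∩ {x | tangentPhase F p x ≤ ε}) ≠ ⊤ :=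
    measure_ne_top_of_subset (inter_subset_left.trans inter_subset_left) hΩ.measure_lt_top.ne
  refine le_trans ?_ (hslab.trans (measureReal_mono hsub hfin))
  have hpow : ε ^ (((N : ℝ) + 1) / 2) = √ε ^ (N - 1) * ε := by
    have h1 : √ε ^ (N - 1) * ε = √ε ^ (N + 1) := by
      conv_lhs => rw [← hsq, Real.sqrt_sq hs0.le, ← pow_add]
      congr 1; omega
    rw [h1, Real.sqrt_eq_rpow, ← Real.rpow_natCast, ← Real.rpow_mul hε.le]
    congr 1; push_cast; ring
  rw [hpow]
  have : ε / l - ε / (2 * l) = ε / (2 * l) := by field_simp; ring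
  rw [this]
  calc _ = (α * √ε / N) ^ (N - 1) * (ε / (2 * Λ)) := by rw [mul_div_right_comm, mul_pow]; ring
    _ ≤ _ := by gcongr

/-- At `s = iR` there is no oscillation: the integrand is `η exp(-Ru) ≥ 0`, and it is at least
`exp(-1)` on the part of the cap of height `1 / R` where `η = 1`. -/
lemma exists_le_norm_poleIntegral_I_mul (H : IsStrictGraph Ω n p₀ F r κ) (hΩ : IsCompact Ω)
    {η : E → ℝ} (hη : Continuous η) (hη0 : ∀ x, 0 ≤ η x)
    {r' : ℝ} (hr' : 0 < r') (hrr' : r' ≤ r) (hη1 : ∀ x ∈ Metric.ball p₀ r', η x = 1) :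
    ∃ c R₀, 0 < c ∧ 1 ≤ R₀ ∧ ∀ p ∈ Metric.ball p₀ (r' / 2), F p = 0 → ∀ R : ℝ, R₀ ≤ R →
      c * R ^ (-(((Module.finrank ℝ E : ℝ) + 1) / 2)) ≤
        ‖poleIntegral Ω F η p (R * Complex.I)‖ := by
  obtain ⟨c, ε₀, hc, hε₀, h⟩ := H.exists_le_volume_real_cap hΩ hr' hrr'
  refine ⟨Real.exp (-1) * c, max 1 ε₀⁻¹, by positivity, le_max_left _ _,
    fun p hp hFp R hR => ?_⟩
  have hR1 : 1 ≤ R := (le_max_left _ _).trans hR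
  have hR0 : 0 < R := by linarith
  have hRε : R⁻¹ ≤ ε₀ := inv_le_of_inv_le₀ hε₀ ((le_max_right _ _).trans hR)
  have hu : Continuous (tangentPhase F p) :=
    (IsGraphFunction.contDiff_tangentPhase (F := F) p).continuous
  set T := Ω ∩ Metric.ball p₀ r' ∩ {x | tangentPhase F p x ≤ R⁻¹} with hTdef
  have hTm : MeasurableSet T := (hΩ.measurableSet.inter measurableSet_ball).inter
    (measurableSet_le hu.measurable measurable_const)
  have hTΩ : T ⊆ Ω := inter_subset_left.trans inter_subset_left
  have hfin : volume T ≠ ⊤ := measure_ne_top_of_subset hTΩ hΩ.measure_lt_top.ne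
  have hv := h p hp hFp R⁻¹ (by positivity) hRε
  have hint : IntegrableOn (fun x => η x * Real.exp (-R * tangentPhase F p x)) Ω :=
    (by fun_prop : Continuous _).continuousOn.integrableOn_compact hΩ
  have heq : poleIntegral Ω F η p (R * Complex.I) =
      ((∫ x in Ω, η x * Real.exp (-R * tangentPhase F p x) : ℝ) : ℂ) := by
    rw [poleIntegral, ← integral_complex_ofReal]
    congr 1
    funext x
    push_cast
    congr 2
    linear_combination (R * tangentPhase F p x : ℂ) * Complex.I_mul_I
  rw [heq, Complex.norm_real]
  refine le_trans ?_ (le_abs_self _)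
  calc _ = Real.exp (-1) * (c * R⁻¹ ^ (((Module.finrank ℝ E : ℝ) + 1) / 2)) := by
        rw [Real.rpow_neg hR0.le, Real.inv_rpow hR0.le]; ring
    _ ≤ Real.exp (-1) * volume.real T := by gcongr
    _ = ∫ _ in T, Real.exp (-1) := by rw [setIntegral_const, smul_eq_mul, mul_comm]
    _ ≤ ∫ x in T, η x * Real.exp (-R * tangentPhase F p x) := by
        refine setIntegral_mono_on (integrableOn_const hfin) (hint.mono_set hTΩ) hTm
          fun x hx => ?_
        rw [hη1 x hx.1.2, one_mul, Real.exp_le_exp]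
        have : R * tangentPhase F p x ≤ R * R⁻¹ := by gcongr; exact hx.2
        rw [mul_inv_cancel₀ hR0.ne'] at this
        linarith
    _ ≤ _ := setIntegral_mono_set hint
        (Eventually.of_forall fun x => mul_nonneg (hη0 x) (Real.exp_pos _).le)
        hTΩ.eventuallyLE

/-- Rotating the frequency from the imaginary to the real axis changes the pole integral only by
lower order terms. -/
lemma norm_poleIntegral_sub_rotate_le (hΩ : IsCompact Ω) {η : E → ℝ} (hη : Continuous η)
    {p : E} {a B R : ℝ} (hR : 0 < R)
    (hB : ∀ s : ℂ, 0 < s.re → 0 ≤ s.im → ‖s‖ = R →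
      ‖(a : ℂ) * poleIntegral Ω F η p s + poleIntegralEuler Ω F η p s‖ ≤ B) :
    ‖poleIntegral Ω F η p (R * Complex.I)‖ ≤ ‖poleIntegral Ω F η p R‖ + B * (Real.pi / 2) := by
  let s : ℝ → ℂ := fun θ => R * Complex.exp (θ * Complex.I)
  choose D hD hD' using fun z => hasDerivAt_poleIntegral (F := F) hΩ hη p z
  -- Up to the constant `R^a` this is `s^a I(s)` on the circle `|s| = R`. Its derivative in `θ` is
  -- `i exp(iaθ) (a I + s I')`, which `hB` bounds.
  let K : ℝ → ℂ := fun θ => Complex.exp (a * θ * Complex.I) * poleIntegral Ω F η p (s θ)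
  have hK : ∀ θ : ℝ, HasDerivAt K (Complex.I * Complex.exp (a * θ * Complex.I) *
      (a * poleIntegral Ω F η p (s θ) + poleIntegralEuler Ω F η p (s θ))) θ := by
    intro θ
    have h0 : HasDerivAt (fun θ : ℝ => (θ : ℂ)) 1 θ := Complex.ofRealCLM.hasDerivAt
    have h1 : HasDerivAt (fun θ : ℝ => Complex.exp (a * θ * Complex.I))
        (Complex.exp (a * θ * Complex.I) * (a * 1 * Complex.I)) θ :=
      ((h0.const_mul (a : ℂ)).mul_const Complex.I).cexp
    have h2 : HasDerivAt s (R * (Complex.exp (θ * Complex.I) * (1 * Complex.I))) θ :=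
      ((h0.mul_const Complex.I).cexp).const_mul _
    have h3 := (hD (s θ)).comp θ h2
    have h4 := h1.mul h3
    convert! h4 using 1
    rw [← hD']
    simp only [s, Function.comp_apply]
    ring
  have hn : ∀ θ : ℝ, ‖Complex.exp (a * θ * Complex.I)‖ = 1 := fun θ => by
    rw [← Complex.ofReal_mul]; exact Complex.norm_exp_ofReal_mul_I _
  have hs : ∀ θ : ℝ, ‖s θ‖ = R := fun θ => by
    simp only [s]
    rw [norm_mul, Complex.norm_exp_ofReal_mul_I, Complex.norm_real, mul_one]
    exact abs_of_pos hR
  have hmain := norm_image_sub_le_of_norm_deriv_le_segment' (a := 0) (b := Real.pi / 2)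
    (fun θ _ => (hK θ).hasDerivWithinAt) (C := B) (fun θ hθ => by
      rw [norm_mul, norm_mul, Complex.norm_I, hn, one_mul, one_mul]
      have hre : (s θ).re = R * Real.cos θ := by
        simp only [s]
        rw [Complex.re_ofReal_mul, Complex.exp_ofReal_mul_I_re]
      have him : (s θ).im = R * Real.sin θ := by
        simp only [s]
        rw [Complex.im_ofReal_mul, Complex.exp_ofReal_mul_I_im]
      refine hB _ ?_ ?_ (hs θ)
      · rw [hre]
        exact mul_pos hR (Real.cos_pos_of_mem_Ioo ⟨by linarith [hθ.1, Real.pi_pos], hθ.2⟩)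
      · rw [him]
        exact mul_nonneg hR.le (Real.sin_nonneg_of_nonneg_of_le_pi hθ.1
          (by linarith [hθ.2, Real.pi_pos])))
    (Real.pi / 2) ⟨by positivity, le_rfl⟩
  have hK0 : ‖K 0‖ = ‖poleIntegral Ω F η p R‖ := by simp [K, s]
  have hK1 : ‖K (Real.pi / 2)‖ = ‖poleIntegral Ω F η p (R * Complex.I)‖ := by
    simp only [K, s]
    rw [norm_mul, hn, one_mul]
    push_cast
    rw [Complex.exp_pi_div_two_mul_I]
  rw [← hK0, ← hK1]
  have := norm_sub_norm_le (K (Real.pi / 2)) (K 0)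
  rw [sub_zero] at hmain
  linarith

lemma exists_poleIntegral_bounds (H : IsStrictGraph Ω n p₀ F r κ) (hΩ : IsCompact Ω)
    (hconv : Convex ℝ Ω) {η : E → ℝ} (hη : ContDiff ℝ ∞ η) (hηs : HasCompactSupport η)
    (hηU : tsupport η ⊆ Metric.ball p₀ r) (hη0 : ∀ x, 0 ≤ η x)
    {r' : ℝ} (hr' : 0 < r') (hrr' : r' ≤ r) (hη1 : ∀ x ∈ Metric.ball p₀ r', η x = 1) :
    ∃ c C R₀, 0 < c ∧ 0 ≤ C ∧ 1 ≤ R₀ ∧ ∀ p ∈ Metric.ball p₀ (r' / 2), F p = 0 →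
      ∀ R : ℝ, R₀ ≤ R →
      c * R ^ (-(((Module.finrank ℝ E : ℝ) + 1) / 2)) ≤ ‖poleIntegral Ω F η p R‖ ∧
      ‖poleIntegral Ω F η p R‖ ≤ C * R ^ (-(((Module.finrank ℝ E : ℝ) + 1) / 2)) ∧
      ‖poleIntegralEuler Ω F η p R‖ ≤ C * R ^ (-(((Module.finrank ℝ E : ℝ) + 1) / 2)) := by
  obtain ⟨c, R₀, hc, hR₀, h1⟩ :=
    H.exists_le_norm_poleIntegral_I_mul hΩ hη.continuous hη0 hr' hrr' hη1
  obtain ⟨C₁, hC₁, h2⟩ := H.exists_norm_poleIntegral_le hΩ hconv hη hηs hηU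
  obtain ⟨C₂, hC₂, h3⟩ := H.exists_norm_euler_le hΩ hconv hη hηs hηU hr' hrr' hη1
  set a : ℝ := ((Module.finrank ℝ E : ℝ) + 1) / 2 with ha
  have ha0 : 0 ≤ a := by positivity
  have hpi := Real.pi_pos
  -- The second entry of the maximum makes the rotation error `C₂ R^(-1/2) π / 2` at most `c / 2`,
  -- half the main term.
  refine ⟨c / 2, C₁ + (C₂ + a * C₁), max R₀ ((C₂ * Real.pi / c) ^ 2), by positivity,
    by positivity, hR₀.trans (le_max_left _ _), fun p hp hFp R hR => ?_⟩
  have hR1 : R₀ ≤ R := (le_max_left _ _).trans hR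
  have hR2 : (C₂ * Real.pi / c) ^ 2 ≤ R := (le_max_right _ _).trans hR
  have hR0 : 0 < R := by linarith
  have hsR : C₂ * Real.pi / c ≤ √R := Real.le_sqrt_of_sq_le hR2
  have hs1 : 1 ≤ √R := Real.one_le_sqrt.2 (by linarith)
  set X := R ^ (-a) with hX
  have hX0 : 0 ≤ X := by positivity
  have hpr : p ∈ Metric.ball p₀ (r / 2) := Metric.ball_subset_ball (by linarith) hp
  have e1 := h1 p hp hFp R hR1
  have hnR : ‖(R : ℂ)‖ = R := by rw [Complex.norm_real]; exact abs_of_pos hR0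
  have e2 := h2 p hpr hFp R (by simpa using hR0) (by simp) (by rw [hnR]; linarith)
  have e3 := h3 p hp hFp R (by simpa using hR0) (by simp) (by rw [hnR]; linarith)
  rw [hnR, ← hX] at e2 e3
  have hinv : (√R)⁻¹ ≤ 1 := inv_le_one_of_one_le₀ hs1
  have e4 := norm_poleIntegral_sub_rotate_le (F := F) hΩ hη.continuous (p := p) (a := a)
    (B := C₂ * (√R)⁻¹ * X) hR0 (fun s hs1 hs2 hs3 => by
      have := h3 p hp hFp s hs1 hs2 (by rw [hs3]; linarith)
      rwa [hs3] at this)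
  refine ⟨?_, ?_, ?_⟩
  · have : C₂ * (√R)⁻¹ * X * (Real.pi / 2) ≤ c / 2 * X := by
      rw [div_le_iff₀ hc] at hsR
      calc _ = (C₂ * Real.pi) * (√R)⁻¹ * X / 2 := by ring
        _ ≤ (√R * c) * (√R)⁻¹ * X / 2 := by gcongr
        _ = _ := by field_simp
    linarith
  · have : 0 ≤ (C₂ + a * C₁) * X := by positivity
    linarith
  · have h5 : poleIntegralEuler Ω F η p R = ((a : ℂ) * poleIntegral Ω F η p R +
        poleIntegralEuler Ω F η p R) - (a : ℂ) * poleIntegral Ω F η p R := by ring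
    rw [h5]
    refine (norm_sub_le _ _).trans ?_
    rw [norm_mul, Complex.norm_real, Real.norm_of_nonneg ha0]
    have h6 : C₂ * (√R)⁻¹ * X ≤ C₂ * 1 * X := by gcongr
    have h7 : a * ‖poleIntegral Ω F η p R‖ ≤ a * (C₁ * X) := by gcongr
    have h8 : 0 ≤ C₁ * X := by positivity
    linarith

/-- Asymptotics of the contribution of a pole `p` to the Fourier transform in the direction of the
normal at `p`. -/
theorem exists_pole_bounds (H : IsStrictGraph Ω n p₀ F r κ) (hΩ : IsCompact Ω)
    (hconv : Convex ℝ Ω) {η : E → ℝ} (hη : ContDiff ℝ ∞ η) (hηs : HasCompactSupport η)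
    (hηU : tsupport η ⊆ Metric.ball p₀ r) (hη0 : ∀ x, 0 ≤ η x)
    {r' : ℝ} (hr' : 0 < r') (hrr' : r' ≤ r) (hη1 : ∀ x ∈ Metric.ball p₀ r', η x = 1) :
    ∃ c C R₀, 0 < c ∧ 0 ≤ C ∧ 1 ≤ R₀ ∧ ∀ p ∈ Metric.ball p₀ (r' / 2), F p = 0 →
      ∀ Θ, Θ = ‖gradient F p‖⁻¹ • gradient F p → ∃ J' : ℝ → ℂ, ∀ σ : ℝ, R₀ ≤ σ →
      HasDerivAt (fun σ : ℝ => ∫ x in Ω, (η x : ℂ) *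
        Complex.exp (2 * Real.pi * Complex.I * σ * (⟪Θ, p - x⟫ : ℝ))) (J' σ) σ ∧
      c * σ ^ (-(((Module.finrank ℝ E : ℝ) + 1) / 2)) ≤ ‖∫ x in Ω, (η x : ℂ) *
        Complex.exp (2 * Real.pi * Complex.I * σ * (⟪Θ, p - x⟫ : ℝ))‖ ∧
      ‖J' σ‖ ≤ C * σ⁻¹ * σ ^ (-(((Module.finrank ℝ E : ℝ) + 1) / 2)) := by
  obtain ⟨c, C, R₀, hc, hC, hR₀, h⟩ :=
    H.exists_poleIntegral_bounds hΩ hconv hη hηs hηU hη0 hr' hrr' hη1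
  obtain ⟨Λ, hΛ, hΛ'⟩ := H.exists_norm_gradient_le
  have hΛ0 : 0 < Λ := by linarith
  have hpi := Real.pi_pos
  have hpi3 := Real.pi_gt_three
  set a : ℝ := ((Module.finrank ℝ E : ℝ) + 1) / 2 with ha
  have ha0 : 0 ≤ a := by positivity
  -- In terms of the unit normal, the frequency is `tσ` with `t = 2π / ‖∇F(p)‖`, which lies between
  -- `1 / Λ` and `2π`. Hence the factors here, and `σ ≥ Λ R₀` ensures `tσ ≥ R₀`.
  refine ⟨c * (2 * Real.pi) ^ (-a), C * Λ ^ a, Λ * R₀, by positivity, by positivity,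
    by nlinarith, ?_⟩
  intro p hp hFp Θ hΘ
  have hpr : p ∈ Metric.ball p₀ r := Metric.ball_subset_ball (by linarith) hp
  set l := ‖gradient F p‖ with hl
  have hl1 : 1 ≤ l := H.one_le_norm_gradient p
  have hl0 : 0 < l := by linarith
  have hlΛ : l ≤ Λ := hΛ' p hpr
  set t : ℝ := 2 * Real.pi / l with ht
  have ht0 : 0 < t := by positivity
  have hJ : (fun σ : ℝ => ∫ x in Ω, (η x : ℂ) *
      Complex.exp (2 * Real.pi * Complex.I * σ * (⟪Θ, p - x⟫ : ℝ))) =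
      fun σ : ℝ => poleIntegral Ω F η p ((t * σ : ℝ) : ℂ) := by
    funext σ
    rw [poleIntegral]
    congr 1
    funext x
    congr 2
    rw [H.tangentPhase_eq_inner p x, ← hl, ← hΘ, ht]
    push_cast
    have : (l : ℂ) ≠ 0 := by exact_mod_cast hl0.ne'
    field_simp
  choose D hD hD' using fun z => hasDerivAt_poleIntegral (F := F) hΩ hη.continuous p z
  refine ⟨fun σ => D ((t * σ : ℝ) : ℂ) * t, fun σ hσ => ?_⟩
  have hσ0 : 0 < σ := by nlinarith
  have htσ : R₀ ≤ t * σ := by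
    calc R₀ ≤ σ / Λ := by rw [le_div_iff₀ hΛ0]; linarith
      _ ≤ σ / l := by gcongr
      _ = 1 * (σ / l) := by ring
      _ ≤ (2 * Real.pi) * (σ / l) := by gcongr; linarith
      _ = t * σ := by rw [ht]; ring
  have htσ0 : 0 < t * σ := by positivity
  obtain ⟨b1, b2, b3⟩ := h p hp hFp (t * σ) htσ
  have hval := congrFun hJ σ
  have hpow : (t * σ) ^ (-a) = t ^ (-a) * σ ^ (-a) := Real.mul_rpow ht0.le hσ0.le
  have hX0 : 0 < σ ^ (-a) := by positivity
  refine ⟨?_, ?_, ?_⟩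
  · rw [hJ]
    have h0 : HasDerivAt (fun σ : ℝ => ((t * σ : ℝ) : ℂ)) (t : ℂ) σ := by
      have h1 : HasDerivAt (fun σ : ℝ => t * σ) t σ := by
        simpa using (hasDerivAt_id σ).const_mul t
      exact h1.ofReal_comp
    exact (hD _).comp σ h0
  · beta_reduce at hval
    rw [hval]
    refine le_trans ?_ b1
    rw [hpow, mul_assoc]
    gcongr c * (?_ * _)
    have : t ≤ 2 * Real.pi := by rw [ht]; exact div_le_self (by positivity) hl1
    exact Real.rpow_le_rpow_of_nonpos ht0 this (by linarith)
  · beta_reduce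
    have h1 : D ((t * σ : ℝ) : ℂ) * t = (σ : ℂ)⁻¹ * poleIntegralEuler Ω F η p ((t * σ : ℝ) : ℂ) := by
      rw [← hD']
      have : (σ : ℂ) ≠ 0 := by exact_mod_cast hσ0.ne'
      push_cast
      field_simp
    rw [h1, norm_mul, norm_inv, Complex.norm_real, Real.norm_of_nonneg hσ0.le]
    have h2 : t ^ (-a) ≤ Λ ^ a := by
      have h3 : Λ⁻¹ ≤ t := by
        rw [ht, inv_eq_one_div]
        gcongr
        linarith
      calc t ^ (-a) ≤ Λ⁻¹ ^ (-a) := Real.rpow_le_rpow_of_nonpos (by positivity) h3 (by linarith)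
        _ = Λ ^ a := by rw [Real.inv_rpow hΛ0.le, Real.rpow_neg hΛ0.le, inv_inv]
    calc _ ≤ σ⁻¹ * (C * (t ^ (-a) * σ ^ (-a))) := by rw [← hpow]; gcongr
      _ ≤ σ⁻¹ * (C * (Λ ^ a * σ ^ (-a))) := by gcongr
      _ = _ := by ring

end IsStrictGraph

end PoleIntegral

/-! ### From a defining function to a graph function. -/

section GraphConstruction

variable {E : Type*} [NormedAddCommGroup E] [InnerProductSpace ℝ E] [FiniteDimensional ℝ E]

/-- A smooth local solution of `f (x + τ x • n) = 0`. -/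
lemma exists_contDiffAt_implicit {f : E → ℝ} {p₀ n : E} (hf : ∀ᶠ x in 𝓝 p₀, ContDiffAt ℝ ∞ f x)
    (hf0 : f p₀ = 0) (hfn : fderiv ℝ f p₀ n ≠ 0) :
    ∃ τ : E → ℝ, τ p₀ = 0 ∧ (∀ᶠ x in 𝓝 p₀, ContDiffAt ℝ ∞ τ x) ∧
      ∀ᶠ x in 𝓝 p₀, f (x + τ x • n) = 0 := by
  let g : E × ℝ → ℝ := fun q => f (q.1 + q.2 • n)
  let m : E × ℝ → E := fun q => q.1 + q.2 • n
  have hm : ContDiff ℝ ∞ m := contDiff_fst.add (contDiff_snd.smul contDiff_const)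
  have hg : ∀ q, ContDiffAt ℝ ∞ f (m q) → ContDiffAt ℝ ∞ g q := fun q hq =>
    hq.comp q hm.contDiffAt
  have hinv : ∀ q, ContDiffAt ℝ ∞ f (m q) → fderiv ℝ f (m q) n ≠ 0 →
      (fderiv ℝ g q ∘L .inr ℝ E ℝ).IsInvertible := by
    intro q hq hne
    refine ⟨ContinuousLinearEquiv.unitsEquivAut ℝ (Units.mk0 _ hne), ?_⟩
    have h1 : HasFDerivAt f (fderiv ℝ f (m q)) (m q) :=
      (hq.differentiableAt (by simp)).hasFDerivAt
    have h2 : HasFDerivAt m (.fst ℝ E ℝ + (ContinuousLinearMap.snd ℝ E ℝ).smulRight n) q :=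
      hasFDerivAt_fst.add (hasFDerivAt_snd.smul_const n)
    have h3 : fderiv ℝ g q = _ := (h1.comp q h2).fderiv
    ext
    simp [h3]
  have hm0 : m (p₀, 0) = p₀ := by simp [m]
  have hc0 : ContDiffAt ℝ ∞ f (m (p₀, 0)) := by rw [hm0]; exact hf.self_of_nhds
  have hne0 : fderiv ℝ f (m (p₀, 0)) n ≠ 0 := by rwa [hm0]
  have hg0 : g (p₀, 0) = 0 := by simpa [g] using hf0
  have htop : (∞ : ℕ∞ω) ≠ 0 := by simp
  set τ := (hg _ hc0).implicitFunction htop (hinv _ hc0 hne0) with hτ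
  have hτ0 : τ p₀ = 0 := (hg _ hc0).implicitFunction_apply_self htop (hinv _ hc0 hne0)
  have hτz : ∀ᶠ x in 𝓝 p₀, g (x, τ x) = 0 := by
    have := (hg _ hc0).eventually_apply_implicitFunction htop (hinv _ hc0 hne0)
    rwa [hg0] at this
  have hτc : ContDiffAt ℝ ∞ τ p₀ :=
    (hg _ hc0).contDiffAt_implicitFunction htop (hinv _ hc0 hne0)
  have hτ1 : ∀ᶠ x in 𝓝 p₀, ContDiffAt ℝ 1 τ x :=
    (hτc.of_le (by simp)).eventually (by simp)
  have hcont : ContinuousAt (fun x => m (x, τ x)) p₀ := by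
    have : ContinuousAt (fun x => x + τ x • n) p₀ :=
      continuousAt_id.add (hτc.continuousAt.smul continuousAt_const)
    exact this
  have hlim : Tendsto (fun x => m (x, τ x)) (𝓝 p₀) (𝓝 p₀) := by
    have := hcont.tendsto
    rwa [hτ0, hm0] at this
  have hdn : ∀ᶠ x in 𝓝 p₀, fderiv ℝ f x n ≠ 0 := by
    have h1 : ContDiffAt ℝ 0 (fderiv ℝ f) p₀ :=
      (hf.self_of_nhds).fderiv_right (m := 0) (by simp)
    exact ((h1.continuousAt.clm_apply continuousAt_const).eventually_ne hfn)
  refine ⟨τ, hτ0, ?_, hτz⟩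
  -- Being `C^∞` at `p₀` does not pass to neighbouring points, being `C^1` does. So the implicit
  -- function theorem is applied afresh at each nearby `(x, τ x)`, and uniqueness identifies its
  -- smooth solution with `τ`, which is already known to be continuous there.
  filter_upwards [hlim.eventually hf, hlim.eventually hdn, hτ1, hτz.eventually_nhds]
    with x hx1 hx2 hx3 hx4
  have hgx : g (x, τ x) = 0 := hx4.self_of_nhds
  have e1 := (hg _ hx1).eventually_apply_eq_iff_implicitFunction htop (hinv _ hx1 hx2)
  have e2 := (hg _ hx1).contDiffAt_implicitFunction htop (hinv _ hx1 hx2)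
  refine e2.congr_of_eventuallyEq ?_
  have hpair : Tendsto (fun y => (y, τ y)) (𝓝 x) (𝓝 (x, τ x)) :=
    (continuousAt_id.prodMk hx3.continuousAt)
  filter_upwards [hpair.eventually e1, hx4] with y hy1 hy2
  exact (hy1.1 (by rw [hy2, hgx])).symm

/-- A regular sublevel set is locally the sublevel set of a graph function. -/
lemma exists_isGraphFunction {f : E → ℝ} {p₀ n : E} (hf : ∀ᶠ x in 𝓝 p₀, ContDiffAt ℝ ∞ f x)
    (hf0 : f p₀ = 0) (hn : ‖n‖ = 1) (hfn : 0 < fderiv ℝ f p₀ n) :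
    ∃ F, IsGraphFunction n F ∧ F p₀ = 0 ∧ (∀ᶠ x in 𝓝 p₀, f (x - F x • n) = 0) ∧
      ∀ᶠ x in 𝓝 p₀, (f x ≤ 0 ↔ F x ≤ 0) := by
  obtain ⟨τ, hτ0, hτc, hτz⟩ := exists_contDiffAt_implicit hf hf0 hfn.ne'
  obtain ⟨ε, hε, hball⟩ := Metric.eventually_nhds_iff_ball.1 hτc
  let χ : ContDiffBump p₀ := ⟨ε / 4, ε / 2, by positivity, by linarith⟩
  let z : E → E := fun x => p₀ + orthComponent n (x - p₀)
  have hz : ContDiff ℝ ∞ z :=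
    contDiff_const.add ((orthComponent n).contDiff.comp (contDiff_id.sub contDiff_const))
  have hφ : ContDiff ℝ ∞ (fun y => χ y * τ y) := by
    refine contDiff_iff_contDiffAt.2 fun y => ?_
    by_cases hy : y ∈ tsupport (fun y => χ y * τ y)
    swap
    · exact contDiffAt_const.congr_of_eventuallyEq (notMem_tsupport_iff_eventuallyEq.1 hy)
    have hy' : y ∈ tsupport χ := tsupport_mul_subset_left hy
    rw [χ.tsupport_eq] at hy'
    refine χ.contDiff.contDiffAt.mul (hball y ?_)
    exact Metric.closedBall_subset_ball (by simp only [χ]; linarith) hy'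
  -- The cutoff makes the implicit solution globally smooth. Evaluating it at the projection `z x`
  -- makes `F` exactly a graph function, not only near `p₀`.
  let F : E → ℝ := fun x => ⟪n, x - p₀⟫ - χ (z x) * τ (z x)
  have hz0 : z p₀ = p₀ := by simp [z]
  have hF0 : F p₀ = 0 := by simp only [F, hz0, hτ0]; simp
  have hFs : ContDiff ℝ ∞ F :=
    (contDiff_const.inner ℝ (contDiff_id.sub contDiff_const)).sub (hφ.comp hz)
  have hG : IsGraphFunction n F := by
    refine ⟨hn, hFs, fun x t => ?_⟩
    have h1 : z (x + t • n) = z x := by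
      simp only [z]
      rw [show x + t • n - p₀ = (x - p₀) + t • n by abel, map_add, map_smul,
        orthComponent_self hn, smul_zero, add_zero]
    simp only [F, h1]
    rw [show x + t • n - p₀ = (x - p₀) + t • n by abel, inner_add_right, inner_smul_right,
      real_inner_self_eq_norm_sq, hn]
    ring
  have hzlim : Tendsto z (𝓝 p₀) (𝓝 p₀) := by
    have := hz.continuous.tendsto p₀
    rwa [hz0] at this
  have hone : ∀ᶠ x in 𝓝 p₀, χ (z x) = 1 := by
    filter_upwards [hzlim.eventually (Metric.closedBall_mem_nhds p₀ χ.rIn_pos)] with x hx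
    exact χ.one_of_mem_closedBall hx
  have hzero : ∀ᶠ x in 𝓝 p₀, f (x - F x • n) = 0 := by
    filter_upwards [hone, hzlim.eventually hτz] with x hx1 hx2
    rw [← hx2]
    congr 1
    have hFx : F x = ⟪n, x - p₀⟫ - τ (z x) := by simp only [F, hx1, one_mul]
    rw [hFx, sub_smul, show z x = p₀ + orthComponent n (x - p₀) from rfl, orthComponent_apply]
    abel
  refine ⟨F, hG, hF0, hzero, ?_⟩
  have hdn : ∀ᶠ x in 𝓝 p₀, 0 < fderiv ℝ f x n := by
    have h1 : ContDiffAt ℝ 0 (fderiv ℝ f) p₀ :=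
      (hf.self_of_nhds).fderiv_right (m := 0) (by simp)
    exact (h1.continuousAt.clm_apply continuousAt_const).eventually_const_lt hfn
  obtain ⟨δ, hδ, hδb⟩ := Metric.eventually_nhds_iff_ball.1 (hf.and hdn)
  have hylim : Tendsto (fun x => x - F x • n) (𝓝 p₀) (𝓝 p₀) := by
    have h1 : Continuous (fun x => x - F x • n) :=
      continuous_id.sub (hFs.continuous.smul continuous_const)
    have := h1.tendsto p₀
    simpa [hF0] using this
  filter_upwards [hzero, Metric.ball_mem_nhds p₀ hδ,
    hylim.eventually (Metric.ball_mem_nhds p₀ hδ)] with x hx1 hx2 hx3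
  have hseg : ∀ t ∈ Icc (0:ℝ) 1, x - F x • n + t • (F x • n) ∈ Metric.ball p₀ δ := by
    intro t ht
    have := (convex_ball p₀ δ).add_smul_sub_mem hx3 hx2 ht
    rwa [sub_sub_cancel] at this
  -- By the mean value theorem on the segment from `x - F x n`, where `f` vanishes, to `x`, `f x` is
  -- `F x` times a positive value of the derivative of `f` along `n`. So `f` and `F` have the same
  -- sign.
  have hder : ∀ t ∈ Icc (0:ℝ) 1, HasDerivAt (fun t : ℝ => f (x - F x • n + t • (F x • n)))
      (F x * fderiv ℝ f (x - F x • n + t • (F x • n)) n) t := by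
    intro t ht
    have h1 := ((hδb _ (hseg t ht)).1.differentiableAt (by simp)).hasFDerivAt
    have h2 : HasDerivAt (fun t : ℝ => x - F x • n + t • (F x • n)) (F x • n) t := by
      simpa using ((hasDerivAt_id t).smul_const (F x • n)).const_add (x - F x • n)
    have h3 := h1.comp_hasDerivAt t h2
    rw [map_smul, smul_eq_mul] at h3
    exact h3
  obtain ⟨c, hc, hc'⟩ := exists_hasDerivAt_eq_slope _ _ (zero_lt_one (α := ℝ))
    (fun t ht => (hder t ht).continuousAt.continuousWithinAt)
    (fun t ht => hder t (Ioo_subset_Icc_self ht))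
  have hpos := (hδb _ (hseg c (Ioo_subset_Icc_self hc))).2
  simp only [one_smul, sub_add_cancel, zero_smul, add_zero, hx1, sub_zero, div_one] at hc'
  rw [← hc']
  constructor
  · intro h
    by_contra! h'
    exact absurd h (not_le.2 (mul_pos h' hpos))
  · intro h
    exact mul_nonpos_of_nonpos_of_nonneg h hpos.le

end GraphConstruction

/-! ### Convexity makes the Hessian nonnegative. -/

section Convexity

variable {E : Type*} [NormedAddCommGroup E] [InnerProductSpace ℝ E]
variable {Ω : Set E} {n p₀ : E} {F : E → ℝ}

/-- If the second derivative were negative, the point would also be a local maximum, and `G` would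
be locally constant. -/
lemma nonneg_of_isLocalMin_deriv_deriv {G : ℝ → ℝ} {x : ℝ} (hG : Continuous G)
    (hmin : IsLocalMin G x) : 0 ≤ deriv (deriv G) x := by
  by_contra! h
  have hmax := isLocalMax_of_deriv_deriv_neg h hmin.deriv_eq_zero hG.continuousAt
  have heq : G =ᶠ[𝓝 x] fun _ => G x := by
    filter_upwards [hmin, hmax] with y h1 h2
    exact le_antisymm h2 h1
  have h0 := heq.deriv.deriv_eq
  simp only [deriv_const'] at h0
  linarith

/-- The boundary points over `p₀ ± t v` have midpoint `p₀ - (G t / 2) n`, which lies in `Ω`, so `-G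
t / 2 ≤ 0`. Thus `G t = F(p₀ + t v) + F(p₀ - t v)` has a minimum at `0`, and its second derivative
there is twice the Hessian. -/
lemma IsGraphFunction.nonneg_fderiv_two_of_convex (hG : IsGraphFunction n F) (hconv : Convex ℝ Ω)
    (hF0 : F p₀ = 0) (hmem : ∀ᶠ x in 𝓝 p₀, (x ∈ Ω ↔ F x ≤ 0)) (v : E) :
    0 ≤ fderiv ℝ (fderiv ℝ F) p₀ v v := by
  let G : ℝ → ℝ := fun t => F (p₀ + t • v) + F (p₀ - t • v)
  have hp : ∀ t : ℝ, HasDerivAt (fun t : ℝ => p₀ + t • v) v t := fun t => by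
    simpa using ((hasDerivAt_id t).smul_const v).const_add p₀
  have hm : ∀ t : ℝ, HasDerivAt (fun t : ℝ => p₀ - t • v) (-v) t := fun t => by
    simpa using ((hasDerivAt_id t).smul_const v).const_sub p₀
  have hFd : ∀ x, HasFDerivAt F (fderiv ℝ F x) x := fun x =>
    (hG.contDiff.differentiable (by simp) x).hasFDerivAt
  have hFd2 : ∀ x, HasFDerivAt (fderiv ℝ F) (fderiv ℝ (fderiv ℝ F) x) x := fun x =>
    (hG.contDiff_fderiv.differentiable (by simp) x).hasFDerivAt
  have h1 : ∀ t, HasDerivAt G (fderiv ℝ F (p₀ + t • v) v + fderiv ℝ F (p₀ - t • v) (-v)) t :=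
    fun t => ((hFd _).comp_hasDerivAt t (hp t)).add ((hFd _).comp_hasDerivAt t (hm t))
  have h2 : HasDerivAt (fun t : ℝ => fderiv ℝ F (p₀ + t • v) v + fderiv ℝ F (p₀ - t • v) (-v))
      (2 * fderiv ℝ (fderiv ℝ F) p₀ v v) 0 := by
    have e1 := ((hFd2 _).comp_hasDerivAt (0:ℝ) (hp 0)).clm_apply (hasDerivAt_const (0:ℝ) v)
    have e2 := ((hFd2 _).comp_hasDerivAt (0:ℝ) (hm 0)).clm_apply (hasDerivAt_const (0:ℝ) (-v))
    convert! e1.add e2 using 1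
    simp
    ring
  have hcont : Continuous G := continuous_iff_continuousAt.2 fun t => (h1 t).continuousAt
  have hder : deriv G = fun t : ℝ =>
      fderiv ℝ F (p₀ + t • v) v + fderiv ℝ F (p₀ - t • v) (-v) := funext fun t => (h1 t).deriv
  have hlim : ∀ {g : ℝ → E}, Continuous g → g 0 = p₀ → Tendsto g (𝓝 0) (𝓝 p₀) := by
    intro g hg h0
    have := hg.tendsto 0
    rwa [h0] at this
  have hFc := hG.contDiff.continuous
  have hmin : IsLocalMin G 0 := by
    have hG0 : G 0 = 0 := by simp [G, hF0]
    filter_upwards [(hlim (g := fun t => p₀ + t • v - F (p₀ + t • v) • n) (by fun_prop)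
        (by simp [hF0])).eventually hmem,
      (hlim (g := fun t => p₀ - t • v - F (p₀ - t • v) • n) (by fun_prop)
        (by simp [hF0])).eventually hmem,
      (hlim (g := fun t => p₀ - (1 / 2 * G t) • n) (by fun_prop)
        (by simp [hG0])).eventually hmem] with t ht1 ht2 ht3
    have htr : ∀ x (s : ℝ), F (x - s • n) = F x - s := fun x s => by
      rw [sub_eq_add_neg, ← neg_smul, hG.translate, sub_eq_add_neg]
    rw [htr, sub_self] at ht1 ht2
    rw [htr, hF0] at ht3
    have h4 := hconv (ht1.2 le_rfl) (ht2.2 le_rfl) (by norm_num : (0:ℝ) ≤ 1 / 2)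
      (by norm_num : (0:ℝ) ≤ 1 / 2) (by norm_num)
    have h5 : (1 / 2 : ℝ) • (p₀ + t • v - F (p₀ + t • v) • n) +
        (1 / 2 : ℝ) • (p₀ - t • v - F (p₀ - t • v) • n) = p₀ - (1 / 2 * G t) • n := by
      simp only [G]
      module
    rw [h5] at h4
    have := ht3.1 h4
    rw [hG0]
    linarith
  have := nonneg_of_isLocalMin_deriv_deriv hcont hmin
  rw [hder, h2.deriv] at this
  linarith

/-- A nonnegative symmetric bilinear form that vanishes at `(v, v)` has `v` in its kernel. -/
lemma apply_eq_zero_of_nonneg (B : E →L[ℝ] E →L[ℝ] ℝ) (hsymm : ∀ v w, B v w = B w v)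
    (hB : ∀ v, 0 ≤ B v v) {v : E} (hv : B v v = 0) : B v = 0 := by
  ext w
  have h : ∀ t : ℝ, 0 ≤ B w w + 2 * t * B v w := fun t => by
    have := hB (w + t • v)
    simp only [map_add, map_smul, _root_.add_apply, _root_.smul_apply, smul_eq_mul, hv,
      hsymm w v] at this
    linarith
  -- For `B v w ≠ 0` this value of `t` makes the right side of `h` equal to `-1`.
  have h1 := h (-(B w w + 1) / (2 * B v w))
  by_contra hne
  have hne' : B v w ≠ 0 := by simpa using hne
  have : 2 * (-(B w w + 1) / (2 * B v w)) * B v w = -(B w w + 1) := by field_simp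
  linarith

end Convexity

/-! ### The derivative of the unit normal and the Hessian of the graph function. -/

section Curvature

variable {E : Type*} [NormedAddCommGroup E] [InnerProductSpace ℝ E]

lemma differentiableAt_inv_norm_smul {w : E} (hw : w ≠ 0) :
    DifferentiableAt ℝ (fun w : E => ‖w‖⁻¹ • w) w :=
  ((differentiableAt_id.norm ℝ hw).inv (norm_ne_zero_iff.2 hw)).smul differentiableAt_id

variable [FiniteDimensional ℝ E] {n p₀ : E} {F f : E → ℝ}

lemma HasFDerivAt.gradient_of_fderiv {L : E →L[ℝ] E →L[ℝ] ℝ} {x : E}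
    (h : HasFDerivAt (fderiv ℝ f) L x) :
    HasFDerivAt (gradient f)
      ((InnerProductSpace.toDual ℝ E).symm.toContinuousLinearEquiv.toContinuousLinearMap ∘L L) x :=
  (InnerProductSpace.toDual ℝ E).symm.toContinuousLinearEquiv.toContinuousLinearMap.hasFDerivAt.comp
    x h

/-- The unit normal of a level set in terms of its graph function. -/
lemma eventually_normalized_gradient_eq (hG : IsGraphFunction n F)
    (hf : ∀ᶠ x in 𝓝 p₀, ContDiffAt ℝ ∞ f x) (hF0 : F p₀ = 0)
    (hfF : ∀ᶠ x in 𝓝 p₀, f (x - F x • n) = 0) (hfn : 0 < fderiv ℝ f p₀ n) :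
    ∀ᶠ x in 𝓝 p₀, ‖gradient f (x - F x • n)‖⁻¹ • gradient f (x - F x • n) =
      ‖gradient F x‖⁻¹ • gradient F x := by
  have hdn : ∀ᶠ x in 𝓝 p₀, 0 < fderiv ℝ f x n := by
    have h1 : ContDiffAt ℝ 0 (fderiv ℝ f) p₀ :=
      (hf.self_of_nhds).fderiv_right (m := 0) (by simp)
    exact (h1.continuousAt.clm_apply continuousAt_const).eventually_const_lt hfn
  have hylim : Tendsto (fun x => x - F x • n) (𝓝 p₀) (𝓝 p₀) := by
    have h1 : Continuous (fun x => x - F x • n) :=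
      continuous_id.sub (hG.contDiff.continuous.smul continuous_const)
    have := h1.tendsto p₀
    simpa [hF0] using this
  filter_upwards [hfF.eventually_nhds, hylim.eventually hf, hylim.eventually hdn]
    with x hx1 hx2 hx3
  set y := x - F x • n with hy
  have h1 : HasFDerivAt f (fderiv ℝ f y) y := (hx2.differentiableAt (by simp)).hasFDerivAt
  have h2 : HasFDerivAt (fun x => x - F x • n)
      (ContinuousLinearMap.id ℝ E - (fderiv ℝ F x).smulRight n) x :=
    (hasFDerivAt_id x).sub ((hG.contDiff.differentiable (by simp) x).hasFDerivAt.smul_const n)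
  have h3 := h1.comp x h2
  have h4 : HasFDerivAt (f ∘ fun x => x - F x • n) (0 : E →L[ℝ] ℝ) x :=
    (hasFDerivAt_const (0:ℝ) x).congr_of_eventuallyEq hx1
  have h5 := h3.unique h4
  -- Differentiating `f (x - F x n) = 0` shows that the gradient of `f` at `y` is a positive
  -- multiple of the gradient of `F` at `x`.
  have h6 : gradient f y = (fderiv ℝ f y n) • gradient F x := by
    refine ext_inner_right ℝ fun w => ?_
    have := congrArg (fun L : E →L[ℝ] ℝ => L w) h5
    simp only [ContinuousLinearMap.comp_apply, _root_.sub_apply,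
      ContinuousLinearMap.id_apply, ContinuousLinearMap.smulRight_apply, map_sub, map_smul,
      _root_.zero_apply, smul_eq_mul] at this
    rw [real_inner_smul_left, ← fderiv_apply_eq_inner_gradient, ← fderiv_apply_eq_inner_gradient]
    linarith
  rw [h6, norm_smul, Real.norm_of_nonneg hx3.le, mul_inv, smul_smul]
  congr 1
  field_simp

/-- Directions in the kernel of the Hessian of the graph function are in the kernel of the
derivative of the unit normal. -/
lemma fderiv_normalized_gradient_eq_zero (hG : IsGraphFunction n F)
    (hf : ∀ᶠ x in 𝓝 p₀, ContDiffAt ℝ ∞ f x) (hF0 : F p₀ = 0)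
    (hfF : ∀ᶠ x in 𝓝 p₀, f (x - F x • n) = 0) (hfn : 0 < fderiv ℝ f p₀ n)
    {v : E} (hv : fderiv ℝ F p₀ v = 0) (hv2 : fderiv ℝ (fderiv ℝ F) p₀ v = 0) :
    fderiv ℝ (fun x => ‖gradient f x‖⁻¹ • gradient f x) p₀ v = 0 := by
  have heq := eventually_normalized_gradient_eq hG hf hF0 hfF hfn
  have hf0 : gradient f p₀ ≠ 0 := by
    intro h
    rw [fderiv_apply_eq_inner_gradient, h, inner_zero_left] at hfn
    exact lt_irrefl _ hfn
  have hFg0 : gradient F p₀ ≠ 0 := by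
    intro h
    have := hG.fderiv_apply_normal p₀
    rw [fderiv_apply_eq_inner_gradient, h, inner_zero_left] at this
    exact zero_ne_one this
  have hdf : DifferentiableAt ℝ (fun x => ‖gradient f x‖⁻¹ • gradient f x) p₀ := by
    have h1 : ContDiffAt ℝ 1 (fderiv ℝ f) p₀ := (hf.self_of_nhds).fderiv_right (m := 1) (by
      rw [one_add_one_eq_two]; exact ENat.LEInfty.out)
    have h2 := (h1.differentiableAt (by simp)).hasFDerivAt.gradient_of_fderiv.differentiableAt
    exact DifferentiableAt.comp p₀ (differentiableAt_inv_norm_smul hf0) h2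
  have h1 : HasFDerivAt (fun x => x - F x • n)
      (ContinuousLinearMap.id ℝ E - (fderiv ℝ F p₀).smulRight n) p₀ :=
    (hasFDerivAt_id p₀).sub ((hG.contDiff.differentiable (by simp) p₀).hasFDerivAt.smul_const n)
  have hy : p₀ - F p₀ • n = p₀ := by simp [hF0]
  have h2 : HasFDerivAt (fun x => ‖gradient f x‖⁻¹ • gradient f x)
      (fderiv ℝ (fun x => ‖gradient f x‖⁻¹ • gradient f x) p₀) (p₀ - F p₀ • n) := by
    rw [hy]; exact hdf.hasFDerivAt
  have h3 := h2.comp p₀ h1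
  have h4 : HasFDerivAt (gradient F) _ p₀ :=
    (hG.contDiff_fderiv.differentiable (by simp) p₀).hasFDerivAt.gradient_of_fderiv
  have h5 := ((differentiableAt_inv_norm_smul hFg0).hasFDerivAt.comp p₀ h4).congr_of_eventuallyEq
    heq
  -- Both expressions for the normal are differentiated along `v`. The map `x - F x n` has
  -- derivative `v` along `v`, and the other side factors through `F''(p₀) v = 0`.
  have h6 := congrArg (fun L : E →L[ℝ] E => L v) (h3.unique h5)
  simpa [hv, hv2] using h6

/-- Compactness of the unit sphere of the complement of `n` gives a lower bound at `p₀`; continuity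
of the Hessian preserves half of it nearby. -/
lemma IsGraphFunction.exists_ball_strict (hG : IsGraphFunction n F)
    (hpos : ∀ v, ⟪n, v⟫ = 0 → v ≠ 0 → 0 < fderiv ℝ (fderiv ℝ F) p₀ v v) :
    ∃ r κ, 0 < r ∧ 0 < κ ∧ ∀ x ∈ Metric.ball p₀ r, ∀ v, ⟪n, v⟫ = 0 →
      κ * ‖v‖ ^ 2 ≤ fderiv ℝ (fderiv ℝ F) x v v := by
  set K : Set E := Metric.sphere 0 1 ∩ {v | ⟪n, v⟫ = 0} with hK
  have hKc : IsCompact K := (isCompact_sphere 0 1).inter_right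
    (isClosed_eq (by fun_prop) continuous_const)
  have hex : ∃ κ, 0 < κ ∧ ∀ v ∈ K, κ ≤ fderiv ℝ (fderiv ℝ F) p₀ v v := by
    -- In dimension one this sphere is empty, and any constant will do.
    rcases K.eq_empty_or_nonempty with h | h
    · exact ⟨1, one_pos, by simp [h]⟩
    · have hc : Continuous (fun v => fderiv ℝ (fderiv ℝ F) p₀ v v) := by fun_prop
      obtain ⟨v, hv, hv'⟩ := hKc.exists_isMinOn h hc.continuousOn
      refine ⟨_, hpos v hv.2 fun h0 => ?_, fun w hw => hv' hw⟩
      have := hv.1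
      simp [h0] at this
  obtain ⟨κ, hκ, hmin⟩ := hex
  have hev : ∀ᶠ x in 𝓝 p₀, ‖fderiv ℝ (fderiv ℝ F) x - fderiv ℝ (fderiv ℝ F) p₀‖ < κ / 2 := by
    have h1 : ContinuousAt (fun x => ‖fderiv ℝ (fderiv ℝ F) x - fderiv ℝ (fderiv ℝ F) p₀‖) p₀ :=
      (hG.contDiff_fderiv_two.continuous.continuousAt.sub continuousAt_const).norm
    refine h1.eventually_lt_const ?_
    beta_reduce
    rw [sub_self, norm_zero]
    positivity
  obtain ⟨r, hr, hball⟩ := Metric.eventually_nhds_iff_ball.1 hev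
  refine ⟨r, κ / 2, hr, by positivity, fun x hx v hv => ?_⟩
  rcases eq_or_ne v 0 with rfl | hv0
  · simp
  have hn0 : 0 < ‖v‖ := norm_pos_iff.2 hv0
  have h1 := hmin (‖v‖⁻¹ • v) ⟨by simp [norm_smul, hn0.ne'], by simp [inner_smul_right, hv]⟩
  have h2 : κ * ‖v‖ ^ 2 ≤ fderiv ℝ (fderiv ℝ F) p₀ v v := by
    simp only [map_smul, _root_.smul_apply, smul_eq_mul] at h1
    calc κ * ‖v‖ ^ 2 ≤ (‖v‖⁻¹ * (‖v‖⁻¹ * fderiv ℝ (fderiv ℝ F) p₀ v v)) * ‖v‖ ^ 2 := by gcongr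
      _ = _ := by field_simp
  have h3 : |(fderiv ℝ (fderiv ℝ F) x - fderiv ℝ (fderiv ℝ F) p₀) v v| ≤ κ / 2 * ‖v‖ ^ 2 := by
    rw [← Real.norm_eq_abs]
    refine (ContinuousLinearMap.le_opNorm₂ _ _ _).trans ?_
    rw [mul_assoc, ← sq]
    gcongr
    exact (hball x hx).le
  simp only [_root_.sub_apply] at h3
  linarith [(abs_le.1 h3).1]

end Curvature

/-! ### Nonzero curvature gives strictly convex graphs. -/

section EuclideanSpace

variable {d : ℕ} {Ω : Set (EuclideanSpace ℝ (Fin d))} {p₀ : EuclideanSpace ℝ (Fin d)}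
  {f : EuclideanSpace ℝ (Fin d) → ℝ}

lemma eq_zero_of_fderiv_unitNormal_eq_zero (hK : levelSetGaussianCurvature f p₀ ≠ 0)
    {v : EuclideanSpace ℝ (Fin d)} (hv : ⟪gradient f p₀, v⟫ = 0)
    (h : fderiv ℝ (unitNormal f) p₀ v = 0) : v = 0 := by
  have hvm : v ∈ tangentHyperplane f p₀ := Submodule.mem_orthogonal_singleton_iff_inner_right.2 hv
  have h1 : weingartenMap f p₀ ⟨v, hvm⟩ = 0 := by
    simp [weingartenMap, h]
  have h2 : Function.Injective (weingartenMap f p₀) :=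
    (LinearMap.equivOfDetNeZero (weingartenMap f p₀) hK).injective
  have h3 : (⟨v, hvm⟩ : tangentHyperplane f p₀) = 0 := h2 (by rw [h1, map_zero])
  simpa using congrArg Subtype.val h3

lemma IsLocalDefiningFunction.apply_eq_zero (hf : IsLocalDefiningFunction Ω f p₀)
    (hΩ : IsClosed Ω) (hp : p₀ ∈ frontier Ω) : f p₀ = 0 := by
  obtain ⟨-, U, hU, hpU, hfU, hmem⟩ := hf
  refine le_antisymm ((hmem p₀ hpU).1 (hΩ.frontier_subset hp)) ?_
  by_contra! h
  have hc : ContinuousAt f p₀ := (hfU.contDiffAt (hU.mem_nhds hpU)).continuousAt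
  refine hp.2 (mem_interior_iff_mem_nhds.2 ?_)
  filter_upwards [hU.mem_nhds hpU, hc.eventually_lt_const h] with x hx1 hx2
  exact (hmem x hx1).2 hx2.le

/-- Near a boundary point of nonzero curvature a convex set is bounded by a strictly convex
graph. -/
theorem exists_isStrictGraph (hΩ : IsClosed Ω) (hconv : Convex ℝ Ω) (hp : p₀ ∈ frontier Ω)
    (hf : IsLocalDefiningFunction Ω f p₀) (hK : levelSetGaussianCurvature f p₀ ≠ 0) :
    ∃ n F r κ, IsStrictGraph Ω n p₀ F r κ ∧ F p₀ = 0 := by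
  have hf0 := hf.apply_eq_zero hΩ hp
  obtain ⟨hg0, U, hU, hpU, hfU, hmem⟩ := hf
  have hfs : ∀ᶠ x in 𝓝 p₀, ContDiffAt ℝ ∞ f x := by
    filter_upwards [hU.mem_nhds hpU] with x hx
    exact hfU.contDiffAt (hU.mem_nhds hx)
  have hgn : 0 < ‖gradient f p₀‖ := norm_pos_iff.2 hg0
  set n := ‖gradient f p₀‖⁻¹ • gradient f p₀ with hn
  have hn1 : ‖n‖ = 1 := by rw [hn, norm_smul, norm_inv, norm_norm, inv_mul_cancel₀ hgn.ne']
  have hfn : 0 < fderiv ℝ f p₀ n := by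
    rw [fderiv_apply_eq_inner_gradient, hn, real_inner_smul_right, real_inner_self_eq_norm_sq]
    positivity
  obtain ⟨F, hG, hF0, hfF, hiff⟩ := exists_isGraphFunction hfs hf0 hn1 hfn
  have hmemF : ∀ᶠ x in 𝓝 p₀, (x ∈ Ω ↔ F x ≤ 0) := by
    filter_upwards [hU.mem_nhds hpU, hiff] with x hx1 hx2
    rw [hmem x hx1, hx2]
  have hnF : n = ‖gradient F p₀‖⁻¹ • gradient F p₀ := by
    have := (eventually_normalized_gradient_eq hG hfs hF0 hfF hfn).self_of_nhds
    simpa [hF0, ← hn] using this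
  have hnn := hG.nonneg_fderiv_two_of_convex hconv hF0 hmemF
  have hsymm : ∀ v w, fderiv ℝ (fderiv ℝ F) p₀ v w = fderiv ℝ (fderiv ℝ F) p₀ w v :=
    (hG.contDiff.contDiffAt (x := p₀)).isSymmSndFDerivAt (by
      rw [minSmoothness_of_isRCLikeNormedField]; exact ENat.LEInfty.out)
  -- A nonnegative Hessian that vanishes on `(v, v)` has `v` in its kernel, so the normal is
  -- stationary along `v`. This is excluded for `v ≠ 0`, since the Weingarten map has nonzero
  -- determinant.
  have hpos : ∀ v, ⟪n, v⟫ = 0 → v ≠ 0 → 0 < fderiv ℝ (fderiv ℝ F) p₀ v v := by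
    intro v hv hv0
    refine lt_of_le_of_ne (hnn v) fun h => hv0 ?_
    have h1 := apply_eq_zero_of_nonneg _ hsymm hnn h.symm
    refine eq_zero_of_fderiv_unitNormal_eq_zero hK ?_
      (fderiv_normalized_gradient_eq_zero hG hfs hF0 hfF hfn ?_ h1)
    · rw [hn, real_inner_smul_left] at hv
      exact (mul_eq_zero.1 hv).resolve_left (by positivity)
    · rw [hnF, real_inner_smul_left] at hv
      rw [fderiv_apply_eq_inner_gradient]
      refine (mul_eq_zero.1 hv).resolve_left fun h => ?_
      rw [h, zero_smul] at hnF
      rw [hnF, norm_zero] at hn1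
      exact zero_ne_one hn1
  obtain ⟨r, κ, hr, hκ, hs⟩ := hG.exists_ball_strict hpos
  obtain ⟨ε, hε, hball⟩ := Metric.eventually_nhds_iff_ball.1 hmemF
  exact ⟨n, F, min r ε, κ, ⟨hG, lt_min hr hε, hκ,
    fun x hx => hball x (Metric.ball_subset_ball (min_le_right _ _) hx),
    fun x hx => hs x (Metric.ball_subset_ball (min_le_left _ _) hx)⟩, hF0⟩

end EuclideanSpace

/-! ### Maximum points of linear functionals and their stability. -/

section Poles

variable {E : Type*} [NormedAddCommGroup E] [InnerProductSpace ℝ E] [FiniteDimensional ℝ E]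
variable {Ω : Set E} {n p₀ : E} {F : E → ℝ} {r κ : ℝ}

namespace IsStrictGraph

/-- A maximum point of a linear functional is a boundary point with the corresponding normal. -/
lemma eq_normalized_gradient_of_isMaxOn (H : IsStrictGraph Ω n p₀ F r κ) {p Θ : E}
    (hp : p ∈ Metric.ball p₀ r) (hpΩ : p ∈ Ω) (hmax : ∀ x ∈ Ω, ⟪Θ, x⟫ ≤ ⟪Θ, p⟫) (hΘ : ‖Θ‖ = 1) :
    F p = 0 ∧ Θ = ‖gradient F p‖⁻¹ • gradient F p := by
  have hev : ∀ᶠ x in 𝓝 p, (x ∈ Ω ↔ F x ≤ 0) := by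
    filter_upwards [Metric.isOpen_ball.mem_nhds hp] with x hx using H.mem_iff x hx
  have hline : ∀ w : E, Tendsto (fun t : ℝ => p + t • w) (𝓝[>] 0) (𝓝 p) := fun w => by
    have h1 : Continuous (fun t : ℝ => p + t • w) := by fun_prop
    have := h1.tendsto 0
    rw [zero_smul, add_zero] at this
    exact this.mono_left nhdsWithin_le_nhds
  -- directions along which one stays in `Ω`
  have hkey : ∀ w : E, (∀ᶠ t in 𝓝[>] (0:ℝ), F (p + t • w) ≤ 0) → ⟪Θ, w⟫ ≤ 0 := by
    intro w hw
    obtain ⟨t, ⟨h1, h2⟩, h3⟩ :=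
      ((hw.and ((hline w).eventually hev)).and self_mem_nhdsWithin).exists
    have h4 := hmax _ (h2.2 h1)
    rw [inner_add_right, inner_smul_right] at h4
    have h3' : (0:ℝ) < t := h3
    by_contra! hcon
    nlinarith [mul_pos h3' hcon]
  have hF0 : F p = 0 := by
    refine le_antisymm ((H.mem_iff p hp).1 hpΩ) ?_
    by_contra! h
    have h1 := hkey Θ (by
      filter_upwards [(hline Θ).eventually
        (H.graph.contDiff.continuous.continuousAt.eventually_lt_const h)] with t ht using ht.le)
    rw [real_inner_self_eq_norm_sq, hΘ] at h1
    norm_num at h1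
  have hg := H.one_le_norm_gradient p
  have hg0 : 0 < ‖gradient F p‖ := by linarith
  set g := gradient F p with hgdef
  have hdir : ∀ w, ⟪g, w⟫ < 0 → ⟪Θ, w⟫ ≤ 0 := by
    intro w hw
    refine hkey w ?_
    have hd : HasDerivAt (fun t : ℝ => F (p + t • w)) ⟪g, w⟫ 0 := by
      have h1 : HasFDerivAt F (fderiv ℝ F p) (p + (0:ℝ) • w) := by
        rw [zero_smul, add_zero]
        exact (H.graph.contDiff.differentiable (by simp) p).hasFDerivAt
      have h2 : HasDerivAt (fun t : ℝ => p + t • w) w 0 := by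
        simpa using ((hasDerivAt_id (0:ℝ)).smul_const w).const_add p
      have h3 := h1.comp_hasDerivAt (0:ℝ) h2
      rwa [fderiv_apply_eq_inner_gradient] at h3
    have h4 := (hasDerivAt_iff_tendsto_slope_zero.1 hd).mono_left
      (nhdsWithin_mono (0:ℝ) (s := Ioi 0) (t := {0}ᶜ) fun t ht => ne_of_gt ht)
    filter_upwards [h4.eventually_lt_const hw, self_mem_nhdsWithin] with t ht1 ht2
    have ht2' : (0:ℝ) < t := ht2
    simp only [zero_add, zero_smul, add_zero, hF0, sub_zero, smul_eq_mul] at ht1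
    by_contra! hcon
    have : 0 < t⁻¹ * F (p + t • w) := by positivity
    linarith
  set u := Θ - (⟪g, Θ⟫ / ‖g‖ ^ 2) • g with hu
  have hgu : ⟪g, u⟫ = 0 := by
    rw [hu, inner_sub_right, inner_smul_right, real_inner_self_eq_norm_sq]
    field_simp
    ring
  have hΘu : ⟪Θ, u⟫ = ‖u‖ ^ 2 := by
    have : Θ = u + (⟪g, Θ⟫ / ‖g‖ ^ 2) • g := by rw [hu]; abel
    conv_lhs => rw [this]
    rw [inner_add_left, real_inner_smul_left, hgu, mul_zero, add_zero, real_inner_self_eq_norm_sq]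
  -- For every real `s` the direction `-g + s u` leads into `Ω`. Since `⟪Θ, u⟫ = ‖u‖²`, arbitrarily
  -- large `s` force `u = 0`, so `Θ` is a multiple of the gradient.
  have hdirs : ∀ s : ℝ, s * ‖u‖ ^ 2 ≤ ⟪g, Θ⟫ := by
    intro s
    have h1 := hdir (-g + s • u) (by
      rw [inner_add_right, inner_neg_right, inner_smul_right, hgu, real_inner_self_eq_norm_sq]
      have : 0 < ‖g‖ ^ 2 := by positivity
      linarith)
    rw [inner_add_right, inner_neg_right, inner_smul_right, hΘu, real_inner_comm] at h1
    linarith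
  have hu0 : u = 0 := by
    by_contra hne
    have hpos : 0 < ‖u‖ ^ 2 := by have := norm_pos_iff.2 hne; positivity
    have h1 := hdirs ((⟪g, Θ⟫ + 1) / ‖u‖ ^ 2)
    rw [div_mul_cancel₀ _ hpos.ne'] at h1
    linarith
  have hnn : 0 ≤ ⟪g, Θ⟫ := by simpa using hdirs 0
  have hΘg : Θ = (⟪g, Θ⟫ / ‖g‖ ^ 2) • g := sub_eq_zero.1 (hu ▸ hu0)
  refine ⟨hF0, ?_⟩
  have hnorm : ⟪g, Θ⟫ / ‖g‖ ^ 2 * ‖g‖ = 1 := by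
    have := congrArg norm hΘg
    rw [hΘ, norm_smul, Real.norm_of_nonneg (by positivity)] at this
    exact this.symm
  rw [← eq_inv_of_mul_eq_one_left hnorm]
  exact hΘg

lemma exists_growth_inner (H : IsStrictGraph Ω n p₀ F r κ) (hΩ : IsCompact Ω)
    (hconv : Convex ℝ Ω) (hF0 : F p₀ = 0) :
    ∃ c, 0 < c ∧ ∀ x ∈ Ω, c * ‖x - p₀‖ ^ 2 ≤ ⟪‖gradient F p₀‖⁻¹ • gradient F p₀, p₀ - x⟫ := by
  obtain ⟨c, hc, h⟩ := H.exists_growth hΩ hconv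
  have hg := H.one_le_norm_gradient p₀
  have hg0 : 0 < ‖gradient F p₀‖ := by linarith
  refine ⟨c / ‖gradient F p₀‖, by positivity, fun x hx => ?_⟩
  have h1 := h p₀ (Metric.mem_ball_self (by linarith [H.r_pos])) hF0 x hx
  rw [H.tangentPhase_eq_inner, ← div_le_iff₀' hg0] at h1
  rwa [div_mul_eq_mul_div]

/-- Quadratic growth at `p₀` and maximality of `p` for `Θ` give `c ‖p - p₀‖² ≤ ⟪Θ₀, p₀ - p⟫ ≤ ⟪Θ -
Θ₀, p - p₀⟫`, hence `c ‖p - p₀‖ ≤ ‖Θ - Θ₀‖`. -/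
lemma eventually_isMaxOn_mem_ball (H : IsStrictGraph Ω n p₀ F r κ) (hΩ : IsCompact Ω)
    (hconv : Convex ℝ Ω) (hF0 : F p₀ = 0) (hp₀ : p₀ ∈ Ω) {ε : ℝ} (hε : 0 < ε) :
    ∀ᶠ Θ in 𝓝 (‖gradient F p₀‖⁻¹ • gradient F p₀), ∀ p ∈ Ω, (∀ x ∈ Ω, ⟪Θ, x⟫ ≤ ⟪Θ, p⟫) →
      p ∈ Metric.ball p₀ ε := by
  obtain ⟨c, hc, h⟩ := H.exists_growth_inner hΩ hconv hF0
  set Θ₀ := ‖gradient F p₀‖⁻¹ • gradient F p₀ with hΘ₀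
  filter_upwards [Metric.ball_mem_nhds Θ₀ (ε := c * ε) (by positivity)] with Θ hΘ p hp hmax
  rw [mem_ball_iff_norm] at hΘ ⊢
  have h1 := h p hp
  have h2 := hmax p₀ hp₀
  have h3 : ⟪Θ₀, p₀ - p⟫ ≤ ⟪Θ - Θ₀, p - p₀⟫ := by
    simp only [inner_sub_left, inner_sub_right]
    linarith
  have h4 := real_inner_le_norm (Θ - Θ₀) (p - p₀)
  rcases eq_or_lt_of_le (norm_nonneg (p - p₀)) with h0 | h0
  · rw [← h0]; exact hε
  · have h5 : c * ‖p - p₀‖ ≤ ‖Θ - Θ₀‖ := by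
      refine le_of_mul_le_mul_right ?_ h0
      calc c * ‖p - p₀‖ * ‖p - p₀‖ = c * ‖p - p₀‖ ^ 2 := by ring
        _ ≤ _ := by linarith
    have h6 : c * ‖p - p₀‖ < c * ε := by linarith
    exact lt_of_mul_lt_mul_left h6 hc.le

lemma eq_of_isMaxOn (H : IsStrictGraph Ω n p₀ F r κ) (hΩ : IsCompact Ω)
    (hconv : Convex ℝ Ω) (hF0 : F p₀ = 0) (hp₀ : p₀ ∈ Ω) {p : E} (hp : p ∈ Ω)
    (hmax : ∀ x ∈ Ω, ⟪‖gradient F p₀‖⁻¹ • gradient F p₀, x⟫ ≤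
      ⟪‖gradient F p₀‖⁻¹ • gradient F p₀, p⟫) : p = p₀ := by
  by_contra hne
  have h := (H.eventually_isMaxOn_mem_ball hΩ hconv hF0 hp₀
    (norm_pos_iff.2 (sub_ne_zero.2 hne))).self_of_nhds p hp hmax
  rw [mem_ball_iff_norm] at h
  exact lt_irrefl _ h

end IsStrictGraph

end Poles

/-! ### Rapid decay away from the poles. -/

section Nonstationary

variable {E : Type*} [NormedAddCommGroup E] [InnerProductSpace ℝ E]
variable {Ω : Set E}

lemma symbolBound_of_contDiff (hΩ : IsCompact Ω) {ι : Type*} {U : Set E} {V : E → E}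
    (hV : ContDiff ℝ ∞ V) (k : ℕ) {g : E → ℂ} (hg : ContDiff ℝ ∞ g) :
    SymbolBound (fun _ : ι => V) (fun _ => Ω ∩ U) k (fun _ _ => 1) (fun _ => g) := by
  have key : ∀ g : E → ℂ, ContDiff ℝ ∞ g →
      ∃ C, 0 ≤ C ∧ ∀ _ : ι, ∀ x ∈ Ω ∩ U, ‖g x‖ ≤ C * 1 := by
    intro g hg
    obtain ⟨C, hC⟩ := hΩ.exists_bound_of_continuousOn hg.continuous.continuousOn
    exact ⟨max C 0, le_max_right _ _, fun _ x hx => by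
      rw [mul_one]; exact (hC x hx.1).trans (le_max_left _ _)⟩
  induction k generalizing g with
  | zero => exact key g hg
  | succ k ih => exact ⟨key g hg, ih (hg.dirDeriv hV)⟩

lemma dirDeriv_inner_left (V : E → E) (Θ x : E) : dirDeriv V (fun x => ⟪Θ, x⟫) x = ⟪Θ, V x⟫ := by
  have : HasFDerivAt (fun x => ⟪Θ, x⟫) (innerSL ℝ Θ) x := (innerSL ℝ Θ).hasFDerivAt
  rw [dirDeriv, this.fderiv]
  rfl

variable [FiniteDimensional ℝ E] [MeasurableSpace E] [BorelSpace E]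

/-- Rapid decay of the Fourier transform in directions that are not normal to the boundary. -/
theorem exists_norm_integral_nonstationary_le (hΩ : IsCompact Ω) {U : Set E} {V : E → E}
    (hT : TangentTo Ω U V) (hV : ContDiff ℝ ∞ V) {S : Set E} (hS : ∀ Θ ∈ S, ‖Θ‖ ≤ 1) {c : ℝ}
    (hc : 0 < c) (hD : ∀ Θ ∈ S, ∀ x ∈ Ω ∩ U, c ≤ |⟪Θ, V x⟫|) {φ : E → ℂ}
    (hφ : ContDiff ℝ ∞ φ) (hφs : HasCompactSupport φ) (hφU : tsupport φ ⊆ U) (N : ℕ) :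
    ∃ C, 0 ≤ C ∧ ∀ Θ ∈ S, ∀ σ : ℝ, 0 < σ →
      ‖∫ x in Ω, φ x * Complex.exp (Complex.I * σ * (⟪Θ, x⟫ : ℝ))‖ ≤ C * (σ ^ N)⁻¹ := by
  have hu : ∀ Θ : E, ContDiff ℝ ∞ (fun x => ⟪Θ, x⟫) := fun Θ =>
    contDiff_const.inner ℝ contDiff_id
  let ι := S × Ioi (0:ℝ)
  have hpf : ∀ (i : ι) x, phaseFactor V (fun x => ⟪(i.1 : E), x⟫) ((i.2 : ℝ) : ℂ) x =
      1 - ((i.2 * ⟪(i.1 : E), V x⟫ : ℝ) : ℂ) * Complex.I := by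
    intro i x
    rw [phaseFactor, dirDeriv_inner_left]
    push_cast
    ring
  have hnorm : ∀ (i : ι) x, x ∈ Ω ∩ U →
      (i.2 : ℝ) * c ≤ ‖phaseFactor V (fun x => ⟪(i.1 : E), x⟫) ((i.2 : ℝ) : ℂ) x‖ := by
    intro i x hx
    rw [hpf]
    refine le_trans ?_ (Complex.abs_im_le_norm _)
    have h2 : 0 < (i.2 : ℝ) := i.2.2
    simp only [Complex.sub_im, Complex.one_im, Complex.im_ofReal_mul,
      Complex.I_im, mul_one, zero_sub, abs_neg, abs_mul, abs_of_pos h2]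
    exact mul_le_mul_of_nonneg_left (hD _ i.1.2 x hx) h2.le
  obtain ⟨C, hC, h⟩ := exists_norm_integral_cexp_le (ι := ι) hΩ (U := fun _ => U)
    (V := fun _ => V) (u := fun i x => ⟪(i.1 : E), x⟫) (s := fun i => ((i.2 : ℝ) : ℂ))
    (φ := fun _ => φ) (w := fun _ _ => 1) (wD := fun _ _ => 1) (fun _ => hT) (fun _ => hV)
    (fun i => hu _) (fun i x => by
      rw [hpf]
      intro h0
      have := congrArg Complex.re h0
      simp at this)
    (fun _ => hφ) (fun _ => hφs) (fun _ => hφU) (fun i x _ => by simp)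
    (fun k => symbolBound_of_contDiff hΩ hV k hV.divergence.complex_ofReal)
    (fun k => by
      simp only [dirDeriv_inner_left]
      -- Expanding `⟪Θ, V x⟫` in a basis separates the bounded coefficients depending on `Θ` from
      -- fixed smooth functions, so the symbol bounds are uniform in `Θ`.
      have hb := fun a => (symbolBound_of_contDiff (ι := ι) (U := U) hΩ hV k
        (g := fun x => ((⟪stdOrthonormalBasis ℝ E a, V x⟫ : ℝ) : ℂ))
        (contDiff_const.inner ℝ hV).complex_ofReal).const_mul
        (fun i => ((⟪(i.1 : E), stdOrthonormalBasis ℝ E a⟫ : ℝ) : ℂ))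
        ⟨1, fun i => by
          rw [Complex.norm_real]
          refine (norm_inner_le_norm _ _).trans ?_
          rw [(stdOrthonormalBasis ℝ E).norm_eq_one, mul_one]
          exact hS _ i.1.2⟩
        (fun _ => (contDiff_const.inner ℝ hV).complex_ofReal) (fun _ => hV)
      have hsum := SymbolBound.sum Finset.univ (fun a _ => hb a)
        (fun a i => contDiff_const.mul (contDiff_const.inner ℝ hV).complex_ofReal) (fun _ => hV)
      convert! hsum using 3 with i x
      rw [← OrthonormalBasis.sum_inner_mul_inner (stdOrthonormalBasis ℝ E)]
      push_cast
      rfl)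
    ⟨c⁻¹, by positivity, fun i x hx => by
      have h2 : 0 < (i.2 : ℝ) := i.2.2
      rw [Complex.norm_real, Real.norm_of_nonneg h2.le, mul_one, inv_mul_eq_div,
        le_div_iff₀ hc]
      exact hnorm i x hx⟩
    (fun k => symbolBound_of_contDiff hΩ hV k hφ) N
  refine ⟨C * ((c⁻¹) ^ N * volume.real Ω), by positivity, fun Θ hΘ σ hσ => ?_⟩
  have h1 := h (fun i _ => ((i.2 : ℝ) ^ N)⁻¹ * c⁻¹ ^ N)
    (fun i => integrableOn_const hΩ.measure_lt_top.ne)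
    (fun i x _ => by
      have h2 : 0 < (i.2 : ℝ) := i.2.2
      positivity)
    (fun i x hx => by
      have h2 : 0 < (i.2 : ℝ) := i.2.2
      rw [one_mul, norm_inv, ← inv_pow, ← mul_pow, ← mul_inv]
      gcongr
      exact hnorm i x hx)
    (⟨Θ, hΘ⟩, ⟨σ, hσ⟩)
  rw [setIntegral_const, smul_eq_mul] at h1
  calc _ ≤ _ := h1
    _ = _ := by ring

/-- In the interior or the exterior the constant field `Θ₀` works, with a constant defining
function. At a boundary point with gradient `g`, the field `|∇F|² Θ₀ - ⟪Θ₀, ∇F⟫ ∇F` annihilates `F`,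
and its product with `Θ₀` is `‖g‖² - ⟪Θ₀, g⟫²`. This vanishes only if `Θ₀` is plus or minus the unit
normal, and then growth would make `x₀` a maximum or a minimum point. -/
lemma exists_tangentTo_pos (hΩ : IsCompact Ω) (hconv : Convex ℝ Ω) {Θ₀ x₀ : E} (hΘ₀ : ‖Θ₀‖ = 1)
    (hgraph : x₀ ∈ frontier Ω → ∃ n F r κ, IsStrictGraph Ω n x₀ F r κ ∧ F x₀ = 0)
    (hmax : ∃ x ∈ Ω, ⟪Θ₀, x₀⟫ < ⟪Θ₀, x⟫) (hmin : ∃ x ∈ Ω, ⟪Θ₀, x⟫ < ⟪Θ₀, x₀⟫) :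
    ∃ U V, IsOpen U ∧ x₀ ∈ U ∧ ContDiff ℝ ∞ V ∧ TangentTo Ω U V ∧ 0 < ⟪Θ₀, V x₀⟫ := by
  have hconst : ∀ (U : Set E) (a : ℝ), (∀ x ∈ U, x ∈ Ω ↔ a ≤ 0) →
      TangentTo Ω U (fun _ => Θ₀) := fun U a h =>
    tangentTo_of_dirDeriv_eq hΩ.measurableSet contDiff_const (F := fun _ => a) contDiff_const 0 h
      fun x _ => by simp [dirDeriv]
  have hpos : 0 < ⟪Θ₀, Θ₀⟫ := by rw [real_inner_self_eq_norm_sq, hΘ₀]; norm_num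
  by_cases hx : x₀ ∈ frontier Ω
  · obtain ⟨n, F, r, κ, H, hF0⟩ := hgraph hx
    have hgs : ContDiff ℝ ∞ (gradient F) :=
      (InnerProductSpace.toDual ℝ E).symm.contDiff.comp H.graph.contDiff_fderiv
    have hgrow := H.exists_growth_inner hΩ hconv hF0
    have hg1 := H.one_le_norm_gradient x₀
    have hg0 : 0 < ‖gradient F x₀‖ := by linarith
    refine ⟨Metric.ball x₀ r, fun x => ‖gradient F x‖ ^ 2 • Θ₀ - ⟪Θ₀, gradient F x⟫ • gradient F x,
      Metric.isOpen_ball, Metric.mem_ball_self H.r_pos,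
      ((hgs.norm_sq ℝ).smul contDiff_const).sub ((contDiff_const.inner ℝ hgs).smul hgs), ?_, ?_⟩
    · refine tangentTo_of_dirDeriv_eq hΩ.measurableSet
        (((hgs.norm_sq ℝ).smul contDiff_const).sub ((contDiff_const.inner ℝ hgs).smul hgs))
        H.graph.contDiff 0 H.mem_iff fun x _ => ?_
      rw [dirDeriv, fderiv_apply_eq_inner_gradient, inner_sub_right, inner_smul_right,
        inner_smul_right, real_inner_self_eq_norm_sq, real_inner_comm]
      ring
    · set g := gradient F x₀ with hg
      rw [inner_sub_right, inner_smul_right, inner_smul_right, real_inner_self_eq_norm_sq, hΘ₀]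
      have hne1 : ⟪Θ₀, g⟫ ≠ ‖g‖ := by
        intro h
        have h1 := (inner_eq_norm_mul_iff_real (x := Θ₀) (y := g)).1 (by rw [h, hΘ₀, one_mul])
        rw [hΘ₀, one_smul] at h1
        have h2 : ‖g‖⁻¹ • g = Θ₀ := by rw [inv_smul_eq_iff₀ hg0.ne', h1]
        obtain ⟨c, hc, h3⟩ := hgrow
        obtain ⟨x, hx, hlt⟩ := hmax
        have h4 := h3 x hx
        rw [h2, inner_sub_right] at h4
        have : 0 ≤ c * ‖x - x₀‖ ^ 2 := by positivity
        linarith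
      have hne2 : ⟪Θ₀, g⟫ ≠ -‖g‖ := by
        intro h
        have h1 := (inner_eq_norm_mul_iff_real (x := -Θ₀) (y := g)).1
          (by rw [inner_neg_left, h, norm_neg, hΘ₀, one_mul, neg_neg])
        rw [norm_neg, hΘ₀, one_smul] at h1
        have h2 : ‖g‖⁻¹ • g = -Θ₀ := by rw [inv_smul_eq_iff₀ hg0.ne', h1]
        obtain ⟨c, hc, h3⟩ := hgrow
        obtain ⟨x, hx, hlt⟩ := hmin
        have h4 := h3 x hx
        rw [h2, inner_sub_right, inner_neg_left, inner_neg_left] at h4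
        have : 0 ≤ c * ‖x - x₀‖ ^ 2 := by positivity
        linarith
      have hle := abs_real_inner_le_norm Θ₀ g
      rw [hΘ₀, one_mul, abs_le] at hle
      have h1 : ⟪Θ₀, g⟫ < ‖g‖ := lt_of_le_of_ne hle.2 hne1
      have h2 : -‖g‖ < ⟪Θ₀, g⟫ := lt_of_le_of_ne hle.1 hne2.symm
      nlinarith
  · by_cases hxi : x₀ ∈ interior Ω
    · exact ⟨interior Ω, fun _ => Θ₀, isOpen_interior, hxi, contDiff_const,
        hconst _ (-1) fun x hx => iff_of_true (interior_subset hx) (by norm_num), hpos⟩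
    · have hxΩ : x₀ ∉ Ω := fun h => hx ⟨subset_closure h, hxi⟩
      exact ⟨Ωᶜ, fun _ => Θ₀, hΩ.isClosed.isOpen_compl, hxΩ, contDiff_const,
        hconst _ 1 fun x hx => iff_of_false hx (by norm_num), hpos⟩

/-- Points that are not poles contribute rapidly decaying terms. -/
theorem exists_nhds_rapid_decay (hΩ : IsCompact Ω) (hconv : Convex ℝ Ω) {Θ₀ x₀ : E}
    (hΘ₀ : ‖Θ₀‖ = 1)
    (hgraph : x₀ ∈ frontier Ω → ∃ n F r κ, IsStrictGraph Ω n x₀ F r κ ∧ F x₀ = 0)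
    (hmax : ∃ x ∈ Ω, ⟪Θ₀, x₀⟫ < ⟪Θ₀, x⟫) (hmin : ∃ x ∈ Ω, ⟪Θ₀, x⟫ < ⟪Θ₀, x₀⟫) :
    ∃ W : Set E, IsOpen W ∧ x₀ ∈ W ∧ ∃ O ∈ 𝓝 Θ₀, ∀ φ : E → ℂ, ContDiff ℝ ∞ φ →
      HasCompactSupport φ → tsupport φ ⊆ W → ∀ N : ℕ, ∃ C, 0 ≤ C ∧
      ∀ Θ ∈ O, ‖Θ‖ = 1 → ∀ σ : ℝ, 0 < σ →
        ‖∫ x in Ω, φ x * Complex.exp (-(2 * Real.pi * Complex.I * σ * (⟪Θ, x⟫ : ℝ)))‖ ≤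
          C * (σ ^ N)⁻¹ := by
  obtain ⟨U, V, hU, hxU, hV, hT, hpos⟩ := exists_tangentTo_pos hΩ hconv hΘ₀ hgraph hmax hmin
  have hc : Continuous (fun q : E × E => ⟪q.1, V q.2⟫) :=
    continuous_fst.inner (hV.continuous.comp continuous_snd)
  have hev : ∀ᶠ q in 𝓝 (Θ₀, x₀), ⟪Θ₀, V x₀⟫ / 2 < ⟪q.1, V q.2⟫ :=
    hc.continuousAt.eventually_const_lt (by simpa using hpos)
  rw [nhds_prod_eq, Filter.eventually_prod_iff] at hev
  obtain ⟨P, hP, Q, hQ, hPQ⟩ := hev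
  obtain ⟨W, hWQ, hW, hxW⟩ := mem_nhds_iff.1 hQ
  refine ⟨U ∩ W, hU.inter hW, ⟨hxU, hxW⟩, {Θ | P Θ}, hP, fun φ hφ hφs hφU N => ?_⟩
  -- That bound has the opposite sign in the exponent, so it is used for `-Θ` and the frequency
  -- `2πσ`.
  obtain ⟨C, hC, h⟩ := exists_norm_integral_nonstationary_le hΩ (U := U ∩ W) (V := V)
    (fun ψ h1 h2 h3 => hT ψ h1 h2 (h3.trans inter_subset_left)) hV
    (S := {Θ | ‖Θ‖ = 1 ∧ P (-Θ)}) (fun Θ hΘ => hΘ.1.le) (half_pos hpos)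
    (fun Θ hΘ x hx => by
      have h1 := hPQ hΘ.2 (hWQ hx.2.2)
      rw [← abs_neg, ← inner_neg_left]
      exact h1.le.trans (le_abs_self _)) hφ hφs hφU N
  refine ⟨C * ((2 * Real.pi) ^ N)⁻¹, by positivity, fun Θ hΘ hΘ1 σ hσ => ?_⟩
  have h1 := h (-Θ) ⟨by rwa [norm_neg], by simpa using hΘ⟩ (2 * Real.pi * σ) (by positivity)
  rw [mul_pow, mul_inv, ← mul_assoc] at h1
  convert! h1 using 3
  funext x
  congr 2
  rw [inner_neg_left]
  push_cast
  ring

end Nonstationary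

/-! ### Two oscillations with different frequencies do not cancel. -/

section TwoOscillations

lemma norm_cexp_neg_two_pi_I (s α : ℝ) :
    ‖Complex.exp (-(2 * Real.pi * Complex.I * s * α))‖ = 1 := by
  rw [show -(2 * Real.pi * Complex.I * s * α) = ((-(2 * Real.pi * s * α) : ℝ) : ℂ) * Complex.I by
    push_cast; ring]
  exact Complex.norm_exp_ofReal_mul_I _

/-- Two slowly varying oscillations with different frequencies cannot cancel on a whole interval
of length one. -/
lemma exists_le_integral_norm_sq {a c C R₀ b δ : ℝ} (ha : 0 ≤ a) (hc : 0 < c) (hC : 0 ≤ C)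
    (hR₀ : 1 ≤ R₀) (hb : 0 < b) (hδ : 0 < δ) (hδ' : δ ≤ 1 / 2) :
    ∃ c' R₁, 0 < c' ∧ 1 ≤ R₁ ∧ ∀ (X A B A' B' : ℝ → ℂ) (α β : ℝ), Continuous X →
      (∀ σ, R₀ ≤ σ → HasDerivAt A (A' σ) σ ∧ c * σ ^ (-a) ≤ ‖A σ‖ ∧
        ‖A' σ‖ ≤ C * σ⁻¹ * σ ^ (-a)) →
      (∀ σ, R₀ ≤ σ → HasDerivAt B (B' σ) σ ∧ ‖B' σ‖ ≤ C * σ⁻¹ * σ ^ (-a)) →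
      (∀ σ, R₀ ≤ σ → ‖X σ - (Complex.exp (-(2 * Real.pi * Complex.I * σ * α)) * A σ +
        Complex.exp (-(2 * Real.pi * Complex.I * σ * β)) * B σ)‖ ≤ C * σ⁻¹ * σ ^ (-a)) →
      b ≤ ‖Complex.exp (-(2 * Real.pi * Complex.I * δ * α)) -
        Complex.exp (-(2 * Real.pi * Complex.I * δ * β))‖ →
      ∀ ρ, R₁ ≤ ρ → c' * ρ ^ (-(2 * a)) ≤ ∫ σ in ρ..(ρ + 1), ‖X σ‖ ^ 2 := by
  set k := b * c / 2 with hk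
  have hk0 : 0 < k := by positivity
  refine ⟨k ^ 2 / 8 * 2 ^ (-(2 * a)), max R₀ (8 * C / (b * c)), by positivity,
    hR₀.trans (le_max_left _ _), ?_⟩
  intro X A B A' B' α β hX hA hB hE hsep ρ hρ
  have hρ0 : R₀ ≤ ρ := (le_max_left _ _).trans hρ
  have hmono : ∀ σ s, R₀ ≤ σ → σ ≤ s → C * s⁻¹ * s ^ (-a) ≤ C * σ⁻¹ * σ ^ (-a) := by
    intro σ s h1 h2
    have h3 : 0 < σ := by linarith
    have h4 : s ^ (-a) ≤ σ ^ (-a) := Real.rpow_le_rpow_of_nonpos h3 h2 (by linarith)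
    have h5 : 0 ≤ s ^ (-a) := Real.rpow_nonneg (by linarith) _
    gcongr
  have hvar : ∀ (G G' : ℝ → ℂ), (∀ σ, R₀ ≤ σ → HasDerivAt G (G' σ) σ ∧
      ‖G' σ‖ ≤ C * σ⁻¹ * σ ^ (-a)) → ∀ σ, R₀ ≤ σ →
      ‖G (σ + δ) - G σ‖ ≤ C * σ⁻¹ * σ ^ (-a) := by
    intro G G' hG σ hσ
    have h1 := norm_image_sub_le_of_norm_deriv_le_segment' (f := G) (f' := G') (a := σ)
      (b := σ + δ) (C := C * σ⁻¹ * σ ^ (-a))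
      (fun s hs => (hG s (hσ.trans hs.1)).1.hasDerivWithinAt)
      (fun s hs => (hG s (hσ.trans hs.1)).2.trans (hmono σ s hσ hs.1)) (σ + δ)
      ⟨by linarith, le_rfl⟩
    refine h1.trans ?_
    have h0 : 0 < σ := by linarith
    have : 0 ≤ C * σ⁻¹ * σ ^ (-a) := by positivity
    nlinarith
  have hkey : ∀ σ, ρ ≤ σ → k * σ ^ (-a) ≤ ‖X σ‖ + ‖X (σ + δ)‖ := by
    intro σ hσ
    have hσR : R₀ ≤ σ := hρ0.trans hσ
    have hσ0 : 0 < σ := by linarith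
    have hσδ : R₀ ≤ σ + δ := by linarith
    set Y := C * σ⁻¹ * σ ^ (-a) with hY
    have e1 := hvar A A' (fun σ hσ => ⟨(hA σ hσ).1, (hA σ hσ).2.2⟩) σ hσR
    have e2 := hvar B B' hB σ hσR
    have e3 := hE σ hσR
    have e4 := (hE (σ + δ) hσδ).trans (hmono σ (σ + δ) hσR (by linarith))
    have e5 := (hA σ hσR).2.1
    set u := Complex.exp (-(2 * Real.pi * Complex.I * σ * α)) with hu
    set v := Complex.exp (-(2 * Real.pi * Complex.I * σ * β)) with hv
    set f := Complex.exp (-(2 * Real.pi * Complex.I * δ * α)) with hf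
    set g := Complex.exp (-(2 * Real.pi * Complex.I * δ * β)) with hg
    have hu1 : ‖u‖ = 1 := norm_cexp_neg_two_pi_I _ _
    have hv1 : ‖v‖ = 1 := norm_cexp_neg_two_pi_I _ _
    have hf1 : ‖f‖ = 1 := norm_cexp_neg_two_pi_I _ _
    have hg1 : ‖g‖ = 1 := norm_cexp_neg_two_pi_I _ _
    have huf : Complex.exp (-(2 * Real.pi * Complex.I * (σ + δ : ℝ) * α)) = u * f := by
      rw [hu, hf, ← Complex.exp_add]; congr 1; push_cast; ring
    have hvg : Complex.exp (-(2 * Real.pi * Complex.I * (σ + δ : ℝ) * β)) = v * g := by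
      rw [hv, hg, ← Complex.exp_add]; congr 1; push_cast; ring
    rw [huf, hvg] at e4
    set P := X σ - (u * A σ + v * B σ) with hP
    set Q := X (σ + δ) - (u * f * A (σ + δ) + v * g * B (σ + δ)) with hQ
    -- Subtracting `g X(σ)` from `X(σ + δ)` removes `B` except for its increment. The two increments
    -- and the two errors `P`, `Q` are each at most `Y`.
    have hid : u * (f - g) * A σ = X (σ + δ) - g * X σ - u * f * (A (σ + δ) - A σ) -
        v * g * (B (σ + δ) - B σ) - Q + g * P := by rw [hP, hQ]; ring
    have h1 : ‖u * (f - g) * A σ‖ = ‖f - g‖ * ‖A σ‖ := by rw [norm_mul, norm_mul, hu1, one_mul]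
    have h2 : ‖u * (f - g) * A σ‖ ≤ ‖X (σ + δ)‖ + ‖X σ‖ + Y + Y + Y + Y := by
      rw [hid]
      refine (norm_add_le _ _).trans (add_le_add ((norm_sub_le _ _).trans (add_le_add
        ((norm_sub_le _ _).trans (add_le_add ((norm_sub_le _ _).trans (add_le_add
        ((norm_sub_le _ _).trans (add_le_add le_rfl ?_)) ?_)) ?_)) e4)) ?_)
      · rw [norm_mul, hg1, one_mul]
      · rwa [norm_mul, norm_mul, hu1, hf1, one_mul, one_mul]
      · rwa [norm_mul, norm_mul, hv1, hg1, one_mul, one_mul]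
      · rwa [norm_mul, hg1, one_mul]
    have h3 : b * (c * σ ^ (-a)) ≤ ‖f - g‖ * ‖A σ‖ := by gcongr
    -- The threshold `8 C / (b c)` is where the four errors drop to half of the main term.
    have h4 : 4 * Y ≤ k * σ ^ (-a) := by
      have h5 : 8 * C / (b * c) ≤ σ := ((le_max_right _ _).trans hρ).trans hσ
      rw [div_le_iff₀ (by positivity)] at h5
      calc 4 * Y = (8 * C) * σ⁻¹ * σ ^ (-a) / 2 := by rw [hY]; ring
        _ ≤ (σ * (b * c)) * σ⁻¹ * σ ^ (-a) / 2 := by gcongr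
        _ = k * σ ^ (-a) := by rw [hk]; field_simp
    have h6 : b * (c * σ ^ (-a)) = 2 * (k * σ ^ (-a)) := by rw [hk]; ring
    linarith
  have hρpos : 0 < ρ := by linarith
  set m := k ^ 2 / 2 * (2 * ρ) ^ (-(2 * a)) with hm
  have hpt : ∀ σ ∈ Icc ρ (ρ + 1 / 2), m ≤ ‖X σ‖ ^ 2 + ‖X (σ + δ)‖ ^ 2 := by
    intro σ hσ
    have hσ0 : 0 < σ := by linarith [hσ.1]
    have h1 := hkey σ hσ.1
    have h2 : 0 ≤ k * σ ^ (-a) := by positivity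
    have h3 : (k * σ ^ (-a)) ^ 2 ≤ (‖X σ‖ + ‖X (σ + δ)‖) ^ 2 := by gcongr
    have h4 : (k * σ ^ (-a)) ^ 2 = k ^ 2 * σ ^ (-(2 * a)) := by
      rw [mul_pow, ← Real.rpow_natCast (σ ^ (-a)), ← Real.rpow_mul hσ0.le]
      congr 2; push_cast; ring
    have h5 : (2 * ρ) ^ (-(2 * a)) ≤ σ ^ (-(2 * a)) :=
      Real.rpow_le_rpow_of_nonpos hσ0 (by linarith [hσ.2]) (by linarith)
    have h6 : k ^ 2 * (2 * ρ) ^ (-(2 * a)) ≤ k ^ 2 * σ ^ (-(2 * a)) := by gcongr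
    have h7 := sq_nonneg (‖X σ‖ - ‖X (σ + δ)‖)
    rw [hm]
    nlinarith
  have hcs : Continuous fun σ => ‖X σ‖ ^ 2 := by fun_prop
  have hii : ∀ u v : ℝ, IntervalIntegrable (fun σ => ‖X σ‖ ^ 2) volume u v :=
    fun u v => hcs.intervalIntegrable u v
  have hcs' : Continuous fun σ => ‖X (σ + δ)‖ ^ 2 := by fun_prop
  have hsub : ∀ u v : ℝ, ρ ≤ u → u ≤ v → v ≤ ρ + 1 →
      ∫ σ in u..v, ‖X σ‖ ^ 2 ≤ ∫ σ in ρ..(ρ + 1), ‖X σ‖ ^ 2 := fun u v h1 h2 h3 =>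
    intervalIntegral.integral_mono_interval h1 h2 h3
      (Eventually.of_forall fun σ => by positivity) (hii _ _)
  have h1 : ∫ _ in ρ..(ρ + 1 / 2), m ≤
      ∫ σ in ρ..(ρ + 1 / 2), (‖X σ‖ ^ 2 + ‖X (σ + δ)‖ ^ 2) :=
    intervalIntegral.integral_mono_on (by linarith) (by simp)
      ((hcs.add hcs').intervalIntegrable _ _) hpt
  rw [intervalIntegral.integral_add (hii _ _) (hcs'.intervalIntegrable _ _),
    intervalIntegral.integral_comp_add_right (fun σ => ‖X σ‖ ^ 2) δ,
    intervalIntegral.integral_const, smul_eq_mul, add_sub_cancel_left] at h1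
  have h2 := hsub ρ (ρ + 1 / 2) le_rfl (by linarith) (by linarith)
  -- As `δ ≤ 1 / 2`, the interval of length `1 / 2` and its translate both lie in `[ρ, ρ + 1]`, so
  -- their contributions sum to at most twice the whole integral.
  have h3 := hsub (ρ + δ) (ρ + 1 / 2 + δ) (by linarith) (by linarith) (by linarith)
  have h4 : m = k ^ 2 / 2 * (2 ^ (-(2 * a)) * ρ ^ (-(2 * a))) := by
    rw [hm, Real.mul_rpow (by norm_num) hρpos.le]
  rw [h4] at h1
  linarith

end TwoOscillations

/-! ### Contributions of the two poles for directions near a given one. -/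

section Pole

variable {E : Type*} [NormedAddCommGroup E] [InnerProductSpace ℝ E] [FiniteDimensional ℝ E]
  [MeasurableSpace E] [BorelSpace E] {Ω : Set E}

/-- The contribution of a boundary point to the Fourier transform in directions close to the
normal. -/
lemma IsStrictGraph.exists_cutoff_bounds {n p₀ : E} {F : E → ℝ} {r κ : ℝ}
    (H : IsStrictGraph Ω n p₀ F r κ) (hΩ : IsCompact Ω) (hconv : Convex ℝ Ω) (hF0 : F p₀ = 0)
    (hp₀ : p₀ ∈ Ω) {Θ₀ : E} (hΘ₀ : Θ₀ = ‖gradient F p₀‖⁻¹ • gradient F p₀) {ε : ℝ} (hε : 0 < ε) :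
    ∃ η : E → ℝ, ContDiff ℝ ∞ η ∧ tsupport η ⊆ Metric.ball p₀ ε ∧ (∀ᶠ x in 𝓝 p₀, η x = 1) ∧
      ∃ c C R₀, 0 < c ∧ 0 ≤ C ∧ 1 ≤ R₀ ∧ ∀ ε' > 0, ∀ᶠ Θ in 𝓝 Θ₀, ‖Θ‖ = 1 → ∀ p ∈ Ω,
        (∀ x ∈ Ω, ⟪Θ, x⟫ ≤ ⟪Θ, p⟫) → p ∈ Metric.ball p₀ ε' ∧ ∃ A A' : ℝ → ℂ, ∀ σ, R₀ ≤ σ →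
        (HasDerivAt A (A' σ) σ ∧
          c * σ ^ (-(((Module.finrank ℝ E : ℝ) + 1) / 2)) ≤ ‖A σ‖ ∧
          ‖A' σ‖ ≤ C * σ⁻¹ * σ ^ (-(((Module.finrank ℝ E : ℝ) + 1) / 2))) ∧
        ∫ x in Ω, (η x : ℂ) * Complex.exp (-(2 * Real.pi * Complex.I * σ * (⟪Θ, x⟫ : ℝ))) =
          Complex.exp (-(2 * Real.pi * Complex.I * σ * (⟪Θ, p⟫ : ℝ))) * A σ := by
  have hr := H.r_pos
  set m := min r ε with hm
  have hm0 : 0 < m := lt_min hr hε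
  let χ : ContDiffBump p₀ := ⟨m / 4, m / 2, by positivity, by linarith⟩
  have hsupp : tsupport χ ⊆ Metric.ball p₀ m := by
    rw [χ.tsupport_eq]
    exact Metric.closedBall_subset_ball (by simp only [χ]; linarith)
  have hone : ∀ x ∈ Metric.ball p₀ (m / 4), χ x = 1 := fun x hx =>
    χ.one_of_mem_closedBall (Metric.ball_subset_closedBall hx)
  obtain ⟨c, C, R₀, hc, hC, hR₀, h⟩ := H.exists_pole_bounds hΩ hconv χ.contDiff
    χ.hasCompactSupport (hsupp.trans (Metric.ball_subset_ball (min_le_left _ _)))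
    (fun x => χ.nonneg) (r' := m / 4) (by positivity) (by linarith [min_le_left r ε]) hone
  refine ⟨χ, χ.contDiff, hsupp.trans (Metric.ball_subset_ball (min_le_right _ _)), ?_,
    c, C, R₀, hc, hC, hR₀, fun ε' hε' => ?_⟩
  · filter_upwards [Metric.ball_mem_nhds p₀ (ε := m / 4) (by positivity)] with x hx
    exact hone x hx
  rw [hΘ₀]
  -- The radius `ε'` is the one demanded in the conclusion; `m / 4 / 2` is the range of base points
  -- for which `h` is uniform.
  filter_upwards [H.eventually_isMaxOn_mem_ball hΩ hconv hF0 hp₀ hε',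
    H.eventually_isMaxOn_mem_ball hΩ hconv hF0 hp₀ (ε := m / 4 / 2) (by positivity)]
    with Θ hΘ1 hΘ2 hΘn p hp hmax
  refine ⟨hΘ1 p hp hmax, ?_⟩
  have hpm := hΘ2 p hp hmax
  obtain ⟨hFp, hΘp⟩ := H.eq_normalized_gradient_of_isMaxOn
    (Metric.ball_subset_ball (by linarith [min_le_left r ε]) hpm) hp hmax hΘn
  obtain ⟨J', hJ⟩ := h p hpm hFp Θ hΘp
  refine ⟨_, J', fun σ hσ => ⟨hJ σ hσ, ?_⟩⟩
  rw [← integral_const_mul]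
  congr 1
  funext x
  rw [mul_left_comm, ← Complex.exp_add]
  congr 2
  rw [inner_sub_right]
  push_cast
  ring

/-- The same as `IsStrictGraph.exists_cutoff_bounds` for minimum points. -/
lemma IsStrictGraph.exists_cutoff_bounds_neg {n p₀ : E} {F : E → ℝ} {r κ : ℝ}
    (H : IsStrictGraph Ω n p₀ F r κ) (hΩ : IsCompact Ω) (hconv : Convex ℝ Ω) (hF0 : F p₀ = 0)
    (hp₀ : p₀ ∈ Ω) {Θ₀ : E} (hΘ₀ : -Θ₀ = ‖gradient F p₀‖⁻¹ • gradient F p₀) {ε : ℝ}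
    (hε : 0 < ε) :
    ∃ η : E → ℝ, ContDiff ℝ ∞ η ∧ tsupport η ⊆ Metric.ball p₀ ε ∧ (∀ᶠ x in 𝓝 p₀, η x = 1) ∧
      ∃ C R₀, 0 ≤ C ∧ 1 ≤ R₀ ∧ ∀ ε' > 0, ∀ᶠ Θ in 𝓝 Θ₀, ‖Θ‖ = 1 → ∀ p ∈ Ω,
        (∀ x ∈ Ω, ⟪Θ, p⟫ ≤ ⟪Θ, x⟫) → p ∈ Metric.ball p₀ ε' ∧ ∃ A A' : ℝ → ℂ, ∀ σ, R₀ ≤ σ →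
        (HasDerivAt A (A' σ) σ ∧
          ‖A' σ‖ ≤ C * σ⁻¹ * σ ^ (-(((Module.finrank ℝ E : ℝ) + 1) / 2))) ∧
        ∫ x in Ω, (η x : ℂ) * Complex.exp (-(2 * Real.pi * Complex.I * σ * (⟪Θ, x⟫ : ℝ))) =
          Complex.exp (-(2 * Real.pi * Complex.I * σ * (⟪Θ, p⟫ : ℝ))) * A σ := by
  obtain ⟨η, hη1, hη2, hη3, c, C, R₀, hc, hC, hR₀, h⟩ :=
    H.exists_cutoff_bounds hΩ hconv hF0 hp₀ hΘ₀ hε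
  refine ⟨η, hη1, hη2, hη3, C, R₀, hC, hR₀, fun ε' hε' => ?_⟩
  have hneg : Tendsto (fun Θ : E => -Θ) (𝓝 Θ₀) (𝓝 (-Θ₀)) := continuous_neg.tendsto _
  filter_upwards [hneg.eventually (h ε' hε')] with Θ hΘ hΘn p hp hmin
  obtain ⟨h1, A, A', h2⟩ := hΘ (by rwa [norm_neg]) p hp fun x hx => by
    rw [inner_neg_left, inner_neg_left]; linarith [hmin x hx]
  -- Minimum points for `Θ` are maximum points for `-Θ`, and conjugation exchanges the two
  -- exponentials. As `η` is real, the amplitude is conjugated as well.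
  have hconj : ∀ (σ : ℝ) (x : E),
      Complex.exp (-(2 * Real.pi * Complex.I * σ * (⟪Θ, x⟫ : ℝ))) =
      (starRingEnd ℂ) (Complex.exp (-(2 * Real.pi * Complex.I * σ * (⟪-Θ, x⟫ : ℝ)))) := by
    intro σ x
    rw [← Complex.exp_conj, inner_neg_left]
    congr 1
    simp only [map_neg, map_mul, Complex.conj_ofReal, Complex.conj_I, map_ofNat]
    push_cast
    ring
  refine ⟨h1, fun σ => (starRingEnd ℂ) (A σ), fun σ => (starRingEnd ℂ) (A' σ),
    fun σ hσ => ⟨⟨?_, ?_⟩, ?_⟩⟩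
  · exact Complex.conjCLE.toContinuousLinearMap.hasFDerivAt.comp_hasDerivAt σ (h2 σ hσ).1.1
  · rw [RCLike.norm_conj]
    exact (h2 σ hσ).1.2.2
  · have h3 := congrArg (starRingEnd ℂ) (h2 σ hσ).2
    rw [map_mul, ← hconj, ← integral_conj] at h3
    rw [← h3]
    congr 1
    funext x
    rw [map_mul, ← hconj, Complex.conj_ofReal]

end Pole

/-! ### The lower bound for large `ρ`, locally uniform in the direction. -/

section LocalBound

variable {E : Type*} [NormedAddCommGroup E] [InnerProductSpace ℝ E] {Ω : Set E}

lemma mem_frontier_of_isMaxOn {Θ p : E} (hΘ : Θ ≠ 0) (hp : p ∈ Ω)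
    (hmax : ∀ x ∈ Ω, ⟪Θ, x⟫ ≤ ⟪Θ, p⟫) : p ∈ frontier Ω := by
  refine ⟨subset_closure hp, fun hi => ?_⟩
  have hlim : Tendsto (fun t : ℝ => p + t • Θ) (𝓝[>] 0) (𝓝 p) := by
    have h1 : Continuous (fun t : ℝ => p + t • Θ) := by fun_prop
    have := h1.tendsto 0
    rw [zero_smul, add_zero] at this
    exact this.mono_left nhdsWithin_le_nhds
  obtain ⟨t, h1, h2⟩ := ((hlim.eventually (mem_interior_iff_mem_nhds.1 hi)).and
    self_mem_nhdsWithin).exists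
  have h3 := hmax _ h1
  have h2' : (0:ℝ) < t := h2
  rw [inner_add_right, inner_smul_right, real_inner_self_eq_norm_sq] at h3
  have : 0 < t * ‖Θ‖ ^ 2 := mul_pos h2' (pow_pos (norm_pos_iff.2 hΘ) 2)
  linarith

variable [FiniteDimensional ℝ E]

/-- A smooth partition of a cutoff function that vanishes outside of a compact set. -/
lemma exists_smooth_partition {K : Set E} (hK : IsCompact K) {W : E → Set E}
    (hW : ∀ x ∈ K, IsOpen (W x) ∧ x ∈ W x) :
    ∃ (t : Finset E) (f : E → E → ℝ), (∀ x ∈ t, x ∈ K) ∧ (∀ x ∈ t, ContDiff ℝ ∞ (f x)) ∧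
      (∀ x ∈ t, HasCompactSupport (f x)) ∧ (∀ x ∈ t, tsupport (f x) ⊆ W x) ∧
      ∀ y ∈ K, ∑ x ∈ t, f x y = 1 := by
  classical
  -- Intersecting with unit balls makes the supports compact.
  obtain ⟨t, htK, ht⟩ := hK.elim_nhds_subcover (fun x => W x ∩ Metric.ball x 1)
    fun x hx => inter_mem ((hW x hx).1.mem_nhds (hW x hx).2) (Metric.ball_mem_nhds x one_pos)
  obtain ⟨f, hf⟩ := SmoothPartitionOfUnity.exists_isSubordinate (modelWithCornersSelf ℝ E)
    hK.isClosed (fun x : t => W x ∩ Metric.ball (x : E) 1)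
    (fun x => (hW x (htK x x.2)).1.inter Metric.isOpen_ball)
    (fun y hy => by
      obtain ⟨x, hx, hyx⟩ := mem_iUnion₂.1 (ht hy)
      exact mem_iUnion.2 ⟨⟨x, hx⟩, hyx⟩)
  refine ⟨t, fun x y => if h : x ∈ t then f ⟨x, h⟩ y else 0, htK, fun x hx => ?_, fun x hx => ?_,
    fun x hx => ?_, fun y hy => ?_⟩
  · simp only [hx, dite_true]
    exact (f ⟨x, hx⟩).contMDiff.contDiff
  · simp only [hx, dite_true]
    exact (isCompact_closedBall x 1).of_isClosed_subset (isClosed_tsupport _)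
      ((hf ⟨x, hx⟩).trans (inter_subset_right.trans Metric.ball_subset_closedBall))
  · simp only [hx, dite_true]
    exact (hf ⟨x, hx⟩).trans inter_subset_left
  · have h1 := f.sum_eq_one hy
    rw [finsum_eq_sum_of_fintype] at h1
    rw [← h1, ← Finset.sum_coe_sort t]
    exact Finset.sum_congr rfl fun x _ => by simp

variable [MeasurableSpace E] [BorelSpace E]

/-- The Fourier transform of the indicator function of `Ω`, localized by the amplitude `φ`. -/
noncomputable def localTransform (Ω : Set E) (φ : E → ℂ) (Θ : E) (σ : ℝ) : ℂ :=
  ∫ x in Ω, φ x * Complex.exp (-(2 * Real.pi * Complex.I * σ * (⟪Θ, x⟫ : ℝ)))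

lemma integrableOn_localTransform (hΩ : IsCompact Ω) {φ : E → ℂ} (hφ : Continuous φ) (Θ : E)
    (σ : ℝ) : IntegrableOn
      (fun x => φ x * Complex.exp (-(2 * Real.pi * Complex.I * σ * (⟪Θ, x⟫ : ℝ)))) Ω :=
  (by fun_prop : Continuous _).continuousOn.integrableOn_compact hΩ

lemma continuous_localTransform (hΩ : IsCompact Ω) {φ : E → ℂ} (hφ : Continuous φ) (Θ : E) :
    Continuous (localTransform Ω φ Θ) := by
  have h : ∀ σ : ℝ, localTransform Ω φ Θ σ = ∫ x in Ω, φ x *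
      Complex.exp ((σ : ℂ) * (-(2 * Real.pi * Complex.I * (⟪Θ, x⟫ : ℝ)))) := fun σ => by
    rw [localTransform]
    congr 1
    funext x
    congr 2
    ring
  have h1 : Continuous (fun s : ℂ => ∫ x in Ω, φ x *
      Complex.exp (s * (-(2 * Real.pi * Complex.I * (⟪Θ, x⟫ : ℝ))))) :=
    continuous_iff_continuousAt.2 fun s =>
      (hasDerivAt_setIntegral_mul_cexp (μ := volume) hΩ hφ (by fun_prop) s).continuousAt
  rw [funext h]
  exact h1.comp Complex.continuous_ofReal

/-- The contribution of the points that are not poles. -/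
lemma exists_nhds_sum_rapid_decay (hΩ : IsCompact Ω) (hconv : Convex ℝ Ω)
    (hgraph : ∀ x ∈ frontier Ω, ∃ n F r κ, IsStrictGraph Ω n x F r κ ∧ F x = 0) {Θ₀ : E}
    (hΘ₀ : ‖Θ₀‖ = 1) {K : Set E} (hK : IsCompact K)
    (hmax : ∀ y ∈ K, ∃ x ∈ Ω, ⟪Θ₀, y⟫ < ⟪Θ₀, x⟫) (hmin : ∀ y ∈ K, ∃ x ∈ Ω, ⟪Θ₀, x⟫ < ⟪Θ₀, y⟫)
    {ζ : E → ℝ} (hζ : ContDiff ℝ ∞ ζ) (hζ0 : ∀ x ∈ Ω \ K, ζ x = 0) (N : ℕ) :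
    ∃ C, 0 ≤ C ∧ ∀ᶠ Θ in 𝓝 Θ₀, ‖Θ‖ = 1 → ∀ σ : ℝ, 0 < σ →
      ‖localTransform Ω (fun x => (ζ x : ℂ)) Θ σ‖ ≤ C * (σ ^ N)⁻¹ := by
  classical
  have hloc : ∀ x : E, ∃ W : Set E, x ∈ K → IsOpen W ∧ x ∈ W ∧ ∃ O ∈ 𝓝 Θ₀, ∀ φ : E → ℂ,
      ContDiff ℝ ∞ φ → HasCompactSupport φ → tsupport φ ⊆ W → ∀ N : ℕ, ∃ C, 0 ≤ C ∧
      ∀ Θ ∈ O, ‖Θ‖ = 1 → ∀ σ : ℝ, 0 < σ → ‖localTransform Ω φ Θ σ‖ ≤ C * (σ ^ N)⁻¹ := by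
    intro x
    by_cases hx : x ∈ K
    · obtain ⟨W, h1, h2, h3⟩ := exists_nhds_rapid_decay hΩ hconv hΘ₀ (hgraph x) (hmax x hx)
        (hmin x hx)
      exact ⟨W, fun _ => ⟨h1, h2, h3⟩⟩
    · exact ⟨univ, fun h => absurd h hx⟩
  choose W hW using hloc
  obtain ⟨t, f, htK, hf1, hf2, hf3, hf4⟩ := exists_smooth_partition hK
    fun x hx => ⟨(hW x hx).1, (hW x hx).2.1⟩
  have hterm : ∀ x : E, ∃ C, x ∈ t → 0 ≤ C ∧ ∀ᶠ Θ in 𝓝 Θ₀, ‖Θ‖ = 1 → ∀ σ : ℝ, 0 < σ →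
      ‖localTransform Ω (fun y => ((f x y * ζ y : ℝ) : ℂ)) Θ σ‖ ≤ C * (σ ^ N)⁻¹ := by
    intro x
    by_cases hx : x ∈ t
    swap
    · exact ⟨0, fun h => absurd h hx⟩
    obtain ⟨O, hO, h⟩ := (hW x (htK x hx)).2.2
    have hsupp : tsupport (fun y => ((f x y * ζ y : ℝ) : ℂ)) ⊆ tsupport (f x) :=
      closure_mono fun y hy => by
        simp only [Function.mem_support, ne_eq, Complex.ofReal_eq_zero, mul_eq_zero, not_or] at hy
        exact hy.1
    obtain ⟨C, hC, h'⟩ := h (fun y => ((f x y * ζ y : ℝ) : ℂ))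
      ((hf1 x hx).mul hζ).complex_ofReal
      ((hf2 x hx).of_isClosed_subset (isClosed_tsupport _) hsupp) (hsupp.trans (hf3 x hx)) N
    exact ⟨C, fun _ => ⟨hC, by filter_upwards [hO] with Θ hΘ using h' Θ hΘ⟩⟩
  choose C hC using hterm
  refine ⟨∑ x ∈ t, C x, Finset.sum_nonneg fun x hx => (hC x hx).1, ?_⟩
  have hev : ∀ᶠ Θ in 𝓝 Θ₀, ∀ x ∈ t, ‖Θ‖ = 1 → ∀ σ : ℝ, 0 < σ →
      ‖localTransform Ω (fun y => ((f x y * ζ y : ℝ) : ℂ)) Θ σ‖ ≤ C x * (σ ^ N)⁻¹ :=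
    (Filter.eventually_all_finset t).2 fun x hx => (hC x hx).2
  filter_upwards [hev] with Θ hΘ hΘ1 σ hσ
  have hsum : localTransform Ω (fun x => (ζ x : ℂ)) Θ σ =
      ∑ x ∈ t, localTransform Ω (fun y => ((f x y * ζ y : ℝ) : ℂ)) Θ σ := by
    simp only [localTransform]
    rw [← integral_finsetSum]
    · refine setIntegral_congr_fun hΩ.measurableSet fun y hy => ?_
      rw [← Finset.sum_mul, ← Complex.ofReal_sum, ← Finset.sum_mul]
      by_cases hyK : y ∈ K
      · rw [hf4 y hyK, one_mul]
      · rw [hζ0 y ⟨hy, hyK⟩, mul_zero]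
    · intro x hx
      exact integrableOn_localTransform hΩ ((hf1 x hx).mul hζ).complex_ofReal.continuous Θ σ
  rw [hsum, Finset.sum_mul]
  exact (norm_sum_le _ _).trans (Finset.sum_le_sum fun x hx => hΘ x hx hΘ1 σ hσ)

/-- The lower bound for the quadratic mean, locally uniformly in the direction. -/
theorem exists_nhds_le_integral (hΩ : IsCompact Ω) (hconv : Convex ℝ Ω)
    (hint : (interior Ω).Nonempty)
    (hgraph : ∀ x ∈ frontier Ω, ∃ n F r κ, IsStrictGraph Ω n x F r κ ∧ F x = 0) {Θ₀ : E}
    (hΘ₀ : ‖Θ₀‖ = 1) :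
    ∃ c R, 0 < c ∧ 1 ≤ R ∧ ∀ᶠ Θ in 𝓝 Θ₀, ‖Θ‖ = 1 → ∀ ρ, R ≤ ρ →
      c * ρ ^ (-((Module.finrank ℝ E : ℝ) + 1)) ≤
        ∫ σ in ρ..(ρ + 1), ‖localTransform Ω (fun _ => 1) Θ σ‖ ^ 2 := by
  have hΘne : Θ₀ ≠ 0 := fun h => by simp [h] at hΘ₀
  have hne : Ω.Nonempty := hint.mono interior_subset
  have hex : ∀ Θ : E, ∃ p ∈ Ω, ∀ x ∈ Ω, ⟪Θ, x⟫ ≤ ⟪Θ, p⟫ := fun Θ =>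
    hΩ.exists_isMaxOn hne (f := fun x => ⟪Θ, x⟫) (by fun_prop)
  have hex' : ∀ Θ : E, ∃ p ∈ Ω, ∀ x ∈ Ω, ⟪Θ, p⟫ ≤ ⟪Θ, x⟫ := fun Θ =>
    hΩ.exists_isMinOn hne (f := fun x => ⟪Θ, x⟫) (by fun_prop)
  obtain ⟨p, hp, hpmax⟩ := hex Θ₀
  obtain ⟨q, hq, hqmin⟩ := hex' Θ₀
  have hqmax : ∀ x ∈ Ω, ⟪-Θ₀, x⟫ ≤ ⟪-Θ₀, q⟫ := fun x hx => by
    rw [inner_neg_left, inner_neg_left]; linarith [hqmin x hx]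
  -- Otherwise the functional is constant on `Ω`, and an interior point would be a maximum point.
  have hlt : ⟪Θ₀, q⟫ < ⟪Θ₀, p⟫ := by
    by_contra! hcon
    obtain ⟨x, hx⟩ := hint
    have hxΩ := interior_subset hx
    refine (mem_frontier_of_isMaxOn hΘne hxΩ fun y hy => ?_).2 hx
    linarith [hpmax y hy, hqmin x hxΩ]
  have hpq : p ≠ q := fun h => by rw [h] at hlt; exact lt_irrefl _ hlt
  obtain ⟨n, F, r, κ, H, hF0⟩ := hgraph p (mem_frontier_of_isMaxOn hΘne hp hpmax)
  obtain ⟨n', F', r', κ', H', hF0'⟩ :=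
    hgraph q (mem_frontier_of_isMaxOn (neg_ne_zero.2 hΘne) hq hqmax)
  have hΘp := (H.eq_normalized_gradient_of_isMaxOn (Metric.mem_ball_self H.r_pos) hp hpmax hΘ₀).2
  have hΘq := (H'.eq_normalized_gradient_of_isMaxOn (Metric.mem_ball_self H'.r_pos) hq hqmax
    (by rwa [norm_neg])).2
  have hpu : ∀ y ∈ Ω, ⟪Θ₀, p⟫ ≤ ⟪Θ₀, y⟫ → y = p := fun y hy h =>
    H.eq_of_isMaxOn hΩ hconv hF0 hp hy (by
      rw [← hΘp]; exact fun x hx => (hpmax x hx).trans h)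
  have hqu : ∀ y ∈ Ω, ⟪Θ₀, y⟫ ≤ ⟪Θ₀, q⟫ → y = q := fun y hy h =>
    H'.eq_of_isMaxOn hΩ hconv hF0' hq hy (by
      rw [← hΘq]
      intro x hx
      rw [inner_neg_left, inner_neg_left]
      linarith [hqmin x hx])
  -- With this radius the supports of the two cutoffs are disjoint. Near each pole one cutoff is `1`
  -- and the other `0`, so `1 - η - η'` vanishes there and only nonpoles remain.
  set ε := dist p q / 2 with hε
  have hε0 : 0 < ε := by have := dist_pos.2 hpq; positivity
  obtain ⟨η, hη, hηs, hη1, c, C₁, R₁, hc, hC₁, hR₁, hA⟩ :=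
    H.exists_cutoff_bounds hΩ hconv hF0 hp hΘp hε0
  obtain ⟨η', hη', hηs', hη1', C₂, R₂, hC₂, hR₂, hB⟩ :=
    H'.exists_cutoff_bounds_neg hΩ hconv hF0' hq hΘq hε0
  have hdisj : ∀ x, x ∈ Metric.ball p ε → x ∉ Metric.ball q ε := fun x h1 h2 => by
    rw [Metric.mem_ball] at h1 h2
    have := dist_triangle_left p q x
    linarith
  have hz : ∀ (g : E → ℝ) (x z : E), tsupport g ⊆ Metric.ball z ε → x ∉ Metric.ball z ε →
      g x = 0 := fun g x z h1 h2 => by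
    by_contra h
    exact h2 (h1 (subset_tsupport _ h))
  obtain ⟨s, hs, hsball⟩ := Metric.eventually_nhds_iff_ball.1 hη1
  obtain ⟨s', hs', hsball'⟩ := Metric.eventually_nhds_iff_ball.1 hη1'
  -- the remaining part
  set K : Set E := Ω \ (Metric.ball p (min s ε) ∪ Metric.ball q (min s' ε)) with hK
  have hKc : IsCompact K := hΩ.diff (Metric.isOpen_ball.union Metric.isOpen_ball)
  set a : ℝ := ((Module.finrank ℝ E : ℝ) + 1) / 2 with ha
  obtain ⟨C₃, hC₃, hE⟩ := exists_nhds_sum_rapid_decay hΩ hconv hgraph hΘ₀ hKc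
    (fun y hy => ⟨p, hp, lt_of_not_ge fun h => hy.2 (Or.inl (by
      rw [hpu y hy.1 h]; exact Metric.mem_ball_self (lt_min hs hε0)))⟩)
    (fun y hy => ⟨q, hq, lt_of_not_ge fun h => hy.2 (Or.inr (by
      rw [hqu y hy.1 h]; exact Metric.mem_ball_self (lt_min hs' hε0)))⟩)
    (ζ := fun x => 1 - η x - η' x) ((contDiff_const.sub hη).sub hη')
    (fun x hx => by
      have hx' : x ∈ Metric.ball p (min s ε) ∪ Metric.ball q (min s' ε) := by
        by_contra h
        exact hx.2 ⟨hx.1, h⟩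
      rcases hx' with h | h
      · rw [hsball x (Metric.ball_subset_ball (min_le_left _ _) h),
          hz η' x q hηs' (hdisj x (Metric.ball_subset_ball (min_le_right _ _) h))]
        ring
      · rw [hsball' x (Metric.ball_subset_ball (min_le_left _ _) h),
          hz η x p hηs fun h' => hdisj x h' (Metric.ball_subset_ball (min_le_right _ _) h)]
        ring) (Module.finrank ℝ E + 2)
  -- separation of the frequencies
  set w := ⟪Θ₀, p⟫ - ⟪Θ₀, q⟫ with hw
  have hw0 : 0 < w := by linarith
  -- This gives `δ ≤ 1 / 2` and `0 < δ w < 1`, so `exp(-2πiδw) ≠ 1` and the two unimodular factors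
  -- differ.
  set δ := 1 / (2 * (1 + w)) with hδ
  have hδ0 : 0 < δ := by positivity
  have hδ1 : δ ≤ 1 / 2 := by
    rw [hδ]; gcongr; linarith
  have hδw : δ * w < 1 := by
    rw [hδ, div_mul_eq_mul_div, div_lt_one (by positivity)]; linarith
  -- The separation depends continuously on the direction and the two poles, and the poles depend
  -- stably on the direction; so half of it persists nearby.
  let sep : E × E × E → ℝ := fun z =>
    ‖Complex.exp (-(2 * Real.pi * Complex.I * δ * ((⟪z.1, z.2.1⟫ : ℝ) : ℂ))) -
      Complex.exp (-(2 * Real.pi * Complex.I * δ * ((⟪z.1, z.2.2⟫ : ℝ) : ℂ)))‖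
  have hsepc : Continuous sep := by
    have : Continuous (fun z : E × E × E => ⟪z.1, z.2.1⟫) :=
      continuous_fst.inner (continuous_fst.comp continuous_snd)
    have : Continuous (fun z : E × E × E => ⟪z.1, z.2.2⟫) :=
      continuous_fst.inner (continuous_snd.comp continuous_snd)
    fun_prop
  have hsep0 : 0 < sep (Θ₀, p, q) := by
    simp only [sep]
    rw [norm_pos_iff, sub_ne_zero]
    intro h
    obtain ⟨m, hm⟩ := Complex.exp_eq_exp_iff_exists_int.1 h
    have h1 : (2 * Real.pi * Complex.I) * (((-(δ * w) : ℝ)) : ℂ) =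
        (2 * Real.pi * Complex.I) * (m : ℂ) := by
      rw [hw]
      push_cast
      linear_combination hm
    have h2 := mul_left_cancel₀ Complex.two_pi_I_ne_zero h1
    have h3 : -(δ * w) = (m : ℝ) := by exact_mod_cast h2
    have h4 : 0 < δ * w := by positivity
    have h5 : (m : ℝ) < 0 := by linarith
    have h6 : (-1 : ℝ) < m := by linarith
    have h7 : m < 0 := by exact_mod_cast h5
    have h8 : (-1 : ℤ) < m := by exact_mod_cast h6
    omega
  set b := sep (Θ₀, p, q) / 2 with hb
  have hb0 : 0 < b := half_pos hsep0
  obtain ⟨ε', hε', hball⟩ := Metric.eventually_nhds_iff_ball.1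
    (hsepc.continuousAt.eventually_const_lt (half_lt_self hsep0))
  have ha0 : 0 ≤ a := by positivity
  obtain ⟨c', R, hc', hR, hmain⟩ := exists_le_integral_norm_sq (a := a) (c := c)
    (C := max (max C₁ C₂) C₃) (R₀ := max R₁ R₂) (b := b) (δ := δ) ha0 hc
    (hC₃.trans (le_max_right _ _)) (hR₁.trans (le_max_left _ _)) hb0 hδ0 hδ1
  refine ⟨c', R, hc', hR, ?_⟩
  filter_upwards [hA ε' hε', hB ε' hε', hE, Metric.ball_mem_nhds Θ₀ hε']
    with Θ hΘA hΘB hΘE hΘb hΘ1 ρ hρ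
  obtain ⟨P, hP, hPmax⟩ := hex Θ
  obtain ⟨Q, hQ, hQmin⟩ := hex' Θ
  obtain ⟨hPb, A, A', hAσ⟩ := hΘA hΘ1 P hP hPmax
  obtain ⟨hQb, B, B', hBσ⟩ := hΘB hΘ1 Q hQ hQmin
  have hexp : -((Module.finrank ℝ E : ℝ) + 1) = -(2 * a) := by rw [ha]; ring
  rw [hexp]
  refine hmain _ A B A' B' ⟪Θ, P⟫ ⟪Θ, Q⟫ (continuous_localTransform hΩ continuous_const Θ)
    (fun σ hσ => ?_) (fun σ hσ => ?_) (fun σ hσ => ?_) ?_ ρ hρ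
  · have hσ0 : 0 < σ := by linarith [(le_max_left R₁ R₂).trans hσ]
    obtain ⟨⟨h1, h2, h3⟩, -⟩ := hAσ σ ((le_max_left _ _).trans hσ)
    refine ⟨h1, h2, h3.trans ?_⟩
    gcongr
    exact (le_max_left _ _).trans (le_max_left _ _)
  · have hσ0 : 0 < σ := by linarith [(le_max_left R₁ R₂).trans hσ]
    obtain ⟨⟨h1, h3⟩, -⟩ := hBσ σ ((le_max_right _ _).trans hσ)
    refine ⟨h1, h3.trans ?_⟩
    gcongr
    exact (le_max_right _ _).trans (le_max_left _ _)
  · have hσ1 : 1 ≤ σ := by linarith [(le_max_left R₁ R₂).trans hσ]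
    have hσ0 : 0 < σ := by linarith
    rw [← (hAσ σ ((le_max_left _ _).trans hσ)).2, ← (hBσ σ ((le_max_right _ _).trans hσ)).2]
    have hi := fun (φ : E → ℂ) (hφ : Continuous φ) => integrableOn_localTransform hΩ hφ Θ σ
    have hsplit : localTransform Ω (fun _ => 1) Θ σ -
        ((∫ x in Ω, (η x : ℂ) * Complex.exp (-(2 * Real.pi * Complex.I * σ * (⟪Θ, x⟫ : ℝ)))) +
        ∫ x in Ω, (η' x : ℂ) * Complex.exp (-(2 * Real.pi * Complex.I * σ * (⟪Θ, x⟫ : ℝ)))) =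
        localTransform Ω (fun x => ((1 - η x - η' x : ℝ) : ℂ)) Θ σ := by
      have i1 := hi (fun _ => 1) continuous_const
      have i2 := hi _ hη.complex_ofReal.continuous
      have i3 := hi _ hη'.complex_ofReal.continuous
      have i4 := integral_add i2 i3
      have i5 := integral_sub i1 (i2.add i3)
      simp only [Pi.add_apply] at i4 i5
      rw [localTransform, localTransform, ← i4, ← i5]
      congr 1
      funext x
      push_cast
      ring
    rw [hsplit]
    refine (hΘE hΘ1 σ hσ0).trans ?_
    -- The decay of order `d + 2` exceeds `1 + (d + 1) / 2`, so the remainder is as small as the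
    -- admissible error.
    have h1 : (σ ^ (Module.finrank ℝ E + 2))⁻¹ ≤ σ⁻¹ * σ ^ (-a) := by
      rw [pow_succ, mul_inv, mul_comm, ← Real.rpow_natCast, ← Real.rpow_neg hσ0.le]
      gcongr
      rw [ha]
      push_cast
      linarith [(Nat.cast_nonneg (Module.finrank ℝ E) : (0:ℝ) ≤ _)]
    rw [mul_assoc]
    gcongr
    exact le_max_right _ _
  · refine (hball (Θ, P, Q) ?_).le
    rw [Metric.mem_ball, Prod.dist_eq, Prod.dist_eq]
    exact max_lt hΘb (max_lt hPb hQb)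

end LocalBound

/-! ### Uniformity over all directions and all `ρ ≥ 1`. -/

section GlobalBound

variable {E : Type*} [NormedAddCommGroup E] [InnerProductSpace ℝ E] [FiniteDimensional ℝ E]
  [MeasurableSpace E] [BorelSpace E] {Ω : Set E}

lemma continuous_localTransform_one (hΩ : IsCompact Ω) :
    Continuous (fun q : E × ℝ => localTransform Ω (fun _ => 1) q.1 q.2) := by
  unfold localTransform
  refine continuous_parametric_integral_of_continuous ?_ hΩ
  simp only [Function.uncurry_def]
  have : Continuous (fun q : (E × ℝ) × E => ⟪q.1.1, q.2⟫) :=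
    (continuous_fst.comp continuous_fst).inner continuous_snd
  fun_prop

/-- Along a line the transform extends to an entire function of `σ` whose value at `0` is the volume
of `Ω`. It is not identically zero, so it cannot vanish on an interval. -/
lemma integral_norm_sq_localTransform_pos (hΩ : IsCompact Ω) (hint : (interior Ω).Nonempty)
    (Θ : E) (ρ : ℝ) :
    0 < ∫ σ in ρ..(ρ + 1), ‖localTransform Ω (fun _ => 1) Θ σ‖ ^ 2 := by
  let h : ℂ → ℂ := fun s => ∫ x in Ω, 1 *
    Complex.exp (s * (-(2 * Real.pi * Complex.I * (⟪Θ, x⟫ : ℝ))))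
  have hh : ∀ σ : ℝ, localTransform Ω (fun _ => 1) Θ σ = h σ := fun σ => by
    simp only [localTransform, h]
    congr 1
    funext x
    congr 2
    ring
  have hd : Differentiable ℂ h := fun s =>
    (hasDerivAt_setIntegral_mul_cexp (μ := volume) hΩ continuous_const (by fun_prop)
      s).differentiableAt
  have hc := (continuous_localTransform hΩ (continuous_const (y := (1:ℂ))) Θ).norm.pow 2
  have hcpt : ∃ σ ∈ Ioo ρ (ρ + 1), localTransform Ω (fun _ => 1) Θ σ ≠ 0 := by
    by_contra! hzero
    have hfreq : ∃ᶠ z in 𝓝[≠] (((ρ + 1 / 2 : ℝ)) : ℂ), h z = (fun _ => (0:ℂ)) z := by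
      have hinj : Tendsto (fun σ : ℝ => (σ : ℂ)) (𝓝[≠] (ρ + 1 / 2)) (𝓝[≠] ((ρ + 1 / 2 : ℝ) : ℂ)) :=
        tendsto_nhdsWithin_of_tendsto_nhds_of_eventually_within _
          (Complex.continuous_ofReal.continuousAt.tendsto.mono_left nhdsWithin_le_nhds)
          (by filter_upwards [self_mem_nhdsWithin] with σ hσ
              exact fun h => hσ (Complex.ofReal_injective h))
      refine hinj.frequently (Eventually.frequently ?_)
      filter_upwards [nhdsWithin_le_nhds (Ioo_mem_nhds (show ρ < ρ + 1 / 2 by linarith)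
        (show ρ + 1 / 2 < ρ + 1 by linarith))] with σ hσ
      rw [← hh, hzero σ hσ]
    have heq := (hd.differentiableOn.analyticOnNhd isOpen_univ).eq_of_frequently_eq
      (analyticOnNhd_const) hfreq
    have h0 := congrFun heq 0
    simp only [h, zero_mul, Complex.exp_zero, mul_one, setIntegral_const, Complex.real_smul,
      Complex.ofReal_eq_zero, measureReal_eq_zero_iff hΩ.measure_lt_top.ne] at h0
    obtain ⟨x, hx⟩ := hint
    exact (Measure.measure_pos_of_mem_nhds volume (mem_interior_iff_mem_nhds.1 hx)).ne' h0
  obtain ⟨σ, hσ, hne⟩ := hcpt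
  refine intervalIntegral.integral_pos (by linarith) hc.continuousOn
    (fun x _ => by positivity) ⟨σ, Ioo_subset_Icc_self hσ, ?_⟩
  have := norm_pos_iff.2 hne
  positivity

/-- The lower bound for the quadratic mean of the Fourier transform of a convex set whose boundary
is locally a strictly convex graph. -/
theorem exists_le_integral_of_isStrictGraph (hΩ : IsCompact Ω) (hconv : Convex ℝ Ω)
    (hint : (interior Ω).Nonempty)
    (hgraph : ∀ x ∈ frontier Ω, ∃ n F r κ, IsStrictGraph Ω n x F r κ ∧ F x = 0) :
    ∃ C, 0 < C ∧ ∀ Θ : E, ‖Θ‖ = 1 → ∀ ρ : ℝ, 1 ≤ ρ →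
      C * ρ ^ (-((Module.finrank ℝ E : ℝ) + 1)) ≤
        ∫ σ in ρ..(ρ + 1), ‖localTransform Ω (fun _ => 1) Θ σ‖ ^ 2 := by
  set D := (Module.finrank ℝ E : ℝ) + 1 with hD
  have hD0 : 0 ≤ D := by positivity
  have hlarge : ∃ c R, 0 < c ∧ 1 ≤ R ∧ ∀ Θ ∈ Metric.sphere (0:E) 1, ∀ ρ, R ≤ ρ →
      c * ρ ^ (-D) ≤ ∫ σ in ρ..(ρ + 1), ‖localTransform Ω (fun _ => 1) Θ σ‖ ^ 2 := by
    refine (isCompact_sphere (0:E) 1).induction_on (p := fun S => ∃ c R, 0 < c ∧ 1 ≤ R ∧ ∀ Θ ∈ S,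
      ∀ ρ, R ≤ ρ → c * ρ ^ (-D) ≤
        ∫ σ in ρ..(ρ + 1), ‖localTransform Ω (fun _ => 1) Θ σ‖ ^ 2) ?_ ?_ ?_ ?_
    · exact ⟨1, 1, one_pos, le_rfl, by simp⟩
    · rintro S T hST ⟨c, R, hc, hR, h⟩
      exact ⟨c, R, hc, hR, fun Θ hΘ => h Θ (hST hΘ)⟩
    · rintro S T ⟨c, R, hc, hR, h⟩ ⟨c', R', hc', hR', h'⟩
      refine ⟨min c c', max R R', lt_min hc hc', hR.trans (le_max_left _ _), ?_⟩
      intro Θ hΘ ρ hρ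
      have hρ1 : 1 ≤ ρ := (hR.trans (le_max_left _ _)).trans hρ
      have hρ0 : 0 ≤ ρ ^ (-D) := Real.rpow_nonneg (by linarith) _
      rcases hΘ with hΘ | hΘ
      · refine le_trans ?_ (h Θ hΘ ρ ((le_max_left _ _).trans hρ))
        gcongr
        exact min_le_left _ _
      · refine le_trans ?_ (h' Θ hΘ ρ ((le_max_right _ _).trans hρ))
        gcongr
        exact min_le_right _ _
    · intro Θ₀ hΘ₀
      obtain ⟨c, R, hc, hR, h⟩ := exists_nhds_le_integral hΩ hconv hint hgraph
        (mem_sphere_zero_iff_norm.1 hΘ₀)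
      refine ⟨{Θ | ‖Θ‖ = 1 → ∀ ρ, R ≤ ρ → c * ρ ^ (-D) ≤
        ∫ σ in ρ..(ρ + 1), ‖localTransform Ω (fun _ => 1) Θ σ‖ ^ 2} ∩ Metric.sphere 0 1,
        inter_mem (mem_nhdsWithin_of_mem_nhds h) self_mem_nhdsWithin, c, R, hc, hR,
        fun Θ hΘ => hΘ.1 (mem_sphere_zero_iff_norm.1 hΘ.2)⟩
  obtain ⟨c, R, hc, hR, hl⟩ := hlarge
  -- For `ρ` in `[1, R]` the mean is continuous and positive on a compact set, and `ρ^(-D) ≤ 1`, so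
  -- no decay estimate is needed.
  have hsmall : ∃ m, 0 < m ∧ ∀ Θ ∈ Metric.sphere (0:E) 1, ∀ ρ ∈ Icc 1 R,
      m ≤ ∫ σ in ρ..(ρ + 1), ‖localTransform Ω (fun _ => 1) Θ σ‖ ^ 2 := by
    let G : E × ℝ → ℝ := fun q => ∫ σ in q.2..(q.2 + 1), ‖localTransform Ω (fun _ => 1) q.1 σ‖ ^ 2
    have hG : Continuous G := by
      have h1 : ∀ q : E × ℝ, G q =
          ∫ t in (0:ℝ)..1, ‖localTransform Ω (fun _ => 1) q.1 (t + q.2)‖ ^ 2 := fun q => by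
        simp only [G]
        rw [intervalIntegral.integral_comp_add_right
          (fun σ => ‖localTransform Ω (fun _ => 1) q.1 σ‖ ^ 2) q.2, zero_add, add_comm]
      rw [funext h1]
      refine intervalIntegral.continuous_parametric_intervalIntegral_of_continuous' ?_ 0 1
      have h2 : Continuous (fun z : (E × ℝ) × ℝ => ((z.1.1, z.2 + z.1.2) : E × ℝ)) := by fun_prop
      exact ((continuous_localTransform_one hΩ).comp h2).norm.pow 2
    -- The sphere is empty in dimension zero.
    rcases (Metric.sphere (0:E) 1 ×ˢ Icc 1 R).eq_empty_or_nonempty with h | h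
    · refine ⟨1, one_pos, fun Θ hΘ ρ hρ => ?_⟩
      have : (Θ, ρ) ∈ Metric.sphere (0:E) 1 ×ˢ Icc 1 R := ⟨hΘ, hρ⟩
      rw [h] at this
      exact absurd this (notMem_empty _)
    · obtain ⟨q, -, hq⟩ := ((isCompact_sphere (0:E) 1).prod isCompact_Icc).exists_isMinOn h
        hG.continuousOn
      exact ⟨G q, integral_norm_sq_localTransform_pos hΩ hint q.1 q.2,
        fun Θ hΘ ρ hρ => isMinOn_iff.1 hq (Θ, ρ) (mk_mem_prod hΘ hρ)⟩
  obtain ⟨m, hm, hs⟩ := hsmall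
  refine ⟨min c m, lt_min hc hm, fun Θ hΘ ρ hρ => ?_⟩
  have hΘ' : Θ ∈ Metric.sphere (0:E) 1 := mem_sphere_zero_iff_norm.2 hΘ
  have hρ0 : 0 ≤ ρ ^ (-D) := Real.rpow_nonneg (by linarith) _
  rcases le_total R ρ with h | h
  · refine le_trans ?_ (hl Θ hΘ' ρ h)
    gcongr
    exact min_le_left _ _
  · refine le_trans ?_ (hs Θ hΘ' ρ ⟨hρ, h⟩)
    have h1 : ρ ^ (-D) ≤ 1 := Real.rpow_le_one_of_one_le_of_nonpos hρ (by linarith)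
    calc min c m * ρ ^ (-D) ≤ m * 1 := by
          gcongr
          exact min_le_right _ _
      _ = m := mul_one m

lemma fourierIndicator_smul {d : ℕ} {Ω : Set (EuclideanSpace ℝ (Fin d))} (hΩ : MeasurableSet Ω)
    (Θ : EuclideanSpace ℝ (Fin d)) (s : ℝ) :
    fourierIndicator Ω (s • Θ) = localTransform Ω (fun _ => 1) Θ s := by
  rw [fourierIndicator, Real.fourier_eq', localTransform, ← integral_indicator hΩ]
  congr 1
  funext x
  by_cases hx : x ∈ Ω
  · simp only [hx, indicator_of_mem, smul_eq_mul, mul_one, one_mul]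
    congr 1
    rw [inner_smul_right, real_inner_comm]
    push_cast
    ring
  · simp [hx]

end GlobalBound

theorem theorem6 {d : ℕ} (Ω : ConvexBody (EuclideanSpace ℝ (Fin d)))
    (hint : (interior (Ω : Set (EuclideanSpace ℝ (Fin d)))).Nonempty)
    (hsmooth : HasSmoothBoundary (Ω : Set (EuclideanSpace ℝ (Fin d))))
    (hcurv : HasPositiveGaussianCurvature (Ω : Set (EuclideanSpace ℝ (Fin d)))) :
    ∃ C : ℝ, 0 < C ∧ ∀ Θ : EuclideanSpace ℝ (Fin d), ‖Θ‖ = 1 → ∀ ρ : ℝ, 1 ≤ ρ →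
      C * ρ ^ (-((d : ℤ) + 1)) ≤
        ∫ s in ρ..(ρ + 1), ‖fourierIndicator (Ω : Set (EuclideanSpace ℝ (Fin d))) (s • Θ)‖ ^ 2 := by
  obtain ⟨C, hC, h⟩ := exists_le_integral_of_isStrictGraph Ω.isCompact Ω.convex hint
    fun p hp => by
      obtain ⟨f, hf, hK⟩ := hcurv p hp
      exact exists_isStrictGraph Ω.isCompact.isClosed Ω.convex hp hf hK.ne'
  refine ⟨C, hC, fun Θ hΘ ρ hρ => ?_⟩
  have h1 := h Θ hΘ ρ hρ
  simp only [fourierIndicator_smul Ω.isCompact.measurableSet]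
  convert! h1 using 2
  rw [← Real.rpow_intCast]
  simp
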